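/- Let $a,b>0$, $\Omega=(-a,b)\times(0,1)$, $\Omega_-=(-a,0)\times(0,1)$, $\Omega_+=(0,b)\times(0,1)$. Let $j:(-a,b)\to[0,\infty)$ satisfy $j>0$ on $(-a,0)$, $j\in L^1_{loc}(-a,0)$ and $j=0$ on $(0,b)$. Let $\alpha\in(1,4/3)$, $h\in(0,1]$ and $p_0\in[1,\infty)$. For $d\ge 0$ and a function $g$ on $(0,1)$, a $p_0$-subsolution on $R=(-a,d)\times(0,1)$ with right-hand datum $g$ is a function $u\in W^{1,1}(R)$, $u>0$ a.e., with $j(x)/\sqrt u\in L^{p_0}(R)$, such that $-\Delta u\le -j(x)/\sqrt u$ in the sense of distributions in $R$ and, in the sense of traces, $u(x,0)=0$ and $u(x,1)\le 1$ for $x\in(-a,d)$, $u(-a,y)\le y^{4/3}$ and $u(d,y)\le g(y)$ for $y\in(0,1)$. The problem $P_{a,b,j}$ is the case $d=b$, $g(y)=y$; the problem $P_{a,0,j}$ is the case $d=0$, $g(y)=hy^\alpha$. Let $u_{0,-}$ be a $p_0$-subsolution of $P_{a,0,j}$ which attains the artificial Dirichlet datum, $u_{0,-}(0,y)=hy^\alpha$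 for $y\in(0,1)$, and which satisfies $$\frac{\partial u_{0,-}}{\partial x}(0,y)\le 0\ \ (0<y<1),\qquad \frac{\partial u_{0,-}}{\partial y}(x,0)=0\ \ (-a<x<0),\qquad u_{0,-}>0\ \text{ in }\Omega_-,$$ where the values on the boundary of $u_{0,-}$ and of its derivatives are understood in the sense of traces (for the derivatives, locally on the open segments; that $\partial_x u_{0,-}\le0$ there means that the positive part of $\partial_x u_{0,-}$ has zero trace). Then there is a bounded classical harmonic function $u_+$ on $\Omega_+$ with $u_+(0,y)=hy^\alpha$ and $u_+(b,y)=y$ for $0<y<1$, $u_+(x,0)=0$ and $u_+(x,1)=1$ for $0<x<b$, continuous on $\overline{\Omega_+}$ (except at the corner $(0,1)$ if $h<1$, where the data jump). For every such $u_+$ the function $\underline u$ equal to $u_{0,-}$ for $x<0$ and to $u_+$ for $x\ge 0$ is a $p_0$-subsolution of $P_{a,b,j}$ and satisfies the additional conditions $AC_{a,b}$: $\partial\underline u/\partial y(x,0)=0$ for $x\in(-a,0)$ (in the same sense) and $\underline u>0$ in $\Omega$. -/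

import Mathlib

open MeasureTheory Set Filter Topology
open scoped ContDiff

noncomputable section

namespace SpaceCharge

/-- The open rectangle `(c, d) × (0, 1)`. -/
def rect (c d : ℝ) : Set (ℝ × ℝ) := Ioo c d ×ˢ Ioo (0 : ℝ) 1

/-- The open vertical segment `{c} × (0, 1)`. -/
def vseg (c : ℝ) : Set (ℝ × ℝ) := {c} ×ˢ Ioo (0 : ℝ) 1

/-- The open horizontal segment `(c, d) × {y}`. -/
def hseg (c d y : ℝ) : Set (ℝ × ℝ) := Ioo c d ×ˢ {y}

/-- `φ` is a test function on `D`, that is, `φ ∈ C_c^∞(D)`. -/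
structure IsTestFunction (D : Set (ℝ × ℝ)) (φ : ℝ × ℝ → ℝ) : Prop where
  smooth : ContDiff ℝ ∞ φ
  compactSupport : HasCompactSupport φ
  support_subset : tsupport φ ⊆ D

/-- The classical Laplacian `∂²f/∂x² + ∂²f/∂y²` in the plane. -/
def lap (f : ℝ × ℝ → ℝ) (p : ℝ × ℝ) : ℝ :=
  iteratedDeriv 2 (fun x => f (x, p.2)) p.1 + iteratedDeriv 2 (fun y => f (p.1, y)) p.2

/-- `v ∈ L¹(D)` is the weak derivative of `u` in the direction `e` in `D`. -/
def IsWeakPartial (D : Set (ℝ × ℝ)) (e : ℝ × ℝ) (u v : ℝ × ℝ → ℝ) : Prop :=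
  IntegrableOn v D ∧ ∀ φ : ℝ × ℝ → ℝ, IsTestFunction D φ →
    ∫ p in D, u p * fderiv ℝ φ p e = - ∫ p in D, v p * φ p

/-- `u ∈ W^{1,1}(D)`. -/
def MemW11 (D : Set (ℝ × ℝ)) (u : ℝ × ℝ → ℝ) : Prop :=
  IntegrableOn u D ∧ (∃ v, IsWeakPartial D (1, 0) u v) ∧ ∃ v, IsWeakPartial D (0, 1) u v

/-- `w` has zero trace on the part `Γ` of the boundary of `D`: the integral of `|w|` over the
layer of width `ε` of `D` around `Γ`, divided by `ε`, tends to `0` as `ε ↓ 0`. (In the sup metric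
of `ℝ × ℝ` the layer of `rect c d` around one of its sides is a strip of width `ε`.) -/
def HasZeroTrace (D Γ : Set (ℝ × ℝ)) (w : ℝ × ℝ → ℝ) : Prop :=
  Tendsto (fun ε : ℝ => (∫⁻ p in D ∩ Metric.thickening ε Γ, ‖w p‖ₑ) / ENNReal.ofReal ε)
    (𝓝[>] 0) (𝓝 0)

/-- `u = g` on `Γ` in the sense of traces. -/
def TraceEq (D Γ : Set (ℝ × ℝ)) (u g : ℝ × ℝ → ℝ) : Prop :=
  HasZeroTrace D Γ (fun p => u p - g p)

/-- `u ≤ g` on `Γ` in the sense of traces. -/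
def TraceLE (D Γ : Set (ℝ × ℝ)) (u g : ℝ × ℝ → ℝ) : Prop :=
  HasZeroTrace D Γ (fun p => max (u p - g p) 0)

/-- The derivative of `u` in the direction `e` vanishes on `Γ`, in the sense of traces on the
compact subsets of `Γ`. -/
def PartialZeroOn (D Γ : Set (ℝ × ℝ)) (e : ℝ × ℝ) (u : ℝ × ℝ → ℝ) : Prop :=
  ∃ v, IsWeakPartial D e u v ∧ ∀ K ⊆ Γ, IsCompact K → TraceEq D K v 0

/-- The derivative of `u` in the direction `e` is nonpositive on `Γ`, in the sense of traces on
the compact subsets of `Γ`. -/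
def PartialNonposOn (D Γ : Set (ℝ × ℝ)) (e : ℝ × ℝ) (u : ℝ × ℝ → ℝ) : Prop :=
  ∃ v, IsWeakPartial D e u v ∧ ∀ K ⊆ Γ, IsCompact K → TraceLE D K v 0

/-- The standing assumptions on the coefficient `j : (-a, b) → [0, ∞)`. -/
structure IsCurrentDensity (a b : ℝ) (j : ℝ → ℝ) : Prop where
  nonneg : ∀ x ∈ Ioo (-a) b, 0 ≤ j x
  pos : ∀ x ∈ Ioo (-a) 0, 0 < j x
  locInt : LocallyIntegrableOn j (Ioo (-a) 0)
  zero : ∀ x ∈ Ioo 0 b, j x = 0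

/-- `u` is a `p`-positive subsolution, on `(-a, b) × (0, 1)`, of `-Δu + j(x)/√u = 0` with the
boundary data `u(x,0) = 0`, `u(x,1) = 1`, `u(-a,y) = y^{4/3}` and `u(b,y) = g(y)`. -/
structure IsPosSubsolution (a b : ℝ) (j : ℝ → ℝ) (g : ℝ → ℝ) (p : ℝ) (u : ℝ × ℝ → ℝ) : Prop where
  memW11 : MemW11 (rect (-a) b) u
  pos : ∀ᵐ q ∂(volume.restrict (rect (-a) b)), 0 < u q
  memLp : MemLp (fun q : ℝ × ℝ => j q.1 / √(u q)) (ENNReal.ofReal p)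
    (volume.restrict (rect (-a) b))
  /-- `-Δu ≤ -j(x)/√u` in the sense of distributions. -/
  ineq : ∀ φ : ℝ × ℝ → ℝ, IsTestFunction (rect (-a) b) φ → (∀ q, 0 ≤ φ q) →
    ∫ q in rect (-a) b, u q * (- lap φ q) ≤ ∫ q in rect (-a) b, -(j q.1 / √(u q)) * φ q
  bottom : TraceEq (rect (-a) b) (hseg (-a) b 0) u (fun _ => 0)
  top : TraceLE (rect (-a) b) (hseg (-a) b 1) u (fun _ => 1)
  left : TraceLE (rect (-a) b) (vseg (-a)) u (fun q => q.2 ^ (4 / 3 : ℝ))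
  right : TraceLE (rect (-a) b) (vseg b) u (fun q => g q.2)

/-- The additional conditions `∂u/∂y(x,0) = 0` for `x ∈ (-a, 0)` and `u > 0` in
`(-a, b) × (0, 1)`. -/
structure AdditionalConditions (a b : ℝ) (u : ℝ × ℝ → ℝ) : Prop where
  flat : PartialZeroOn (rect (-a) b) (hseg (-a) 0 0) (0, 1) u
  pos : ∀ q ∈ rect (-a) b, 0 < u q

/-- `u` is the bounded classical harmonic function on `(0, b) × (0, 1)` with boundary data
`u(0,y) = h y^α`, `u(b,y) = y`, `u(x,0) = 0`, `u(x,1) = 1`. For `h ≠ 1` the data jump at the corner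
`(0,1)`, where no continuity is possible. -/
structure IsHarmonicPart (b h α : ℝ) (u : ℝ × ℝ → ℝ) : Prop where
  contDiffOn : ContDiffOn ℝ 2 u (rect 0 b)
  harmonic : ∀ q ∈ rect 0 b, lap u q = 0
  bounded : ∃ M : ℝ, ∀ q ∈ rect 0 b, |u q| ≤ M
  continuousOn : ContinuousOn u ((Icc 0 b ×ˢ Icc (0 : ℝ) 1) \ {q | q = (0, 1) ∧ h ≠ 1})
  left : ∀ y ∈ Ioo (0 : ℝ) 1, u (0, y) = h * y ^ α
  right : ∀ y ∈ Ioo (0 : ℝ) 1, u (b, y) = y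
  bottom : ∀ x ∈ Ioo 0 b, u (x, 0) = 0
  top : ∀ x ∈ Ioo 0 b, u (x, 1) = 1

/-- The function equal to `uL` for `x < 0` and to `uR` for `x ≥ 0`. -/
def glue (uL uR : ℝ × ℝ → ℝ) (q : ℝ × ℝ) : ℝ := if q.1 < 0 then uL q else uR q

end SpaceCharge

end

open MeasureTheory Set Filter Topology
open scoped ContDiff

noncomputable section

namespace SpaceCharge

/-! Two subsolutions glue to a subsolution along a segment on which their traces agree, provided the
normal derivative does not decrease across it: the distributional Laplacian of the glued function
then carries only a nonnegative measure on the interface. On the left the normal derivative is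
nonpositive by assumption, so everything rests on showing that `u_+` increases in `x`.

The function `u_+` is written explicitly as the imaginary part of a holomorphic function
(`exists_isHarmonicPart`): the linear function `y`, a sine series that corrects the left datum, and
a logarithm that produces the jump at the corner. The bounds `h y ^ α ≤ u_+ ≤ y` follow from the
maximum principle, as `y ^ α` is subharmonic and `y` harmonic; a logarithmic barrier takes care of
the corner `(0, 1)` (`nonneg_of_lap_nonpos_of_corner`). Given these bounds, `u_+` can be compared
with its own translates, which makes it nondecreasing in `x` and in `y` (`monotone_fst`,
`monotone_snd`). Monotonicity pays three times: it signs the normal derivative, it bounds both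
partial derivatives in `L¹` by increments along slices, and it controls the layer integrals that
define the trace on the axis (`tendsto_strip`).

For the gluing, a test function `φ` is multiplied by a cutoff `η` in `x` that vanishes near the
axis, so that `η φ` splits into a test function for each half. Terms with `η'` times the glued
function vanish in the limit because the traces agree (`tendsto_integral_deriv_cutoff`). In the
Laplacian the remaining term `∂ₓ(η' φ)` is integrated by parts on each half and leaves the normal
derivatives against kernels of known sign (`glue_subsolution_ineq`): the left one contributes at
most its positive part, which has zero trace, and the right one has the favourable sign. -/

/-- The derivative of `f` in the direction `e`, as a function. -/
abbrev pd (e : ℝ × ℝ) (f : ℝ × ℝ → ℝ) (p : ℝ × ℝ) : ℝ := fderiv ℝ f p e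

/-! ### Partial derivatives along slices -/

theorem hasDerivAt_slice_fst {f : ℝ × ℝ → ℝ} {x y : ℝ} (hf : DifferentiableAt ℝ f (x, y)) :
    HasDerivAt (fun t => f (t, y)) (pd (1, 0) f (x, y)) x :=
  hf.hasFDerivAt.comp_hasDerivAt x ((hasDerivAt_id x).prodMk (hasDerivAt_const x y))

theorem hasDerivAt_slice_snd {f : ℝ × ℝ → ℝ} {x y : ℝ} (hf : DifferentiableAt ℝ f (x, y)) :
    HasDerivAt (fun t => f (x, t)) (pd (0, 1) f (x, y)) y :=
  hf.hasFDerivAt.comp_hasDerivAt y ((hasDerivAt_const y x).prodMk (hasDerivAt_id y))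

theorem contDiffOn_pd {f : ℝ × ℝ → ℝ} {U : Set (ℝ × ℝ)} (hU : IsOpen U) {m n : WithTop ℕ∞}
    (hf : ContDiffOn ℝ n f U) (hmn : m + 1 ≤ n) (e : ℝ × ℝ) : ContDiffOn ℝ m (pd e f) U :=
  (hf.fderiv_of_isOpen hU hmn).clm_apply contDiffOn_const

theorem differentiableAt_of_contDiffOn {f : ℝ × ℝ → ℝ} {U : Set (ℝ × ℝ)} (hU : IsOpen U)
    {n : WithTop ℕ∞} (hf : ContDiffOn ℝ n f U) (hn : n ≠ 0) {p : ℝ × ℝ} (hp : p ∈ U) :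
    DifferentiableAt ℝ f p :=
  (hf.contDiffAt (hU.mem_nhds hp)).differentiableAt hn

theorem eventually_slice_fst {U : Set (ℝ × ℝ)} (hU : IsOpen U) {p : ℝ × ℝ} (hp : p ∈ U) :
    ∀ᶠ t in 𝓝 p.1, (t, p.2) ∈ U :=
  (show ContinuousAt (fun t : ℝ => (t, p.2)) p.1 by fun_prop) (hU.mem_nhds hp)

theorem eventually_slice_snd {U : Set (ℝ × ℝ)} (hU : IsOpen U) {p : ℝ × ℝ} (hp : p ∈ U) :
    ∀ᶠ t in 𝓝 p.2, (p.1, t) ∈ U :=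
  (show ContinuousAt (fun t : ℝ => (p.1, t)) p.2 by fun_prop) (hU.mem_nhds hp)

/-- Links the slicewise definition of `lap` with directional derivatives, the form in which
integration by parts applies. -/
theorem lap_eq {f : ℝ × ℝ → ℝ} {U : Set (ℝ × ℝ)} (hU : IsOpen U) (hf : ContDiffOn ℝ 2 f U)
    {p : ℝ × ℝ} (hp : p ∈ U) :
    lap f p = pd (1, 0) (pd (1, 0) f) p + pd (0, 1) (pd (0, 1) f) p := by
  have hd : ∀ q ∈ U, DifferentiableAt ℝ f q := fun q hq =>
    differentiableAt_of_contDiffOn hU hf two_ne_zero hq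
  have hd' : ∀ e, ∀ q ∈ U, DifferentiableAt ℝ (pd e f) q := fun e q hq =>
    differentiableAt_of_contDiffOn hU (contDiffOn_pd (m := 1) hU hf (by norm_num) e)
      one_ne_zero hq
  have h1 : iteratedDeriv 2 (fun x => f (x, p.2)) p.1 = pd (1, 0) (pd (1, 0) f) p := by
    rw [iteratedDeriv_succ, iteratedDeriv_one]
    have : deriv (fun x => f (x, p.2)) =ᶠ[𝓝 p.1] fun x => pd (1, 0) f (x, p.2) := by
      filter_upwards [eventually_slice_fst hU hp] with t ht
      exact (hasDerivAt_slice_fst (hd _ ht)).deriv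
    rw [this.deriv_eq]
    exact (hasDerivAt_slice_fst (x := p.1) (y := p.2) (hd' _ _ hp)).deriv
  have h2 : iteratedDeriv 2 (fun y => f (p.1, y)) p.2 = pd (0, 1) (pd (0, 1) f) p := by
    rw [iteratedDeriv_succ, iteratedDeriv_one]
    have : deriv (fun y => f (p.1, y)) =ᶠ[𝓝 p.2] fun y => pd (0, 1) f (p.1, y) := by
      filter_upwards [eventually_slice_snd hU hp] with t ht
      exact (hasDerivAt_slice_snd (hd _ ht)).deriv
    rw [this.deriv_eq]
    exact (hasDerivAt_slice_snd (x := p.1) (y := p.2) (hd' _ _ hp)).deriv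
  rw [lap, h1, h2]

/-! ### Imaginary parts of holomorphic functions -/

theorem hasDerivAt_im_line {H : ℂ → ℂ} {c d : ℂ} {t : ℝ}
    (hH : DifferentiableAt ℂ H (c + t * d)) :
    HasDerivAt (fun s : ℝ => (H (c + s * d)).im) ((d * deriv H (c + t * d)).im) t := by
  have h1 : HasDerivAt (fun s : ℝ => c + (s : ℂ) * d) d t := by
    simpa using ((Complex.ofRealCLM.hasDerivAt (x := t)).mul_const d).const_add c
  have h2 := HasDerivAt.scomp t hH.hasDerivAt h1
  exact Complex.imCLM.hasFDerivAt.comp_hasDerivAt t h2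

theorem iteratedDeriv_two_im_line {H : ℂ → ℂ} {V : Set ℂ} (hV : IsOpen V)
    (hH : DifferentiableOn ℂ H V) {c d : ℂ} {t : ℝ} (ht : c + t * d ∈ V) :
    iteratedDeriv 2 (fun s : ℝ => (H (c + s * d)).im) t
      = (d * (d * deriv (deriv H) (c + t * d))).im := by
  have hev : ∀ᶠ s : ℝ in 𝓝 t, c + s * d ∈ V :=
    (show ContinuousAt (fun s : ℝ => c + (s : ℂ) * d) t by fun_prop) (hV.mem_nhds ht)
  have h1 : deriv (fun s : ℝ => (H (c + s * d)).im)
      =ᶠ[𝓝 t] fun s => (d * deriv H (c + s * d)).im := by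
    filter_upwards [hev] with s hs
    exact (hasDerivAt_im_line (hH.differentiableAt (hV.mem_nhds hs))).deriv
  rw [iteratedDeriv_succ, iteratedDeriv_one, h1.deriv_eq]
  have hd : DifferentiableAt ℂ (deriv H) (c + t * d) :=
    (hH.deriv hV).differentiableAt (hV.mem_nhds ht)
  rw [(hasDerivAt_im_line (H := fun z => d * deriv H z) (hd.const_mul d)).deriv, deriv_const_mul _ hd]

/-- The point `x + i y` of the complex plane. -/
def toC (q : ℝ × ℝ) : ℂ := q.1 + q.2 * Complex.I

theorem toC_re (q : ℝ × ℝ) : (toC q).re = q.1 := by simp [toC]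

theorem toC_im (q : ℝ × ℝ) : (toC q).im = q.2 := by simp [toC]

theorem contDiff_toC {n : WithTop ℕ∞} : ContDiff ℝ n toC := by
  unfold toC
  exact (Complex.ofRealCLM.contDiff.comp contDiff_fst).add
    ((Complex.ofRealCLM.contDiff.comp contDiff_snd).mul contDiff_const)

theorem continuous_toC : Continuous toC := (contDiff_toC (n := 0)).continuous

theorem contDiffOn_im {H : ℂ → ℂ} {V : Set ℂ} (hV : IsOpen V) (hH : DifferentiableOn ℂ H V)
    {U : Set (ℝ × ℝ)} (hUV : ∀ q ∈ U, toC q ∈ V) :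
    ContDiffOn ℝ 2 (fun q => (H (toC q)).im) U :=
  Complex.imCLM.contDiff.comp_contDiffOn
    (((hH.contDiffOn (n := 2) hV).restrict_scalars ℝ).comp contDiff_toC.contDiffOn hUV)

/-- Differentiating twice in the direction `d` multiplies `H''` by `d²`; the directions `1` and `I`
therefore cancel. -/
theorem lap_im {H : ℂ → ℂ} {V : Set ℂ} (hV : IsOpen V) (hH : DifferentiableOn ℂ H V)
    {q : ℝ × ℝ} (hq : toC q ∈ V) : lap (fun q => (H (toC q)).im) q = 0 := by
  have h1 := iteratedDeriv_two_im_line hV hH (c := q.2 * Complex.I) (d := 1) (t := q.1)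
    (by simpa [toC, add_comm] using hq)
  have h2 := iteratedDeriv_two_im_line hV hH (c := q.1) (d := Complex.I) (t := q.2) hq
  have e1 : (fun x : ℝ => (H (toC (x, q.2))).im)
      = fun s : ℝ => (H (q.2 * Complex.I + s * 1)).im := by
    funext x; simp [toC, add_comm]
  have e2 : (q.2 : ℂ) * Complex.I + q.1 * 1 = toC q := by simp [toC, add_comm]
  rw [e2] at h1
  rw [lap, e1, h1]
  change _ + iteratedDeriv 2 (fun s : ℝ => (H (q.1 + s * Complex.I)).im) q.2 = 0
  rw [h2, ← mul_assoc Complex.I, Complex.I_mul_I]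
  simp [toC]

/-! ### The maximum principle -/

/-- A negative second derivative would make `x` a local maximum as well, hence `f` locally constant
and its second derivative zero. -/
theorem deriv_deriv_nonneg_of_isLocalMin {f : ℝ → ℝ} {x : ℝ} (hf : IsLocalMin f x)
    (hc : ContinuousAt f x) : 0 ≤ deriv (deriv f) x := by
  by_contra! hlt
  have hmax := isLocalMax_of_deriv_deriv_neg hlt hf.deriv_eq_zero hc
  have hconst : f =ᶠ[𝓝 x] fun _ => f x := by
    filter_upwards [hf, hmax] with t h1 h2
    exact le_antisymm h2 h1
  have : deriv f =ᶠ[𝓝 x] fun _ => 0 := by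
    filter_upwards [hconst.eventually_nhds] with t ht
    rw [Filter.EventuallyEq.deriv_eq ht, deriv_const]
  rw [this.deriv_eq, deriv_const] at hlt
  exact lt_irrefl _ hlt

theorem lap_nonneg_of_isLocalMin {f : ℝ × ℝ → ℝ} {p : ℝ × ℝ} (hf : IsLocalMin f p)
    (hc : ContinuousAt f p) : 0 ≤ lap f p := by
  have c1 : ContinuousAt (fun t : ℝ => (t, p.2)) p.1 := by fun_prop
  have c2 : ContinuousAt (fun t : ℝ => (p.1, t)) p.2 := by fun_prop
  rw [lap]
  simp only [iteratedDeriv_succ (n := 1), iteratedDeriv_one]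
  refine add_nonneg (deriv_deriv_nonneg_of_isLocalMin (f := fun t => f (t, p.2)) ?_ ?_)
    (deriv_deriv_nonneg_of_isLocalMin (f := fun t => f (p.1, t)) ?_ ?_)
  · exact c1.eventually hf
  · exact ContinuousAt.comp (f := fun t : ℝ => (t, p.2)) hc c1
  · exact c2.eventually hf
  · exact ContinuousAt.comp (f := fun t : ℝ => (p.1, t)) hc c2

theorem lap_add {f g : ℝ × ℝ → ℝ} {U : Set (ℝ × ℝ)} (hU : IsOpen U) (hf : ContDiffOn ℝ 2 f U)
    (hg : ContDiffOn ℝ 2 g U) {p : ℝ × ℝ} (hp : p ∈ U) :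
    lap (fun q => f q + g q) p = lap f p + lap g p := by
  have s1 : ContDiffAt ℝ 2 (fun t : ℝ => (t, p.2)) p.1 := by fun_prop
  have s2 : ContDiffAt ℝ 2 (fun t : ℝ => (p.1, t)) p.2 := by fun_prop
  have hf' := hf.contDiffAt (hU.mem_nhds hp)
  have hg' := hg.contDiffAt (hU.mem_nhds hp)
  have h1 := iteratedDeriv_fun_add (n := 2) (ContDiffAt.comp p.1 (g := f) hf' s1)
    (ContDiffAt.comp p.1 (g := g) hg' s1)
  have h2 := iteratedDeriv_fun_add (n := 2) (ContDiffAt.comp p.2 (g := f) hf' s2)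
    (ContDiffAt.comp p.2 (g := g) hg' s2)
  simp only [Function.comp_def] at h1 h2
  simp only [lap, h1, h2]
  ring

theorem lap_const_mul (c : ℝ) (f : ℝ × ℝ → ℝ) (p : ℝ × ℝ) :
    lap (fun q => c * f q) p = c * lap f p := by
  simp only [lap, iteratedDeriv_const_mul_field]
  ring

/-- A superharmonic function with nonnegative lower boundary limits is nonnegative. -/
theorem nonneg_of_lap_nonpos {U : Set (ℝ × ℝ)} (hU : IsOpen U) (hb : Bornology.IsBounded U)
    {w : ℝ × ℝ → ℝ} (hw : ContDiffOn ℝ 2 w U) (hl : ∀ q ∈ U, lap w q ≤ 0)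
    (hbd : ∀ p ∈ closure U, p ∉ U → ∀ δ > 0, ∀ᶠ q in 𝓝[U] p, -δ < w q) :
    ∀ q ∈ U, 0 ≤ w q := by
  intro q₀ hq₀
  by_contra! hneg
  obtain ⟨R, hR⟩ := hb.subset_closedBall 0
  have hx : ∀ q ∈ U, q.1 ^ 2 ≤ R ^ 2 := fun q hq => by
    have h1 := hR hq
    rw [mem_closedBall_zero_iff] at h1
    have h2 := (norm_fst_le q).trans h1
    rw [Real.norm_eq_abs] at h2
    exact sq_le_sq' (abs_le.1 h2).1 (abs_le.1 h2).2
  -- `κ` is small enough that adding the bump `κ (R² - x²)` keeps the value at `q₀` negative. The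
  -- bump is nonnegative on `U` and strictly superharmonic, which rules out an interior minimum of
  -- the sum.
  obtain ⟨κ, hκ, hκ'⟩ : ∃ κ > 0, w q₀ + κ * R ^ 2 < 0 := by
    refine ⟨-w q₀ / (2 * (R ^ 2 + 1)), by apply div_pos <;> nlinarith [sq_nonneg R], ?_⟩
    have : -w q₀ / (2 * (R ^ 2 + 1)) * R ^ 2 < -w q₀ := by
      rw [div_mul_eq_mul_div, div_lt_iff₀ (by positivity)]
      nlinarith [sq_nonneg R]
    linarith
  set k : ℝ × ℝ → ℝ := fun q => κ * (R ^ 2 - q.1 ^ 2) with hk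
  have hkC : ContDiffOn ℝ 2 k U := by
    have : ContDiff ℝ 2 k := by unfold k; fun_prop
    exact this.contDiffOn
  have hklap : ∀ q, lap k q = -(2 * κ) := fun q => by
    rw [hk, lap_const_mul, lap]
    have e1 : deriv (fun x : ℝ => R ^ 2 - x ^ 2) = fun x => -(2 * x) := by
      funext x; simp
    simp only [iteratedDeriv_succ (n := 1), iteratedDeriv_one, e1]
    have e2 : deriv (fun x : ℝ => -(2 * x)) q.1 = -2 := by
      simp
    rw [e2]; simp; ring
  set W : ℝ × ℝ → ℝ := fun q => w q + k q with hW
  have hWC : ContDiffOn ℝ 2 W U := hw.add hkC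
  have hW0 : W q₀ < 0 := by
    have : κ * (R ^ 2 - q₀.1 ^ 2) ≤ κ * R ^ 2 := by nlinarith [sq_nonneg q₀.1]
    simp only [hW, hk]; linarith
  have hwW : ∀ q ∈ U, w q ≤ W q := fun q hq => by
    have : 0 ≤ κ * (R ^ 2 - q.1 ^ 2) := mul_nonneg hκ.le (by linarith [hx q hq])
    simp only [hW, hk]; linarith
  -- The boundary condition keeps this sublevel set away from the boundary of `U`, so it is compact
  -- and `W` attains a minimum inside `U`.
  set K : Set (ℝ × ℝ) := {q ∈ U | W q ≤ W q₀} with hK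
  have hKclosed : IsClosed K := by
    rw [isClosed_iff_clusterPt]
    intro p hp
    have hfreq : ∃ᶠ q in 𝓝 p, q ∈ K := by
      rw [← mem_closure_iff_frequently]; exact mem_closure_iff_clusterPt.2 hp
    have hpU : p ∈ closure U := mem_closure_iff_frequently.2 (hfreq.mono fun q hq => hq.1)
    by_cases hpm : p ∈ U
    · refine ⟨hpm, ?_⟩
      by_contra! hlt
      have hc : ContinuousAt W p := hWC.continuousOn.continuousAt (hU.mem_nhds hpm)
      obtain ⟨q, hq, hq'⟩ := (hfreq.and_eventually (hc.eventually (lt_mem_nhds hlt))).exists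
      exact absurd hq.2 (not_le.2 hq')
    · have h1 := eventually_nhdsWithin_iff.1 (hbd p hpU hpm (-W q₀) (by linarith))
      obtain ⟨q, hq, hq'⟩ := (hfreq.and_eventually h1).exists
      have h2 := hq' hq.1
      have h3 := hwW q hq.1
      have h4 := hq.2
      linarith
  have hKcomp : IsCompact K :=
    Metric.isCompact_of_isClosed_isBounded hKclosed (hb.subset fun q hq => hq.1)
  obtain ⟨p, hpK, hpmin⟩ := hKcomp.exists_isMinOn ⟨q₀, hq₀, le_rfl⟩
    (hWC.continuousOn.mono fun q hq => hq.1)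
  have hloc : IsLocalMin W p := by
    filter_upwards [hU.mem_nhds hpK.1] with q hq
    by_cases hqK : W q ≤ W q₀
    · exact hpmin ⟨hq, hqK⟩
    · exact (hpmin (show q₀ ∈ K from ⟨hq₀, le_rfl⟩)).trans (not_le.1 hqK).le
  have h0 := lap_nonneg_of_isLocalMin hloc (hWC.continuousOn.continuousAt (hU.mem_nhds hpK.1))
  rw [hW, lap_add hU hw hkC hpK.1, hklap] at h0
  linarith [hl p hpK.1]

/-! ### Integration by parts with compact supports -/

theorem integral_pd_eq_zero {f : ℝ × ℝ → ℝ} (hf : ContDiff ℝ 1 f) (hs : HasCompactSupport f)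
    (e : ℝ × ℝ) : ∫ p, pd e f p = 0 := by
  have hc : Continuous (pd e f) := (hf.continuous_fderiv one_ne_zero).clm_apply continuous_const
  have hi : Integrable (pd e f) :=
    hc.integrable_of_hasCompactSupport (hs.fderiv_apply ℝ e)
  have hi' : Integrable f := hf.continuous.integrable_of_hasCompactSupport hs
  have := integral_mul_fderiv_eq_neg_fderiv_mul_of_integrable (f := f)
    (g := fun _ : ℝ × ℝ => (1 : ℝ)) (v := e) (μ := volume)
    (by simpa using hi) (by simp) (by simpa using hi')
    (fun x _ => (hf.differentiable one_ne_zero) x) (fun _ _ => differentiableAt_const _)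
  simpa using this.symm

/-- The product of a function on `U` with a function supported in a compact part of `U`. -/
theorem contDiff_mul_of_tsupport_subset {f ψ : ℝ × ℝ → ℝ} {U : Set (ℝ × ℝ)} (hU : IsOpen U)
    {n : WithTop ℕ∞} (hf : ContDiffOn ℝ n f U) (hψ : ContDiff ℝ n ψ) (hs : tsupport ψ ⊆ U) :
    ContDiff ℝ n (fun q => f q * ψ q) := by
  refine contDiff_iff_contDiffAt.2 fun x => ?_
  by_cases hx : x ∈ tsupport ψ
  · exact (hf.contDiffAt (hU.mem_nhds (hs hx))).mul hψ.contDiffAt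
  · refine (contDiffAt_const (c := (0 : ℝ))).congr_of_eventuallyEq ?_
    filter_upwards [notMem_tsupport_iff_eventuallyEq.1 hx] with q hq
    simp [hq]

/-- Although `f` is regular only on `U`, the product `f ψ` is `C¹` on the whole plane with compact
support, so its derivative integrates to zero. -/
theorem integral_mul_pd {f ψ : ℝ × ℝ → ℝ} {U : Set (ℝ × ℝ)} (hU : IsOpen U)
    (hf : ContDiffOn ℝ 1 f U) (hψ : ContDiff ℝ 1 ψ) (hc : HasCompactSupport ψ)
    (hs : tsupport ψ ⊆ U) (e : ℝ × ℝ) :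
    ∫ q in U, f q * pd e ψ q = - ∫ q in U, pd e f q * ψ q := by
  have hF := contDiff_mul_of_tsupport_subset hU hf hψ hs
  have h0 := integral_pd_eq_zero hF (hc.mul_left) e
  have hsub : ∀ q ∉ tsupport ψ, ψ q = 0 ∧ pd e ψ q = 0 := fun q hq => by
    refine ⟨image_eq_zero_of_notMem_tsupport hq, ?_⟩
    have : q ∉ tsupport (fderiv ℝ ψ) := fun h => hq (tsupport_fderiv_subset ℝ h)
    simp [pd, image_eq_zero_of_notMem_tsupport this]
  have hpd : ∀ q, pd e (fun q => f q * ψ q) q = f q * pd e ψ q + pd e f q * ψ q := fun q => by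
    by_cases hq : q ∈ tsupport ψ
    · have h1 := differentiableAt_of_contDiffOn hU hf one_ne_zero (hs hq)
      have h2 := hψ.differentiable one_ne_zero q
      simp only [pd, fderiv_fun_mul h1 h2]
      simp [mul_comm]
    · have : q ∉ tsupport (fderiv ℝ (fun q => f q * ψ q)) := fun h =>
        hq (tsupport_mul_subset_right (tsupport_fderiv_subset ℝ h))
      simp only [pd, image_eq_zero_of_notMem_tsupport this]
      simp [(hsub q hq).1, show fderiv ℝ ψ q e = 0 from (hsub q hq).2]
  have hz : ∀ q, q ∉ U → ψ q = 0 ∧ pd e ψ q = 0 := fun q hq => hsub q fun h => hq (hs h)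
  have hI1 : Integrable (fun q => f q * pd e ψ q) := by
    refine Continuous.integrable_of_hasCompactSupport ?_ (hc.fderiv_apply ℝ e).mul_left
    have hψ' : ContDiff ℝ 0 (pd e ψ) :=
      (hψ.fderiv_right (by norm_num)).clm_apply contDiff_const
    exact (contDiff_mul_of_tsupport_subset hU (hf.of_le zero_le_one) hψ'
      ((tsupport_fderiv_apply_subset ℝ e).trans hs)).continuous
  have hI2 : Integrable (fun q => pd e f q * ψ q) := by
    refine Continuous.integrable_of_hasCompactSupport ?_ hc.mul_left
    exact (contDiff_mul_of_tsupport_subset hU (contDiffOn_pd hU hf (by norm_num) e)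
      (hψ.of_le zero_le_one) hs).continuous
  rw [setIntegral_eq_integral_of_forall_compl_eq_zero (fun q hq => by simp [(hz q hq).2]),
    setIntegral_eq_integral_of_forall_compl_eq_zero (fun q hq => by simp [(hz q hq).1])]
  simp only [hpd] at h0
  rw [integral_add hI1 hI2] at h0
  linarith

/-! ### Sine series -/

/-- The sum of `c i * sin (N i π y) * sinh (N i π x) / sinh (N i π b)`, as the imaginary part of
a holomorphic function. -/
def sineSeries {ι : Type} (b : ℝ) (c : ι → ℝ) (N : ι → ℤ) (z : ℂ) : ℂ :=
  ∑' i, ((c i / Real.sinh (N i * Real.pi * b) : ℝ) : ℂ) * Complex.cosh (N i * Real.pi * z)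

/-- Here `cosh ≤ 1 + |sinh|`, and the `1` is absorbed because `|sinh (n π b)| ≥ sinh (π b)`. The
constant does not depend on `n`, so absolutely summable coefficients give uniform convergence up to
`|Re z| = b`. -/
theorem cosh_le_mul_abs_sinh {b : ℝ} (hb : 0 < b) {n : ℤ} (hn : n ≠ 0) :
    Real.cosh (n * Real.pi * b) ≤
      (1 + 1 / Real.sinh (Real.pi * b)) * |Real.sinh (n * Real.pi * b)| := by
  have hpb : 0 < Real.pi * b := by positivity
  have hs : 0 < Real.sinh (Real.pi * b) := Real.sinh_pos_iff.2 hpb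
  have h1 : Real.sinh (Real.pi * b) ≤ |Real.sinh (n * Real.pi * b)| := by
    rw [Real.abs_sinh, Real.sinh_le_sinh, mul_assoc, abs_mul, abs_of_pos hpb]
    have : (1 : ℝ) ≤ |(n : ℝ)| := by exact_mod_cast Int.one_le_abs hn
    nlinarith
  have h2 : Real.cosh (n * Real.pi * b) ≤ 1 + |Real.sinh (n * Real.pi * b)| := by
    have h3 := Real.cosh_sq (n * Real.pi * b)
    have h4 := sq_abs (Real.sinh (n * Real.pi * b))
    refine abs_le_of_sq_le_sq' ?_ (by positivity) |>.2
    nlinarith [abs_nonneg (Real.sinh (n * Real.pi * b))]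
  have h5 : 1 ≤ 1 / Real.sinh (Real.pi * b) * |Real.sinh (n * Real.pi * b)| := by
    rw [one_div, inv_mul_eq_div, le_div_iff₀ hs]; linarith
  linarith

theorem norm_cosh_le (z : ℂ) : ‖Complex.cosh z‖ ≤ Real.cosh z.re := by
  rw [Complex.cosh, norm_div, Complex.norm_two, Real.cosh_eq]
  gcongr
  refine (norm_add_le _ _).trans ?_
  rw [Complex.norm_exp, Complex.norm_exp, Complex.neg_re]

section

variable {ι : Type} {b : ℝ} {c : ι → ℝ} {N : ι → ℤ}

theorem norm_sineSeries_term_le (hb : 0 < b) (i : ι) {z : ℂ} (hz : |z.re| ≤ b) :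
    ‖((c i / Real.sinh (N i * Real.pi * b) : ℝ) : ℂ) * Complex.cosh (N i * Real.pi * z)‖ ≤
      |c i| * (1 + 1 / Real.sinh (Real.pi * b)) := by
  have hs : 0 < Real.sinh (Real.pi * b) := Real.sinh_pos_iff.2 (by positivity)
  -- For frequency zero the denominator `sinh 0` is `0`, and division by zero makes the term vanish.
  by_cases hN : N i = 0
  · simp only [hN, Int.cast_zero, zero_mul, Real.sinh_zero, div_zero, Complex.ofReal_zero,
      norm_zero]
    positivity
  have h1 : ‖Complex.cosh (N i * Real.pi * z)‖ ≤ Real.cosh (N i * Real.pi * b) := by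
    refine (norm_cosh_le _).trans ?_
    have : ((N i : ℂ) * Real.pi * z).re = N i * Real.pi * z.re := by
      have : (N i : ℂ) * Real.pi = ((N i * Real.pi : ℝ) : ℂ) := by push_cast; rfl
      rw [this, Complex.re_ofReal_mul]
    rw [this, Real.cosh_le_cosh, abs_mul, abs_mul _ b, abs_of_pos hb]
    gcongr
  have h2 : 0 < |Real.sinh (N i * Real.pi * b)| := by
    rw [abs_pos, Ne, Real.sinh_eq_zero]
    have : (N i : ℝ) ≠ 0 := by exact_mod_cast hN
    positivity
  rw [norm_mul, Complex.norm_real, Real.norm_eq_abs, abs_div, div_mul_eq_mul_div,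
    div_le_iff₀ h2, mul_assoc |c i|]
  exact mul_le_mul_of_nonneg_left (h1.trans (cosh_le_mul_abs_sinh hb hN)) (abs_nonneg _)

theorem differentiableOn_sineSeries (hb : 0 < b) (hc : Summable fun i => |c i|) :
    DifferentiableOn ℂ (sineSeries b c N) {z | |z.re| < b} := by
  refine Complex.differentiableOn_tsum_of_summable_norm
    (hc.mul_right (1 + 1 / Real.sinh (Real.pi * b))) (fun i => ?_) ?_
    (fun i z hz => norm_sineSeries_term_le hb i (le_of_lt hz))
  · have : Differentiable ℂ fun z => ((c i / Real.sinh (N i * Real.pi * b) : ℝ) : ℂ) *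
        Complex.cosh (N i * Real.pi * z) := by fun_prop
    exact this.differentiableOn
  · exact isOpen_lt (by fun_prop) continuous_const

theorem continuousOn_sineSeries (hb : 0 < b) (hc : Summable fun i => |c i|) :
    ContinuousOn (sineSeries b c N) {z | |z.re| ≤ b} := by
  refine continuousOn_tsum (fun i => ?_) (hc.mul_right (1 + 1 / Real.sinh (Real.pi * b)))
    (fun i z hz => norm_sineSeries_term_le hb i hz)
  have : Differentiable ℂ fun z => ((c i / Real.sinh (N i * Real.pi * b) : ℝ) : ℂ) *
      Complex.cosh (N i * Real.pi * z) := by fun_prop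
  exact this.continuous.continuousOn

/-- Termwise, `Im cosh (s + i t) = sinh s · sin t` for real `s`, `t`; the boundary values on the
four sides are read off from this. -/
theorem sineSeries_im (hb : 0 < b) (hc : Summable fun i => |c i|) {q : ℝ × ℝ} (hq : |q.1| ≤ b) :
    (sineSeries b c N (toC q)).im = ∑' i, c i / Real.sinh (N i * Real.pi * b) *
      (Real.sinh (N i * Real.pi * q.1) * Real.sin (N i * Real.pi * q.2)) := by
  have hs : Summable fun i => ((c i / Real.sinh (N i * Real.pi * b) : ℝ) : ℂ) *
      Complex.cosh (N i * Real.pi * toC q) :=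
    (Summable.of_nonneg_of_le (fun _ => norm_nonneg _)
      (fun i => norm_sineSeries_term_le hb i (by rwa [toC_re]))
      (hc.mul_right (1 + 1 / Real.sinh (Real.pi * b)))).of_norm
  rw [sineSeries, Complex.im_tsum hs]
  refine tsum_congr fun i => ?_
  have : (N i : ℂ) * Real.pi * toC q =
      ((N i * Real.pi * q.1 : ℝ) : ℂ) + ((N i * Real.pi * q.2 : ℝ) : ℂ) * Complex.I := by
    simp only [toC]; push_cast; ring
  rw [Complex.im_ofReal_mul, this, Complex.cosh_add, Complex.cosh_mul_I, Complex.sinh_mul_I,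
    ← Complex.ofReal_cosh, ← Complex.ofReal_sinh, ← Complex.ofReal_cos, ← Complex.ofReal_sin,
    ← mul_assoc, ← Complex.ofReal_mul, ← Complex.ofReal_mul, Complex.add_im, Complex.ofReal_im,
    Complex.im_ofReal_mul, Complex.I_im, mul_one, zero_add]

theorem sineSeries_im_right (hb : 0 < b) (hc : Summable fun i => |c i|) (y : ℝ) :
    (sineSeries b c N (toC (b, y))).im = ∑' i, c i * Real.sin (N i * Real.pi * y) := by
  rw [sineSeries_im hb hc (by simp [abs_of_pos hb])]
  refine tsum_congr fun i => ?_
  by_cases hN : N i = 0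
  · simp [hN]
  · have : Real.sinh (N i * Real.pi * b) ≠ 0 := by
      rw [Ne, Real.sinh_eq_zero]
      have : (N i : ℝ) ≠ 0 := by exact_mod_cast hN
      positivity
    field_simp

theorem sineSeries_im_left (hb : 0 < b) (hc : Summable fun i => |c i|) (y : ℝ) :
    (sineSeries b c N (toC (0, y))).im = 0 := by
  rw [sineSeries_im hb hc (by simp [hb.le])]
  simp

theorem sineSeries_im_bottom (hb : 0 < b) (hc : Summable fun i => |c i|) {x : ℝ} (hx : |x| ≤ b) :
    (sineSeries b c N (toC (x, 0))).im = 0 := by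
  rw [sineSeries_im hb hc hx]
  simp

theorem sineSeries_im_top (hb : 0 < b) (hc : Summable fun i => |c i|) {x : ℝ} (hx : |x| ≤ b) :
    (sineSeries b c N (toC (x, 1))).im = 0 := by
  rw [sineSeries_im hb hc hx]
  simp [Real.sin_int_mul_pi]

theorem abs_sineSeries_im_le (hb : 0 < b) (hc : Summable fun i => |c i|) {z : ℂ}
    (hz : |z.re| ≤ b) :
    |(sineSeries b c N z).im| ≤ ∑' i, |c i| * (1 + 1 / Real.sinh (Real.pi * b)) :=
  (Complex.abs_im_le_norm _).trans
    (tsum_of_norm_bounded (hc.mul_right _).hasSum fun i => norm_sineSeries_term_le hb i hz)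

end

/-! ### The sine expansion of `y ^ α - y` -/

/-- The odd extension of `y ^ α - y`. -/
def oddPow (α y : ℝ) : ℝ := y * |y| ^ (α - 1) - y

/-- The odd extension is `C¹` across the origin because `α > 1`: the difference quotient of its
power part at `0` is `|t| ^ (α - 1)`. -/
theorem hasDerivAt_oddPow {α : ℝ} (hα : 1 < α) (y : ℝ) :
    HasDerivAt (oddPow α) (α * |y| ^ (α - 1) - 1) y := by
  refine HasDerivAt.sub ?_ (hasDerivAt_id y)
  rcases eq_or_ne y 0 with rfl | hy
  · rw [hasDerivAt_iff_tendsto_slope, abs_zero, Real.zero_rpow (by linarith), mul_zero]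
    have h1 : Tendsto (fun y : ℝ => |y| ^ (α - 1)) (𝓝[≠] 0) (𝓝 0) := by
      have : Continuous fun y : ℝ => |y| ^ (α - 1) :=
        continuous_abs.rpow_const fun _ => Or.inr (by linarith)
      have h2 := this.tendsto 0
      rw [abs_zero, Real.zero_rpow (by linarith)] at h2
      exact h2.mono_left nhdsWithin_le_nhds
    refine h1.congr' ?_
    filter_upwards [self_mem_nhdsWithin] with t ht
    have : t ≠ 0 := ht
    simp [slope_def_field]
    field_simp
  · have h1 := (hasDerivAt_abs hy).rpow_const (p := α - 1) (Or.inl (abs_ne_zero.2 hy))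
    have h2 := (hasDerivAt_id y).mul h1
    refine h2.congr_deriv ?_
    have h3 : |y| ^ (α - 1) = |y| ^ (α - 1 - 1) * |y| := by
      rw [← Real.rpow_add_one (abs_ne_zero.2 hy)]; ring_nf
    have h4 : y * (SignType.sign y : ℝ) = |y| := by rw [mul_comm]; exact sign_mul_self y
    simp only [id, one_mul]
    rw [h3]
    linear_combination (α - 1) * |y| ^ (α - 1 - 1) * h4

/-- The Fourier series below live on the circle of length `2`, whose period must be known to be
positive. -/
instance : Fact ((0 : ℝ) < 2) := ⟨two_pos⟩

/-- Up to a constant factor the coefficients of `f` are those of `f'` divided by `n`, the boundary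
term dropping out by `f a = f b`. Both `1 / n` and the coefficients of `f'` are square summable
(Parseval), so their product is summable. -/
theorem summable_fourierCoeffOn_of_hasDerivAt {f f' : ℝ → ℂ} {a b : ℝ} (hab : a < b)
    (hf : ∀ x, HasDerivAt f (f' x) x) (hf' : Continuous f') (hper : f a = f b) :
    Summable (fourierCoeffOn hab f) := by
  have hL2 : MemLp f' 2 (volume.restrict (Ioc a b)) := by
    obtain ⟨C, hC⟩ := (isCompact_Icc (a := a) (b := b)).exists_bound_of_continuousOn
      hf'.continuousOn
    exact MemLp.of_bound hf'.aestronglyMeasurable C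
      ((ae_restrict_mem measurableSet_Ioc).mono fun x hx => hC x (Ioc_subset_Icc_self hx))
  have hsq := (hasSum_sq_fourierCoeffOn hab hL2).summable
  have hn2 : Summable fun n : ℤ => 1 / (n : ℝ) ^ 2 := by
    exact Real.summable_one_div_int_pow.2 one_lt_two
  refine Summable.of_norm_bounded_eventually (g := fun n =>
    (b - a) / (2 * Real.pi) * (1 / (n : ℝ) ^ 2 + ‖fourierCoeffOn hab f' n‖ ^ 2))
    ((hn2.add hsq).mul_left _) ?_
  have hfin : ∀ᶠ n : ℤ in cofinite, n ≠ 0 := (Set.finite_singleton (0 : ℤ)).compl_mem_cofinite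
  filter_upwards [hfin] with n hn
  rw [fourierCoeffOn_of_hasDerivAt hab hn (fun x _ => hf x) (hf'.intervalIntegrable _ _), hper,
    sub_self, mul_zero, zero_sub]
  have hn' : (0 : ℝ) < |(n : ℝ)| := by
    have : (n : ℝ) ≠ 0 := by exact_mod_cast hn
    positivity
  have e : ‖(b : ℂ) - a‖ = b - a := by
    rw [← Complex.ofReal_sub, Complex.norm_real, Real.norm_eq_abs, abs_of_pos (sub_pos.2 hab)]
  have e1 : ‖(n : ℂ)‖ = |(n : ℝ)| := by rw [Complex.norm_intCast]
  simp only [norm_mul, norm_div, norm_neg, norm_one, Complex.norm_ofNat, Complex.norm_I,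
    Complex.norm_real, e, e1, mul_one, Real.norm_eq_abs, abs_of_pos Real.pi_pos]
  set t := ‖fourierCoeffOn hab f' n‖
  have h1 : t / |(n : ℝ)| ≤ 1 / (n : ℝ) ^ 2 + t ^ 2 := by
    rw [← sq_abs (n : ℝ)]
    set m := |(n : ℝ)|
    have : t / m = 1 / m * t := by ring
    have h2 : 1 / m ^ 2 = (1 / m) ^ 2 := by ring
    rw [this, h2]
    nlinarith [sq_nonneg (1 / m - t), sq_nonneg (1 / m), sq_nonneg t]
  calc 1 / (2 * Real.pi * |(n : ℝ)|) * ((b - a) * t)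
      = (b - a) / (2 * Real.pi) * (t / |(n : ℝ)|) := by field_simp
    _ ≤ _ := by
      have : 0 ≤ (b - a) / (2 * Real.pi) := div_nonneg (by linarith) (by positivity)
      exact mul_le_mul_of_nonneg_left h1 this

/-- An odd `2`-periodic `C¹` function has an absolutely convergent sine expansion. -/
theorem exists_sine_expansion {F F' : ℝ → ℝ} (hF : ∀ x, HasDerivAt F (F' x) x)
    (hF' : Continuous F') (hodd : ∀ x, F (-x) = -F x) (h1 : F 1 = 0) :
    ∃ d : ℤ → ℝ, Summable (fun n => |d n|) ∧
      ∀ y ∈ Icc (0 : ℝ) 1, HasSum (fun n => d n * Real.sin (n * Real.pi * y)) (F y) := by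
  have hm1 : F (-1) = 0 := by rw [hodd, h1, neg_zero]
  have hFc : Continuous F := continuous_iff_continuousAt.2 fun x => (hF x).continuousAt
  set f : ℝ → ℂ := fun x => (F x : ℂ) with hf
  have hlift : Continuous (AddCircle.liftIco 2 (-1) f) := by
    refine AddCircle.liftIco_continuous ?_ (by fun_prop)
    norm_num [hf, h1, hm1]
  have hab : (-1 : ℝ) < -1 + 2 := by norm_num
  have hsum : Summable (fourierCoeffOn hab f) := by
    refine summable_fourierCoeffOn_of_hasDerivAt hab (fun x => (hF x).ofReal_comp)
      (Complex.continuous_ofReal.comp hF') ?_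
    norm_num [hf, h1, hm1]
  have hcoef : ∀ n, fourierCoeff (AddCircle.liftIco 2 (-1) f) n = fourierCoeffOn hab f n :=
    fun n => fourierCoeff_liftIco_eq f n
  have hpt := has_pointwise_sum_fourier_series_of_summable (f := ⟨_, hlift⟩)
    (by convert hsum using 1; funext n; exact hcoef n)
  have hval : ∀ y ∈ Icc (-1 : ℝ) 1, AddCircle.liftIco 2 (-1) f (y : AddCircle (2 : ℝ)) = F y := by
    intro y hy
    -- The endpoint `1` lies outside the fundamental interval; on the circle it is the point `-1`,
    -- where `F` also vanishes.
    rcases hy.2.eq_or_lt with rfl | hlt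
    · have : ((1 : ℝ) : AddCircle (2 : ℝ)) = ((-1 : ℝ) : AddCircle (2 : ℝ)) := by
        rw [← AddCircle.coe_add_period 2 (-1)]; norm_num
      rw [this, AddCircle.liftIco_coe_apply (by norm_num)]
      simp [hf, h1, hm1]
    · rw [AddCircle.liftIco_coe_apply ⟨hy.1, by linarith⟩]
  have hfour : ∀ (n : ℤ) (y : ℝ), fourier n (y : AddCircle (2 : ℝ)) =
      Complex.exp ((n * Real.pi * y : ℝ) * Complex.I) := by
    intro n y
    rw [fourier_coe_apply]
    congr 1
    push_cast
    ring
  -- The odd part `(F y - F (-y)) / 2` of the series `∑ cₙ exp (i n π y)` is `∑ i cₙ sin (n π y)`,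
  -- and the real part of `i cₙ` is `-Im cₙ`.
  refine ⟨fun n => -(fourierCoeffOn hab f n).im, ?_, fun y hy => ?_⟩
  · refine Summable.of_nonneg_of_le (fun _ => abs_nonneg _) (fun n => ?_) hsum.norm
    rw [abs_neg]
    exact Complex.abs_im_le_norm _
  · have p1 := hpt (y : AddCircle (2 : ℝ))
    have p2 := hpt ((-y : ℝ) : AddCircle (2 : ℝ))
    simp only [ContinuousMap.coe_mk, hcoef, smul_eq_mul] at p1 p2
    rw [hval y ⟨by linarith [hy.1], hy.2⟩] at p1
    rw [hval (-y) ⟨by linarith [hy.2], by linarith [hy.1]⟩, hodd] at p2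
    have p3 := Complex.hasSum_re ((p1.sub p2).mul_left (1 / 2))
    have e1 : ((1 / 2 : ℂ) * ((F y : ℂ) - ((-F y : ℝ) : ℂ))).re = F y := by
      have : (1 / 2 : ℂ) * ((F y : ℂ) - ((-F y : ℝ) : ℂ)) = (F y : ℂ) := by push_cast; ring
      rw [this, Complex.ofReal_re]
    rw [e1] at p3
    convert p3 using 2 with n
    rw [hfour, hfour]
    have : (((n * Real.pi * -y : ℝ)) : ℂ) = -((n * Real.pi * y : ℝ) : ℂ) := by push_cast; ring
    rw [this, Complex.exp_mul_I, Complex.exp_mul_I, Complex.cos_neg, Complex.sin_neg]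
    have : (1 / 2 : ℂ) * (fourierCoeffOn hab f n * (Complex.cos ((n * Real.pi * y : ℝ) : ℂ) +
        Complex.sin ((n * Real.pi * y : ℝ) : ℂ) * Complex.I) - fourierCoeffOn hab f n *
        (Complex.cos ((n * Real.pi * y : ℝ) : ℂ) +
        -Complex.sin ((n * Real.pi * y : ℝ) : ℂ) * Complex.I)) =
        (Real.sin (n * Real.pi * y) : ℂ) * (fourierCoeffOn hab f n * Complex.I) := by
      rw [Complex.ofReal_sin]; ring
    rw [this, Complex.re_ofReal_mul, Complex.mul_I_re]
    ring

theorem exists_sine_expansion_rpow {α : ℝ} (hα : 1 < α) :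
    ∃ d : ℤ → ℝ, Summable (fun n => |d n|) ∧
      ∀ y ∈ Icc (0 : ℝ) 1, HasSum (fun n => d n * Real.sin (n * Real.pi * y)) (y ^ α - y) := by
  obtain ⟨d, hd, hs⟩ := exists_sine_expansion (hasDerivAt_oddPow hα)
    (by
      have : Continuous fun y : ℝ => |y| ^ (α - 1) :=
        continuous_abs.rpow_const fun _ => Or.inr (by linarith)
      fun_prop)
    (fun y => by simp only [oddPow, abs_neg]; ring) (by simp [oddPow])
  refine ⟨d, hd, fun y hy => ?_⟩
  have : oddPow α y = y ^ α - y := by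
    rcases hy.1.eq_or_lt with rfl | h0
    · simp [oddPow, Real.zero_rpow (show α ≠ 0 by linarith)]
    · rw [oddPow, abs_of_pos h0, mul_comm, ← Real.rpow_add_one h0.ne', sub_add_cancel]
  rw [← this]
  exact hs y hy

/-! ### The harmonic function with a jump at the corner -/

/-- A holomorphic function on the right half plane whose imaginary part at `x + i y` equals `y` for
`x = 0` and vanishes for `y = 0` and for `y = 1`. -/
def jumpLog (z : ℂ) : ℂ :=
  ((-(2 / Real.pi) : ℝ) : ℂ) * Complex.log (1 + Complex.exp (-(Real.pi * z)))

theorem norm_exp_neg_pi_mul_lt_one {z : ℂ} (hz : 0 < z.re) :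
    ‖Complex.exp (-(Real.pi * z))‖ < 1 := by
  rw [Complex.norm_exp, Complex.neg_re, Complex.re_ofReal_mul, Real.exp_lt_one_iff, neg_lt_zero]
  positivity

/-- For `x > 0` the exponential has modulus below `1`; on `x = 0` the real part is `1 + cos (π y)`,
which vanishes only at the excluded corner. -/
theorem jumpLog_mem_slitPlane {q : ℝ × ℝ} (hx : 0 ≤ q.1) (hy : q.2 ∈ Icc (0 : ℝ) 1)
    (hq : q ≠ (0, 1)) : 1 + Complex.exp (-(Real.pi * toC q)) ∈ Complex.slitPlane := by
  rcases hx.eq_or_lt with h0 | h0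
  · have hy1 : q.2 < 1 := lt_of_le_of_ne hy.2 fun h => hq (Prod.ext h0.symm h)
    left
    have : -(Real.pi * toC q) = ((-(Real.pi * q.2) : ℝ) : ℂ) * Complex.I := by
      simp [toC, ← h0, mul_assoc]
    rw [this, Complex.add_re, Complex.one_re, Complex.exp_ofReal_mul_I_re, Real.cos_neg]
    have h1 : Real.cos Real.pi < Real.cos (Real.pi * q.2) :=
      Real.cos_lt_cos_of_nonneg_of_le_pi (mul_nonneg Real.pi_pos.le hy.1) le_rfl
        (by nlinarith [Real.pi_pos])
    rw [Real.cos_pi] at h1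
    linarith
  · exact Complex.mem_slitPlane_of_norm_lt_one (norm_exp_neg_pi_mul_lt_one (by rwa [toC_re]))

theorem differentiableOn_jumpLog : DifferentiableOn ℂ jumpLog {z | 0 < z.re} := by
  intro z hz
  have h1 : DifferentiableAt ℂ (fun z => 1 + Complex.exp (-(Real.pi * z))) z := by fun_prop
  exact ((h1.clog (Complex.mem_slitPlane_of_norm_lt_one
    (norm_exp_neg_pi_mul_lt_one hz))).const_mul _).differentiableWithinAt

theorem continuousOn_jumpLog :
    ContinuousOn (fun q => jumpLog (toC q)) ((Ici 0 ×ˢ Icc (0 : ℝ) 1) \ {(0, 1)}) := by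
  have hc := continuous_toC
  refine continuousOn_const.mul (ContinuousOn.clog (by fun_prop) fun q hq => ?_)
  exact jumpLog_mem_slitPlane hq.1.1 hq.1.2 hq.2

theorem jumpLog_im (z : ℂ) : (jumpLog z).im =
    -(2 / Real.pi) * (Complex.log (1 + Complex.exp (-(Real.pi * z)))).im := by
  rw [jumpLog, Complex.im_ofReal_mul]

theorem abs_jumpLog_im_le (z : ℂ) : |(jumpLog z).im| ≤ 2 := by
  rw [jumpLog_im, Complex.log_im, abs_mul, abs_neg, abs_of_pos (by positivity)]
  have := Complex.abs_arg_le_pi (1 + Complex.exp (-(Real.pi * z)))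
  calc _ ≤ 2 / Real.pi * Real.pi := by gcongr
    _ = 2 := by field_simp

/-- Since `1 + exp (-iπy) = 2 cos (πy/2) exp (-iπy/2)`, the argument is `-πy/2`, and the factor
`-2/π` turns it into `y`. -/
theorem jumpLog_im_left {y : ℝ} (hy : y ∈ Ico (0 : ℝ) 1) : (jumpLog (toC (0, y))).im = y := by
  have hpi := Real.pi_pos
  have e : 1 + Complex.exp (-(Real.pi * toC (0, y))) =
      ((2 * Real.cos (-(Real.pi * y / 2)) : ℝ) : ℂ) * (Complex.cos ((-(Real.pi * y / 2) : ℝ) : ℂ) +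
        Complex.sin ((-(Real.pi * y / 2) : ℝ) : ℂ) * Complex.I) := by
    have h1 : -(Real.pi * toC (0, y)) = (2 * ((-(Real.pi * y / 2) : ℝ) : ℂ)) * Complex.I := by
      simp only [toC]; push_cast; ring
    rw [h1, Complex.exp_mul_I, Complex.cos_two_mul, Complex.sin_two_mul]
    push_cast
    ring
  have hcos : 0 < Real.cos (-(Real.pi * y / 2)) := by
    apply Real.cos_pos_of_mem_Ioo
    constructor <;> nlinarith [hy.1, hy.2]
  rw [jumpLog_im, Complex.log_im, e, Complex.arg_mul_cos_add_sin_mul_I (by positivity)]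
  · field_simp
  · constructor <;> nlinarith [hy.1, hy.2]

theorem jumpLog_im_bottom (x : ℝ) : (jumpLog (toC (x, 0))).im = 0 := by
  have : 1 + Complex.exp (-(Real.pi * toC (x, 0))) = ((1 + Real.exp (-(Real.pi * x)) : ℝ) : ℂ) := by
    simp [toC]
  rw [jumpLog_im, Complex.log_im, this, Complex.arg_ofReal_of_nonneg (by positivity), mul_zero]

theorem jumpLog_im_top {x : ℝ} (hx : 0 ≤ x) : (jumpLog (toC (x, 1))).im = 0 := by
  have : 1 + Complex.exp (-(Real.pi * toC (x, 1))) = ((1 - Real.exp (-(Real.pi * x)) : ℝ) : ℂ) := by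
    have : -(Real.pi * toC (x, 1)) = ((-(Real.pi * x) : ℝ) : ℂ) - Real.pi * Complex.I := by
      simp only [toC]; push_cast; ring
    rw [this, Complex.exp_sub, Complex.exp_pi_mul_I]
    push_cast
    ring
  have h0 : Real.exp (-(Real.pi * x)) ≤ 1 :=
    Real.exp_le_one_iff.2 (neg_nonpos.2 (mul_nonneg Real.pi_pos.le hx))
  rw [jumpLog_im, Complex.log_im, this, Complex.arg_ofReal_of_nonneg (by linarith), mul_zero]

/-- This is the Taylor series of `log (1 + w)` at `w = exp (-π (b + i y))`; the coefficients decay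
geometrically because `b > 0`. It serves to cancel the values of `jumpLog` on the side `x = b`. -/
theorem exists_sine_expansion_jumpLog {b : ℝ} (hb : 0 < b) :
    ∃ d : ℕ → ℝ, Summable (fun n => |d n|) ∧
      ∀ y, HasSum (fun n => d n * Real.sin (((n : ℤ) : ℝ) * Real.pi * y))
        (jumpLog (toC (b, y))).im := by
  have hr : Real.exp (-(Real.pi * b)) < 1 := by
    rw [Real.exp_lt_one_iff, neg_lt_zero]; positivity
  refine ⟨fun n => 2 / Real.pi * ((-1) ^ (n + 1) * Real.exp (-(Real.pi * b)) ^ n / n), ?_,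
    fun y => ?_⟩
  · refine Summable.of_nonneg_of_le (fun _ => abs_nonneg _) (fun n => ?_)
      ((summable_geometric_of_lt_one (Real.exp_pos _).le hr).mul_left (2 / Real.pi))
    rw [abs_mul, abs_of_pos (show 0 < 2 / Real.pi by positivity), abs_div, abs_mul, abs_pow,
      abs_neg, abs_one, one_pow, one_mul, abs_of_pos (by positivity), Nat.abs_cast]
    gcongr
    rcases n.eq_zero_or_pos with rfl | hn
    · simp
    · exact div_le_self (by positivity) (by exact_mod_cast hn)
  · have h1 := Complex.hasSum_im (Complex.hasSum_taylorSeries_log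
      (norm_exp_neg_pi_mul_lt_one (z := toC (b, y)) (by rwa [toC_re])))
    have h2 := h1.mul_left (-(2 / Real.pi))
    rw [jumpLog_im]
    refine (congrArg (fun f : ℕ → ℝ => HasSum f _) (funext fun n => ?_)).mpr h2
    have e : (-1) ^ (n + 1) * Complex.exp (-(Real.pi * toC (b, y))) ^ n / (n : ℂ) =
        (((-1) ^ (n + 1) * Real.exp (-(Real.pi * b)) ^ n / n : ℝ) : ℂ) *
          Complex.exp ((-(n * Real.pi * y) : ℝ) * Complex.I) := by
      have : Complex.exp (-(Real.pi * toC (b, y))) ^ n = Complex.exp (-(Real.pi * b)) ^ n *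
          Complex.exp ((-(n * Real.pi * y) : ℝ) * Complex.I) := by
        rw [← Complex.exp_nat_mul, ← Complex.exp_nat_mul, ← Complex.exp_add]
        congr 1
        simp only [toC]; push_cast; ring
      rw [this]
      push_cast
      ring
    rw [e, Complex.im_ofReal_mul, Complex.exp_ofReal_mul_I_im, Real.sin_neg, Int.cast_natCast]
    ring

/-! ### Existence of the harmonic part -/

theorem sineSeries_im_neg {ι : Type} {b : ℝ} {c : ι → ℝ} {N : ι → ℤ} (hb : 0 < b)
    (hc : Summable fun i => |c i|) {x : ℝ} (hx : |x| ≤ b) (y : ℝ) :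
    (sineSeries b c N (toC (x, -y))).im = -(sineSeries b c N (toC (x, y))).im := by
  rw [sineSeries_im hb hc hx, sineSeries_im hb hc hx, ← tsum_neg]
  refine tsum_congr fun i => ?_
  simp only [mul_neg, Real.sin_neg]

/-- The function is `y + h · s + (h - 1) · (ℓ - t)`, where `s` equals `y ^ α - y` on the left side
and `0` on the others, while `ℓ - t` equals `y` on the left (below the corner) and `0` on the
others. On the left this sums to `y + h (y ^ α - y) + (h - 1) y = h y ^ α`. For `h = 1` the
discontinuous part drops out. -/
theorem exists_isHarmonicPart {b h α : ℝ} (hb : 0 < b) (hα : 1 < α) :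
    ∃ u, IsHarmonicPart b h α u := by
  obtain ⟨c, hc, hcs⟩ := exists_sine_expansion_rpow hα
  obtain ⟨d, hd, hds⟩ := exists_sine_expansion_jumpLog hb
  set S : ℂ → ℂ := sineSeries b c id with hS
  set T : ℂ → ℂ := sineSeries b d (fun n : ℕ => (n : ℤ)) with hT
  -- The reflection `z ↦ b - z` moves the data of `S` to the left side but also changes `y` to `-y`;
  -- as `Im S` is odd in `y`, the minus sign compensates.
  set H : ℂ → ℂ := fun z => z - h * S (b - z) + ((h - 1 : ℝ) : ℂ) * (jumpLog z - T z) with hH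
  have hrefl : ∀ q : ℝ × ℝ, (b : ℂ) - toC q = toC (b - q.1, -q.2) := fun q => by
    simp only [toC]; push_cast; ring
  have him : ∀ q : ℝ × ℝ, q.1 ∈ Icc 0 b → (H (toC q)).im = q.2 + h * (S (toC (b - q.1, q.2))).im +
      (h - 1) * ((jumpLog (toC q)).im - (T (toC q)).im) := by
    intro q hq
    have h1 := sineSeries_im_neg (N := id) hb hc (x := b - q.1) (y := q.2)
      (by rw [abs_of_nonneg] <;> linarith [hq.1, hq.2])
    simp only [hH, Complex.add_im, Complex.sub_im, Complex.im_ofReal_mul, toC_im, hrefl]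
    rw [hS, h1]
    ring
  set V : Set ℂ := {z | 0 < z.re ∧ z.re < b} with hV
  have hVo : IsOpen V := (isOpen_lt continuous_const Complex.continuous_re).inter
    (isOpen_lt Complex.continuous_re continuous_const)
  have hHd : DifferentiableOn ℂ H V := by
    have d1 : DifferentiableOn ℂ (fun z => S (b - z)) V :=
      (differentiableOn_sineSeries hb hc).comp (by fun_prop) fun z hz => by
        simp only [mem_ofPred_eq, Complex.sub_re, Complex.ofReal_re, abs_lt]
        constructor <;> linarith [hz.1, hz.2]
    have d2 : DifferentiableOn ℂ T V := (differentiableOn_sineSeries hb hd).mono fun z hz =>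
      abs_lt.2 ⟨by linarith [hz.1], hz.2⟩
    have d3 : DifferentiableOn ℂ jumpLog V := differentiableOn_jumpLog.mono fun z hz => hz.1
    exact (differentiableOn_id.sub (d1.const_mul _)).add ((d3.sub d2).const_mul _)
  have hUV : ∀ q ∈ rect 0 b, toC q ∈ V := fun q hq => by
    simp only [hV, mem_ofPred_eq, toC_re]; exact hq.1
  refine ⟨fun q => (H (toC q)).im, contDiffOn_im hVo hHd hUV,
    fun q hq => lap_im hVo hHd (hUV q hq), ?_, ?_, fun y hy => ?_, fun y hy => ?_,
    fun x hx => ?_, fun x hx => ?_⟩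
  · refine ⟨1 + |h| * (∑' i, |c i| * (1 + 1 / Real.sinh (Real.pi * b))) +
      |h - 1| * (2 + ∑' i, |d i| * (1 + 1 / Real.sinh (Real.pi * b))), fun q hq => ?_⟩
    rw [him q ⟨hq.1.1.le, hq.1.2.le⟩]
    refine (abs_add_le _ _).trans (add_le_add ((abs_add_le _ _).trans (add_le_add ?_ ?_)) ?_)
    · rw [abs_of_pos hq.2.1]; exact hq.2.2.le
    · rw [abs_mul]
      refine mul_le_mul_of_nonneg_left (abs_sineSeries_im_le hb hc ?_) (abs_nonneg _)
      rw [toC_re, abs_of_nonneg] <;> linarith [hq.1.1, hq.1.2]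
    · rw [abs_mul]
      refine mul_le_mul_of_nonneg_left ((abs_sub _ _).trans (add_le_add (abs_jumpLog_im_le _)
        (abs_sineSeries_im_le hb hd ?_))) (abs_nonneg _)
      rw [toC_re, abs_of_pos hq.1.1]; exact hq.1.2.le
  · refine Complex.continuous_im.comp_continuousOn ?_
    have hcC := continuous_toC
    have c1 : ContinuousOn (fun q => S (b - toC q)) (Icc 0 b ×ˢ Icc (0 : ℝ) 1) :=
      (continuousOn_sineSeries hb hc).comp (by fun_prop) fun q hq => by
        simp only [mem_ofPred_eq, Complex.sub_re, Complex.ofReal_re, toC_re, abs_le]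
        constructor <;> linarith [hq.1.1, hq.1.2]
    have c2 : ContinuousOn (fun q => T (toC q)) (Icc 0 b ×ˢ Icc (0 : ℝ) 1) :=
      (continuousOn_sineSeries hb hd).comp (by fun_prop) fun q hq => by
        simp only [mem_ofPred_eq, toC_re, abs_le]
        constructor <;> linarith [hq.1.1, hq.1.2]
    have c12 : ContinuousOn (fun q => toC q - h * S (b - toC q)) (Icc 0 b ×ˢ Icc (0 : ℝ) 1) :=
      hcC.continuousOn.sub (continuousOn_const.mul c1)
    by_cases h1 : h = 1
    · refine (c12.mono sdiff_subset).congr fun q _ => ?_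
      simp only [hH, h1, sub_self, Complex.ofReal_zero, zero_mul, add_zero]
    · refine (c12.mono sdiff_subset).add (continuousOn_const.mul
        ((continuousOn_jumpLog.mono ?_).sub (c2.mono sdiff_subset)))
      intro q hq
      exact ⟨⟨hq.1.1.1, hq.1.2⟩, fun h' => hq.2 ⟨h', h1⟩⟩
  · have e1 : (S (toC (b, y))).im = y ^ α - y := by
      rw [hS, sineSeries_im_right hb hc]
      exact (hcs y ⟨hy.1.le, hy.2.le⟩).tsum_eq
    rw [him _ ⟨le_rfl, hb.le⟩, jumpLog_im_left ⟨hy.1.le, hy.2⟩, hT, sineSeries_im_left hb hd]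
    simp only [sub_zero, e1]
    ring
  · have e1 : (T (toC (b, y))).im = (jumpLog (toC (b, y))).im := by
      rw [hT, sineSeries_im_right hb hd]
      exact (hds y).tsum_eq
    rw [him _ ⟨hb.le, le_rfl⟩, e1, sub_self, sub_self, hS, sineSeries_im_left hb hc]
    simp
  · have hx' : |x| ≤ b := by rw [abs_of_pos hx.1]; exact hx.2.le
    have hx'' : |b - x| ≤ b := by rw [abs_of_nonneg] <;> linarith [hx.1, hx.2]
    rw [him _ ⟨hx.1.le, hx.2.le⟩, jumpLog_im_bottom, hT, sineSeries_im_bottom hb hd hx', hS,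
      sineSeries_im_bottom hb hc hx'']
    simp
  · have hx' : |x| ≤ b := by rw [abs_of_pos hx.1]; exact hx.2.le
    have hx'' : |b - x| ≤ b := by rw [abs_of_nonneg] <;> linarith [hx.1, hx.2]
    rw [him _ ⟨hx.1.le, hx.2.le⟩, jumpLog_im_top hx.1.le, hT, sineSeries_im_top hb hd hx', hS,
      sineSeries_im_top hb hc hx'']
    simp

/-! ### Rectangles and boundary limits -/

theorem isOpen_rect (c d : ℝ) : IsOpen (rect c d) := isOpen_Ioo.prod isOpen_Ioo

theorem measurableSet_rect (c d : ℝ) : MeasurableSet (rect c d) := (isOpen_rect c d).measurableSet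

theorem closure_rect {c d : ℝ} (h : c < d) : closure (rect c d) = Icc c d ×ˢ Icc (0 : ℝ) 1 := by
  rw [rect, closure_prod_eq, closure_Ioo h.ne, closure_Ioo zero_ne_one]

theorem isBounded_rect (c d : ℝ) : Bornology.IsBounded (rect c d) :=
  (Metric.isBounded_Ioo _ _).prod (Metric.isBounded_Ioo _ _)

theorem volume_rect_lt_top (c d : ℝ) : volume (rect c d) < ⊤ := (isBounded_rect c d).measure_lt_top

theorem volume_restrict_rect (c d : ℝ) : (volume : Measure (ℝ × ℝ)).restrict (rect c d) =
    (volume.restrict (Ioo c d)).prod (volume.restrict (Ioo (0 : ℝ) 1)) := by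
  rw [rect, Measure.volume_eq_prod, Measure.prod_restrict]

theorem eventually_neg_lt_of_continuousWithinAt {U : Set (ℝ × ℝ)} {w : ℝ × ℝ → ℝ} {p : ℝ × ℝ}
    (hc : ContinuousWithinAt w U p) (h0 : 0 ≤ w p) : ∀ δ > 0, ∀ᶠ q in 𝓝[U] p, -δ < w q :=
  fun _ hδ => hc (lt_mem_nhds (by linarith))

/-! ### The maximum principle on a rectangle, with an exceptional corner -/

/-- A nonnegative harmonic function on `rect 0 b` that tends to `∞` at the corner `(0, 1)`. -/
def cornerBarrier (b : ℝ) (q : ℝ × ℝ) : ℝ :=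
  (-Complex.I * Complex.log (toC q - Complex.I) + Real.log (b + 2) * Complex.I).im

/-- Harmonicity is visible from the imaginary part of a holomorphic function; sign and blow-up at
the corner from this real form. -/
theorem cornerBarrier_eq (b : ℝ) (q : ℝ × ℝ) :
    cornerBarrier b q = Real.log (b + 2) - Real.log ‖toC q - Complex.I‖ := by
  simp [cornerBarrier, Complex.log_re]
  ring

theorem differentiableOn_cornerBarrier_aux (b : ℝ) : DifferentiableOn ℂ (fun z =>
    -Complex.I * Complex.log (z - Complex.I) + Real.log (b + 2) * Complex.I) {z | 0 < z.re} := by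
  intro z hz
  have : DifferentiableAt ℂ (fun z => z - Complex.I) z := by fun_prop
  exact (((this.clog (Or.inl (by simpa using hz))).const_mul _).add_const _).differentiableWithinAt

theorem isOpen_re_pos : IsOpen {z : ℂ | 0 < z.re} := isOpen_lt continuous_const Complex.continuous_re

theorem toC_mem_re_pos {b : ℝ} {q : ℝ × ℝ} (hq : q ∈ rect 0 b) : toC q ∈ {z : ℂ | 0 < z.re} := by
  rw [mem_ofPred_eq, toC_re]
  exact hq.1.1

theorem norm_toC_sub_I_pos {b : ℝ} {q : ℝ × ℝ} (hq : q ∈ rect 0 b) : 0 < ‖toC q - Complex.I‖ := by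
  rw [norm_pos_iff]
  intro h
  have h2 := congrArg Complex.re h
  simp only [Complex.sub_re, toC_re, Complex.I_re, Complex.zero_re, sub_zero] at h2
  exact hq.1.1.ne' h2

theorem contDiffOn_cornerBarrier (b : ℝ) : ContDiffOn ℝ 2 (cornerBarrier b) (rect 0 b) :=
  contDiffOn_im isOpen_re_pos (differentiableOn_cornerBarrier_aux b) fun _ => toC_mem_re_pos

theorem lap_cornerBarrier {b : ℝ} {q : ℝ × ℝ} (hq : q ∈ rect 0 b) : lap (cornerBarrier b) q = 0 :=
  lap_im isOpen_re_pos (differentiableOn_cornerBarrier_aux b) (toC_mem_re_pos hq)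

/-- The normalisation `log (b + 2)` suffices because `|z - i| ≤ x + (1 - y)`, which is below `b + 1`
on the rectangle. -/
theorem cornerBarrier_nonneg {b : ℝ} {q : ℝ × ℝ} (hq : q ∈ rect 0 b) : 0 ≤ cornerBarrier b q := by
  rw [cornerBarrier_eq, sub_nonneg]
  refine Real.log_le_log (norm_toC_sub_I_pos hq) ((Complex.norm_le_abs_re_add_abs_im _).trans ?_)
  simp only [Complex.sub_re, Complex.sub_im, toC_re, toC_im, Complex.I_re, Complex.I_im, sub_zero]
  rw [abs_of_pos hq.1.1, abs_of_neg (by linarith [hq.2.2])]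
  linarith [hq.1.2, hq.2.1]

theorem eventually_lt_cornerBarrier (b K : ℝ) :
    ∀ᶠ q in 𝓝[rect 0 b] (0, 1), K < cornerBarrier b q := by
  have hc : Continuous fun q => ‖toC q - Complex.I‖ := (continuous_toC.sub continuous_const).norm
  have h0 : ‖toC (0, 1) - Complex.I‖ = 0 := by simp [toC]
  have h1 : ∀ᶠ q in 𝓝 ((0, 1) : ℝ × ℝ), ‖toC q - Complex.I‖ < Real.exp (Real.log (b + 2) - K) :=
    hc.continuousAt.eventually_lt continuousAt_const (by rw [h0]; exact Real.exp_pos _)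
  filter_upwards [nhdsWithin_le_nhds h1, self_mem_nhdsWithin] with q hq hqr
  rw [cornerBarrier_eq]
  have := (Real.log_lt_iff_lt_exp (norm_toC_sub_I_pos hqr)).2 hq
  linarith

/-- A Phragmén–Lindelöf argument: since `w` is bounded below, any positive multiple `κ` of the
barrier makes the sum positive near the corner; then `κ ↓ 0`. -/
theorem nonneg_of_lap_nonpos_of_corner {b : ℝ} {w : ℝ × ℝ → ℝ}
    (hw : ContDiffOn ℝ 2 w (rect 0 b)) (hl : ∀ q ∈ rect 0 b, lap w q ≤ 0)
    {M : ℝ} (hM : ∀ q ∈ rect 0 b, -M ≤ w q)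
    (hbd : ∀ p ∈ closure (rect 0 b), p ∉ rect 0 b → p ≠ (0, 1) →
      ∀ δ > 0, ∀ᶠ q in 𝓝[rect 0 b] p, -δ < w q) :
    ∀ q ∈ rect 0 b, 0 ≤ w q := by
  have key : ∀ κ > 0, ∀ q ∈ rect 0 b, 0 ≤ w q + κ * cornerBarrier b q := by
    intro κ hκ
    have hC : ContDiffOn ℝ 2 (fun q => κ * cornerBarrier b q) (rect 0 b) :=
      contDiffOn_const.mul (contDiffOn_cornerBarrier b)
    refine nonneg_of_lap_nonpos (isOpen_rect 0 b) (isBounded_rect 0 b) (hw.add hC)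
      (fun q hq => ?_) fun p hp hpn δ hδ => ?_
    · rw [lap_add (isOpen_rect 0 b) hw hC hq, lap_const_mul, lap_cornerBarrier hq]
      simpa using hl q hq
    · by_cases hpc : p = (0, 1)
      · subst hpc
        filter_upwards [eventually_lt_cornerBarrier b (M / κ), self_mem_nhdsWithin] with q h1 h2
        have h3 := hM q h2
        rw [div_lt_iff₀ hκ] at h1
        linarith
      · filter_upwards [hbd p hp hpn hpc δ hδ, self_mem_nhdsWithin] with q h1 h2
        have := mul_nonneg hκ.le (cornerBarrier_nonneg h2)
        linarith
  intro q hq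
  have hlim : Tendsto (fun κ => w q + κ * cornerBarrier b q) (𝓝[>] 0) (𝓝 (w q)) := by
    have : Continuous fun κ => w q + κ * cornerBarrier b q := by fun_prop
    simpa using (this.tendsto 0).mono_left nhdsWithin_le_nhds
  refine ge_of_tendsto hlim ?_
  filter_upwards [self_mem_nhdsWithin] with κ hκ
  exact key κ hκ q hq

/-! ### Properties of the harmonic part -/

theorem lap_comp_add (f : ℝ × ℝ → ℝ) (v q : ℝ × ℝ) :
    lap (fun q => f (q + v)) q = lap f (q + v) := by
  simp only [lap, Prod.fst_add, Prod.snd_add]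
  have h1 := congrFun (iteratedDeriv_comp_add_const 2 (fun x => f (x, q.2 + v.2)) v.1) q.1
  have h2 := congrFun (iteratedDeriv_comp_add_const 2 (fun y => f (q.1 + v.1, y)) v.2) q.2
  rw [← h1, ← h2]
  rfl

theorem lap_sub {f g : ℝ × ℝ → ℝ} {U : Set (ℝ × ℝ)} (hU : IsOpen U) (hf : ContDiffOn ℝ 2 f U)
    (hg : ContDiffOn ℝ 2 g U) {p : ℝ × ℝ} (hp : p ∈ U) :
    lap (fun q => f q - g q) p = lap f p - lap g p := by
  have := lap_add hU hf (contDiffOn_const (c := (-1 : ℝ)).mul hg) hp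
  rw [lap_const_mul] at this
  simpa [sub_eq_add_neg] using this

theorem contDiffOn_rpow_snd (h α b c : ℝ) {n : WithTop ℕ∞} :
    ContDiffOn ℝ n (fun q : ℝ × ℝ => h * q.2 ^ α) (rect c b) :=
  contDiffOn_const.mul (contDiffOn_snd.rpow_const_of_ne fun q hq => (show 0 < q.2 from hq.2.1).ne')

theorem continuous_rpow_snd {α : ℝ} (hα : 1 < α) (h : ℝ) :
    Continuous fun q : ℝ × ℝ => h * q.2 ^ α :=
  continuous_const.mul (continuous_snd.rpow_const fun _ => Or.inr (by linarith))

theorem lap_rpow_snd_nonneg {h α : ℝ} (hh : 0 ≤ h) (hα : 1 < α) {q : ℝ × ℝ} (hq : 0 < q.2) :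
    0 ≤ lap (fun q : ℝ × ℝ => h * q.2 ^ α) q := by
  rw [lap_const_mul]
  refine mul_nonneg hh ?_
  have e1 : deriv (fun y : ℝ => y ^ α) = fun y => α * y ^ (α - 1) := by
    funext y; exact (Real.hasDerivAt_rpow_const (Or.inr hα.le)).deriv
  have e2 : deriv (fun y : ℝ => α * y ^ (α - 1)) q.2 = α * ((α - 1) * q.2 ^ (α - 1 - 1)) :=
    ((Real.hasDerivAt_rpow_const (Or.inl hq.ne')).const_mul α).deriv
  simp only [lap, iteratedDeriv_succ (n := 1), iteratedDeriv_one, e1, e2, deriv_const', zero_add]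
  have : 0 < α - 1 := by linarith
  positivity

namespace IsHarmonicPart

variable {b h α : ℝ} {u : ℝ × ℝ → ℝ}

theorem continuousOn' (hu : IsHarmonicPart b h α u) :
    ContinuousOn u ((Icc 0 b ×ˢ Icc (0 : ℝ) 1) \ {(0, 1)}) :=
  hu.continuousOn.mono fun _ hq => ⟨hq.1, fun h' => hq.2 h'.1⟩

/-- The data are prescribed on open sides only; here and in the next three lemmas continuity extends
them to the end points, always excluding the corner `(0, 1)`. -/
theorem left' (hu : IsHarmonicPart b h α u) (hb : 0 < b) (hα : 1 < α) {y : ℝ}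
    (hy : y ∈ Ico (0 : ℝ) 1) : u (0, y) = h * y ^ α := by
  have hs : EqOn u (fun q => h * q.2 ^ α) ({0} ×ˢ Ioo (0 : ℝ) 1) := by
    rintro ⟨x, y⟩ ⟨rfl, hy⟩
    exact hu.left y hy
  have h2 := hs.of_subset_closure (t := {0} ×ˢ Ico (0 : ℝ) 1)
    (hu.continuousOn'.mono ?_) (continuous_rpow_snd hα h).continuousOn
    (prod_mono le_rfl Ioo_subset_Ico_self) ?_
  · exact h2 (show ((0 : ℝ), y) ∈ _ from ⟨rfl, hy⟩)
  · rintro ⟨x, y⟩ ⟨rfl, hy⟩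
    exact ⟨⟨⟨le_rfl, hb.le⟩, hy.1, hy.2.le⟩, fun h' => hy.2.ne (congrArg Prod.snd h')⟩
  · rw [closure_prod_eq, closure_Ioo zero_ne_one]
    exact prod_mono subset_closure Ico_subset_Icc_self

theorem right' (hu : IsHarmonicPart b h α u) (hb : 0 < b) {y : ℝ}
    (hy : y ∈ Icc (0 : ℝ) 1) : u (b, y) = y := by
  have hs : EqOn u (fun q => q.2) ({b} ×ˢ Ioo (0 : ℝ) 1) := by
    rintro ⟨x, y⟩ ⟨rfl, hy⟩
    exact hu.right y hy
  have h2 := hs.of_subset_closure (t := {b} ×ˢ Icc (0 : ℝ) 1)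
    (hu.continuousOn'.mono ?_) continuous_snd.continuousOn
    (prod_mono le_rfl Ioo_subset_Icc_self) ?_
  · exact h2 (show (b, y) ∈ _ from ⟨rfl, hy⟩)
  · rintro ⟨x, y⟩ ⟨rfl, hy⟩
    exact ⟨⟨⟨hb.le, le_rfl⟩, hy⟩, fun h' => hb.ne' (congrArg Prod.fst h')⟩
  · rw [closure_prod_eq, closure_Ioo zero_ne_one]
    exact prod_mono subset_closure le_rfl

theorem bottom' (hu : IsHarmonicPart b h α u) (hb : 0 < b) {x : ℝ}
    (hx : x ∈ Icc 0 b) : u (x, 0) = 0 := by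
  have hs : EqOn u (fun _ => 0) (Ioo 0 b ×ˢ {(0 : ℝ)}) := by
    rintro ⟨x, y⟩ ⟨hx, rfl⟩
    exact hu.bottom x hx
  have h2 := hs.of_subset_closure (t := Icc 0 b ×ˢ {(0 : ℝ)})
    (hu.continuousOn'.mono ?_) continuousOn_const
    (prod_mono Ioo_subset_Icc_self le_rfl) ?_
  · exact h2 (show (x, (0 : ℝ)) ∈ _ from ⟨hx, rfl⟩)
  · rintro ⟨x, y⟩ ⟨hx, rfl⟩
    exact ⟨⟨hx, le_rfl, zero_le_one⟩, fun h' => zero_ne_one (congrArg Prod.snd h')⟩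
  · rw [closure_prod_eq, closure_Ioo hb.ne]
    exact prod_mono le_rfl subset_closure

theorem top' (hu : IsHarmonicPart b h α u) (hb : 0 < b) {x : ℝ}
    (hx : x ∈ Ioc 0 b) : u (x, 1) = 1 := by
  have hs : EqOn u (fun _ => 1) (Ioo 0 b ×ˢ {(1 : ℝ)}) := by
    rintro ⟨x, y⟩ ⟨hx, rfl⟩
    exact hu.top x hx
  have h2 := hs.of_subset_closure (t := Ioc 0 b ×ˢ {(1 : ℝ)})
    (hu.continuousOn'.mono ?_) continuousOn_const
    (prod_mono Ioo_subset_Ioc_self le_rfl) ?_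
  · exact h2 (show (x, (1 : ℝ)) ∈ _ from ⟨hx, rfl⟩)
  · rintro ⟨x, y⟩ ⟨hx, rfl⟩
    exact ⟨⟨Ioc_subset_Icc_self hx, zero_le_one, le_rfl⟩,
      fun h' => hx.1.ne' (congrArg Prod.fst h')⟩
  · rw [closure_prod_eq, closure_Ioo hb.ne]
    exact prod_mono Ioc_subset_Icc_self subset_closure

theorem continuousWithinAt_rect (hu : IsHarmonicPart b h α u) {p : ℝ × ℝ}
    (hp : p ∈ Icc 0 b ×ˢ Icc (0 : ℝ) 1) (hp' : p ≠ (0, 1)) : ContinuousWithinAt u (rect 0 b) p := by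
  refine (hu.continuousOn' p ⟨hp, hp'⟩).mono fun q hq => ?_
  exact ⟨⟨Ioo_subset_Icc_self hq.1, Ioo_subset_Icc_self hq.2⟩,
    fun h' => hq.1.1.ne' (congrArg Prod.fst h')⟩

theorem mem_sides {c d e : ℝ} {p : ℝ × ℝ} (hp : p ∈ Icc c d ×ˢ Icc (0 : ℝ) e)
    (hn : p ∉ Ioo c d ×ˢ Ioo (0 : ℝ) e) : p.1 = c ∨ p.1 = d ∨ p.2 = 0 ∨ p.2 = e := by
  by_contra! hne
  exact hn ⟨⟨lt_of_le_of_ne hp.1.1 hne.1.symm, lt_of_le_of_ne hp.1.2 hne.2.1⟩,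
    lt_of_le_of_ne hp.2.1 hne.2.2.1.symm, lt_of_le_of_ne hp.2.2 hne.2.2.2⟩

theorem rpow_le_self' {h α y : ℝ} (hα : 1 < α) (hh : h ∈ Ioc (0 : ℝ) 1) (hy : y ∈ Icc (0 : ℝ) 1) :
    h * y ^ α ≤ y := by
  have h1 : y ^ α ≤ y := by
    simpa using Real.rpow_le_rpow_of_exponent_ge_of_imp hy.1 hy.2 hα.le (fun _ h1 => by linarith)
  have h2 : 0 ≤ y ^ α := Real.rpow_nonneg hy.1 _
  nlinarith [hh.1, hh.2]

/-- By convexity of `y ^ α` the difference `u - h y ^ α` is superharmonic, and on the boundary it is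
nonnegative since `h y ^ α ≤ y ≤ 1`. -/
theorem rpow_le_of_mem_rect (hu : IsHarmonicPart b h α u) (hb : 0 < b) (hα : 1 < α)
    (hh : h ∈ Ioc (0 : ℝ) 1) {q : ℝ × ℝ} (hq : q ∈ rect 0 b) : h * q.2 ^ α ≤ u q := by
  obtain ⟨M, hM⟩ := hu.bounded
  rw [← sub_nonneg]
  refine nonneg_of_lap_nonpos_of_corner (w := fun q => u q - h * q.2 ^ α) (M := M + 1)
    (hu.contDiffOn.sub (contDiffOn_rpow_snd h α b 0)) (fun q hq => ?_) (fun q hq => ?_)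
    (fun p hp hpn hpc => ?_) q hq
  · rw [lap_sub (isOpen_rect 0 b) hu.contDiffOn (contDiffOn_rpow_snd h α b 0) hq, hu.harmonic q hq]
    linarith [lap_rpow_snd_nonneg hh.1.le hα hq.2.1]
  · have h1 := (abs_le.1 (hM q hq)).1
    have h2 := rpow_le_self' hα hh (Ioo_subset_Icc_self hq.2)
    linarith [hq.2.2]
  · rw [closure_rect hb] at hp
    refine eventually_neg_lt_of_continuousWithinAt ((hu.continuousWithinAt_rect hp hpc).sub
      (continuous_rpow_snd hα h).continuousWithinAt) ?_
    obtain ⟨x, y⟩ := p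
    have hy := rpow_le_self' hα hh hp.2
    rcases mem_sides hp hpn with rfl | rfl | rfl | rfl
    · have : y < 1 := lt_of_le_of_ne hp.2.2 fun h' => hpc (Prod.ext rfl h')
      simp [hu.left' hb hα ⟨hp.2.1, this⟩]
    · simp only [hu.right' hb hp.2]
      linarith
    · simp [hu.bottom' hb hp.1, Real.zero_rpow (show α ≠ 0 by linarith)]
    · have : 0 < x := lt_of_le_of_ne hp.1.1 fun h' => hpc (Prod.ext h'.symm rfl)
      simpa [hu.top' hb ⟨this, hp.1.2⟩] using hy

theorem le_snd_of_mem_rect (hu : IsHarmonicPart b h α u) (hb : 0 < b) (hα : 1 < α)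
    (hh : h ∈ Ioc (0 : ℝ) 1) {q : ℝ × ℝ} (hq : q ∈ rect 0 b) : u q ≤ q.2 := by
  obtain ⟨M, hM⟩ := hu.bounded
  rw [← sub_nonneg]
  have hs : ContDiffOn ℝ 2 (fun q : ℝ × ℝ => q.2) (rect 0 b) := contDiffOn_snd
  refine nonneg_of_lap_nonpos_of_corner (w := fun q => q.2 - u q) (M := M)
    (hs.sub hu.contDiffOn) (fun q hq => ?_) (fun q hq => ?_)
    (fun p hp hpn hpc => ?_) q hq
  · rw [lap_sub (isOpen_rect 0 b) hs hu.contDiffOn hq, hu.harmonic q hq]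
    simp only [lap, iteratedDeriv_succ (n := 1), iteratedDeriv_one]
    simp
  · have h1 := (abs_le.1 (hM q hq)).2
    linarith [hq.2.1]
  · rw [closure_rect hb] at hp
    refine eventually_neg_lt_of_continuousWithinAt (continuous_snd.continuousWithinAt.sub
      (hu.continuousWithinAt_rect hp hpc)) ?_
    obtain ⟨x, y⟩ := p
    have hy := rpow_le_self' hα hh hp.2
    rcases mem_sides hp hpn with rfl | rfl | rfl | rfl
    · have : y < 1 := lt_of_le_of_ne hp.2.2 fun h' => hpc (Prod.ext rfl h')
      simpa [hu.left' hb hα ⟨hp.2.1, this⟩] using hy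
    · simp [hu.right' hb hp.2]
    · simp [hu.bottom' hb hp.1]
    · have : 0 < x := lt_of_le_of_ne hp.1.1 fun h' => hpc (Prod.ext h'.symm rfl)
      simp [hu.top' hb ⟨this, hp.1.2⟩]

/-- The bounds `h y ^ α ≤ u ≤ y` up to the boundary. -/
theorem mem_Icc (hu : IsHarmonicPart b h α u) (hb : 0 < b) (hα : 1 < α)
    (hh : h ∈ Ioc (0 : ℝ) 1) {x y : ℝ} (hx : x ∈ Icc 0 b) (hy : y ∈ Icc (0 : ℝ) 1)
    (hn : x ≠ 0 ∨ y ≠ 1) : u (x, y) ∈ Icc (h * y ^ α) y := by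
  have hp : (x, y) ∈ closure (rect 0 b) := by rw [closure_rect hb]; exact ⟨hx, hy⟩
  have hne : (x, y) ≠ ((0 : ℝ), (1 : ℝ)) := fun h' => by
    simp only [Prod.mk.injEq] at h'; tauto
  have hc := hu.continuousWithinAt_rect (p := (x, y)) ⟨hx, hy⟩ hne
  have : (𝓝[rect 0 b] (x, y)).NeBot := mem_closure_iff_nhdsWithin_neBot.1 hp
  constructor
  · refine le_of_tendsto_of_tendsto
      ((continuous_rpow_snd hα h).continuousWithinAt (s := rect 0 b) (x := (x, y))) hc ?_
    filter_upwards [self_mem_nhdsWithin] with q hq using hu.rpow_le_of_mem_rect hb hα hh hq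
  · refine le_of_tendsto_of_tendsto hc
      (continuous_snd.continuousWithinAt (s := rect 0 b) (x := (x, y))) ?_
    filter_upwards [self_mem_nhdsWithin] with q hq using hu.le_snd_of_mem_rect hb hα hh hq

theorem translate_nonneg (hu : IsHarmonicPart b h α u) {U : Set (ℝ × ℝ)} (hU : IsOpen U)
    {v : ℝ × ℝ} (hUr : U ⊆ rect 0 b) (hUv : ∀ q ∈ U, q + v ∈ rect 0 b)
    (hbd : ∀ p ∈ closure U, p ∉ U → ∀ δ > 0, ∀ᶠ q in 𝓝[U] p, -δ < u (q + v) - u q) :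
    ∀ q ∈ U, u q ≤ u (q + v) := by
  have h1 : ContDiffOn ℝ 2 (fun q => u (q + v)) U :=
    hu.contDiffOn.comp (by fun_prop) hUv
  intro q hq
  rw [← sub_nonneg]
  refine nonneg_of_lap_nonpos hU ((isBounded_rect 0 b).subset hUr)
    (h1.sub (hu.contDiffOn.mono hUr)) (fun q hq => ?_) hbd q hq
  rw [lap_sub hU h1 (hu.contDiffOn.mono hUr) hq, lap_comp_add, hu.harmonic _ (hUv q hq),
    hu.harmonic _ (hUr hq), sub_zero]

theorem continuousWithinAt_translate (hu : IsHarmonicPart b h α u) {U : Set (ℝ × ℝ)}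
    {v p : ℝ × ℝ} (hUv : ∀ q ∈ U, q + v ∈ rect 0 b) (hp : p + v ∈ Icc 0 b ×ˢ Icc (0 : ℝ) 1)
    (hn : p + v ≠ (0, 1)) : ContinuousWithinAt (fun q => u (q + v)) U p :=
  (hu.continuousWithinAt_rect hp hn).comp (f := fun q : ℝ × ℝ => q + v)
    (by fun_prop) hUv

/-- Compare `u` with its translate on `rect 0 (b - s)`. On the left `u` is at its lower bound `h y ^
α`; on the right the translate is at its upper bound `y`; on the bottom both vanish; on the top the
translate is `1`. -/
theorem monotone_fst (hu : IsHarmonicPart b h α u) (hb : 0 < b) (hα : 1 < α)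
    (hh : h ∈ Ioc (0 : ℝ) 1) {s : ℝ} (hs : 0 < s) {x y : ℝ} (hx : 0 < x) (hxs : x + s < b)
    (hy : y ∈ Ioo (0 : ℝ) 1) : u (x, y) ≤ u (x + s, y) := by
  have hUv : ∀ q ∈ rect 0 (b - s), q + (s, 0) ∈ rect 0 b := fun q hq =>
    ⟨⟨by simpa using add_pos hq.1.1 hs, by simpa using lt_sub_iff_add_lt.1 hq.1.2⟩,
      by simpa using hq.2⟩
  have hUr : rect 0 (b - s) ⊆ rect 0 b := prod_mono (Ioo_subset_Ioo_right (by linarith)) le_rfl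
  have := hu.translate_nonneg (isOpen_rect 0 (b - s)) (v := (s, 0)) hUr hUv
    (fun p hp hpn => ?_) (x, y) ⟨⟨hx, by linarith⟩, hy⟩
  · simpa using this
  rw [closure_rect (by linarith)] at hp
  obtain ⟨p₁, p₂⟩ := p
  have hp1 : p₁ ∈ Icc 0 b := ⟨hp.1.1, by linarith [hp.1.2]⟩
  have hp1s : p₁ + s ∈ Icc 0 b := ⟨by linarith [hp.1.1], by linarith [hp.1.2]⟩
  have hp1s0 : p₁ + s ≠ 0 := by linarith [hp.1.1]
  have hct := hu.continuousWithinAt_translate (v := (s, 0)) (p := (p₁, p₂)) hUv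
    ⟨hp1s, by simpa using hp.2⟩ (fun h' => hp1s0 (by simpa using congrArg Prod.fst h'))
  have hv := hu.mem_Icc hb hα hh hp1s hp.2 (Or.inl hp1s0)
  by_cases hpc : p₁ = 0 ∧ p₂ = 1
  -- At the corner `u` has no limit in general, but `u ≤ y < 1` nearby while the translate tends to
  -- `1`.
  · obtain ⟨rfl, rfl⟩ := hpc
    intro δ hδ
    have h1 : u ((0, 1) + (s, 0)) = 1 := by
      simpa using hu.top' hb ⟨hs, by linarith⟩
    have h2 := hct (lt_mem_nhds (show u ((0, 1) + (s, 0)) - δ < _ by linarith))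
    rw [mem_map, h1] at h2
    filter_upwards [h2, self_mem_nhdsWithin] with q h3 h4
    have h5 := hu.le_snd_of_mem_rect hb hα hh (hUr h4)
    have h6 : 1 - δ < u (q + (s, 0)) := h3
    linarith [h4.2.2]
  have hpc' : p₁ ≠ 0 ∨ p₂ ≠ 1 := by tauto
  have hw := hu.mem_Icc hb hα hh hp1 hp.2 hpc'
  have hne : (p₁, p₂) ≠ ((0 : ℝ), (1 : ℝ)) := fun h' => hpc (by simpa using h')
  refine eventually_neg_lt_of_continuousWithinAt
    (hct.sub ((hu.continuousWithinAt_rect (p := (p₁, p₂)) ⟨hp1, hp.2⟩ hne).mono hUr)) ?_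
  simp only [Prod.mk_add_mk, add_zero, sub_nonneg]
  rcases mem_sides hp hpn with h0 | h0 | h0 | h0 <;> simp only at h0
  · subst h0
    have : p₂ < 1 := lt_of_le_of_ne hp.2.2 (by simpa using hpc')
    rw [hu.left' hb hα ⟨hp.2.1, this⟩]
    exact hv.1
  · have : p₁ + s = b := by linarith
    rw [this, hu.right' hb hp.2]
    exact hw.2
  · subst h0
    rw [hu.bottom' hb hp1, hu.bottom' hb hp1s]
  · subst h0
    rw [hu.top' hb ⟨lt_of_le_of_ne hp1s.1 hp1s0.symm, hp1s.2⟩]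
    exact hw.2

/-- The same comparison vertically; on the left and right sides it uses that the data `h y ^ α` and
`y` increase. -/
theorem monotone_snd (hu : IsHarmonicPart b h α u) (hb : 0 < b) (hα : 1 < α)
    (hh : h ∈ Ioc (0 : ℝ) 1) {s : ℝ} (hs : 0 < s) {x y : ℝ} (hx : x ∈ Ioo 0 b) (hy : 0 < y)
    (hys : y + s < 1) : u (x, y) ≤ u (x, y + s) := by
  set U : Set (ℝ × ℝ) := Ioo 0 b ×ˢ Ioo 0 (1 - s)
  have hUv : ∀ q ∈ U, q + (0, s) ∈ rect 0 b := fun q hq =>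
    ⟨by simpa using hq.1,
      ⟨by simpa using add_pos hq.2.1 hs, by simpa using lt_sub_iff_add_lt.1 hq.2.2⟩⟩
  have hUr : U ⊆ rect 0 b := prod_mono le_rfl (Ioo_subset_Ioo_right (by linarith))
  have := hu.translate_nonneg (isOpen_Ioo.prod isOpen_Ioo) (v := (0, s)) hUr hUv
    (fun p hp hpn => ?_) (x, y) ⟨hx, ⟨hy, by linarith⟩⟩
  · simpa using this
  have hs1 : 0 < 1 - s := by linarith
  rw [closure_prod_eq, closure_Ioo hb.ne, closure_Ioo hs1.ne] at hp
  obtain ⟨p₁, p₂⟩ := p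
  have hp2 : p₂ ∈ Icc (0 : ℝ) 1 := ⟨hp.2.1, by linarith [hp.2.2]⟩
  have hp2s : p₂ + s ∈ Icc (0 : ℝ) 1 := ⟨by linarith [hp.2.1], by linarith [hp.2.2]⟩
  have hp21 : p₂ ≠ 1 := by linarith [hp.2.2]
  have hcu : ContinuousWithinAt u U (p₁, p₂) := (hu.continuousWithinAt_rect (p := (p₁, p₂))
    ⟨hp.1, hp2⟩ (fun h' => hp21 (by simpa using congrArg Prod.snd h'))).mono hUr
  have hw := hu.mem_Icc hb hα hh hp.1 hp2 (Or.inr hp21)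
  have hpow : p₂ ^ α ≤ (p₂ + s) ^ α :=
    Real.rpow_le_rpow hp2.1 (by linarith) (by linarith)
  by_cases hpc : p₁ = 0 ∧ p₂ + s = 1
  -- Now the translate is the one that meets the corner; its lower bound `h (y + s) ^ α`, which is
  -- continuous there, replaces it.
  · obtain ⟨rfl, hps⟩ := hpc
    have h1 : u (0, p₂) = h * p₂ ^ α := hu.left' hb hα ⟨hp2.1, lt_of_le_of_ne hp2.2 hp21⟩
    have hcr : Continuous fun q : ℝ × ℝ => h * (q.2 + s) ^ α :=
      continuous_const.mul ((continuous_snd.add continuous_const).rpow_const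
        fun _ => Or.inr (by linarith))
    intro δ hδ
    have h2 := eventually_neg_lt_of_continuousWithinAt (U := U)
      (w := fun q => h * (q.2 + s) ^ α - u q) (hcr.continuousWithinAt.sub hcu) (by
        simp only [h1, sub_nonneg]
        exact mul_le_mul_of_nonneg_left hpow hh.1.le) δ hδ
    filter_upwards [h2, self_mem_nhdsWithin] with q h3 h4
    have h5 := hu.rpow_le_of_mem_rect hb hα hh (hUv q h4)
    simp only [Prod.snd_add] at h5
    linarith
  have hpc' : p₁ ≠ 0 ∨ p₂ + s ≠ 1 := by tauto
  have hv := hu.mem_Icc hb hα hh hp.1 hp2s hpc'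
  have hct := hu.continuousWithinAt_translate (v := (0, s)) (p := (p₁, p₂)) hUv
    ⟨by simpa using hp.1, hp2s⟩ (fun h' => hpc (by simpa using h'))
  refine eventually_neg_lt_of_continuousWithinAt (hct.sub hcu) ?_
  simp only [Prod.mk_add_mk, add_zero, sub_nonneg]
  rcases mem_sides hp hpn with h0 | h0 | h0 | h0 <;> simp only at h0
  · subst h0
    rw [hu.left' hb hα ⟨hp2.1, lt_of_le_of_ne hp2.2 hp21⟩]
    exact (mul_le_mul_of_nonneg_left hpow hh.1.le).trans hv.1
  · subst h0
    rw [hu.right' hb hp2, hu.right' hb hp2s]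
    linarith
  · subst h0
    rw [hu.bottom' hb hp.1]
    exact (mul_nonneg hh.1.le (Real.rpow_nonneg hp2s.1 _)).trans hv.1
  · have e : p₂ + s = 1 := by linarith
    rw [e] at hpc' ⊢
    have : 0 < p₁ := lt_of_le_of_ne hp.1.1 (by tauto)
    rw [hu.top' hb ⟨this, hp.1.2⟩]
    exact hw.2.trans hp2.2

end IsHarmonicPart

/-! ### Integrability, trace and weak harmonicity of the harmonic part -/

theorem lintegral_deriv_le {f f' : ℝ → ℝ} {c d C : ℝ} (hcd : c ≤ d) (hf : ContinuousOn f (Icc c d))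
    (hf' : ∀ t ∈ Ioo c d, HasDerivAt f (f' t) t) (h0 : ∀ t ∈ Ioo c d, 0 ≤ f' t)
    (hC : f d - f c ≤ C) : ∫⁻ t in Ioo c d, ‖f' t‖ₑ ≤ ENNReal.ofReal C := by
  have hi := intervalIntegral.integrableOn_deriv_of_nonneg hf hf' h0
  have hi' : IntervalIntegrable f' volume c d := (intervalIntegrable_iff_integrableOn_Ioc_of_le hcd).2 hi
  have hI := intervalIntegral.integral_eq_sub_of_hasDerivAt_of_le hcd hf hf' hi'
  rw [intervalIntegral.integral_of_le hcd, integral_Ioc_eq_integral_Ioo] at hI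
  have h0' : ∀ᵐ t ∂volume.restrict (Ioo c d), 0 ≤ f' t :=
    (ae_restrict_mem measurableSet_Ioo).mono h0
  have : ∫⁻ t in Ioo c d, ‖f' t‖ₑ = ∫⁻ t in Ioo c d, ENNReal.ofReal (f' t) :=
    lintegral_congr_ae (h0'.mono fun t ht => Real.enorm_of_nonneg ht)
  rw [this, ← ofReal_integral_eq_lintegral_ofReal (hi.mono_set Ioo_subset_Ioc_self) h0', hI]
  exact ENNReal.ofReal_le_ofReal hC

/-- The intersection of a rectangle with a strip around the `y`-axis. -/
def strip (c d ε : ℝ) : Set (ℝ × ℝ) := rect c d ∩ {q | |q.1| < ε}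

theorem strip_eq_thickening (c d ε : ℝ) : strip c d ε = rect c d ∩ Metric.thickening ε (vseg 0) := by
  ext q
  refine and_congr_right fun hq => ?_
  rw [Metric.mem_thickening_iff, mem_ofPred_eq]
  constructor
  · intro h
    refine ⟨(0, q.2), ⟨rfl, hq.2⟩, ?_⟩
    rw [Prod.dist_eq, dist_self, Real.dist_eq, sub_zero, max_eq_left (abs_nonneg _)]
    exact h
  · rintro ⟨z, hz, hd⟩
    have h1 : z.1 = 0 := hz.1
    rw [Prod.dist_eq, max_lt_iff, Real.dist_eq, h1, sub_zero] at hd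
    exact hd.1

namespace IsHarmonicPart

variable {b h α : ℝ} {u : ℝ × ℝ → ℝ}

theorem differentiableAt (hu : IsHarmonicPart b h α u) {q : ℝ × ℝ} (hq : q ∈ rect 0 b) :
    DifferentiableAt ℝ u q :=
  differentiableAt_of_contDiffOn (isOpen_rect 0 b) hu.contDiffOn two_ne_zero hq

theorem deriv_nonneg_of_forall_le {f : ℝ → ℝ} {f' t : ℝ} (hf : HasDerivAt f f' t)
    (hm : ∀ᶠ s in 𝓝[>] 0, f t ≤ f (t + s)) : 0 ≤ f' := by
  have h1 := hf.tendsto_slope_zero_right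
  refine ge_of_tendsto h1 ?_
  filter_upwards [hm, self_mem_nhdsWithin] with s hs hs0
  exact smul_nonneg (inv_nonneg.2 (le_of_lt hs0)) (sub_nonneg.2 hs)

theorem pd_fst_nonneg (hu : IsHarmonicPart b h α u) (hb : 0 < b) (hα : 1 < α)
    (hh : h ∈ Ioc (0 : ℝ) 1) {q : ℝ × ℝ} (hq : q ∈ rect 0 b) : 0 ≤ pd (1, 0) u q := by
  obtain ⟨x, y⟩ := q
  refine deriv_nonneg_of_forall_le (hasDerivAt_slice_fst (hu.differentiableAt hq)) ?_
  filter_upwards [Ioo_mem_nhdsGT (sub_pos.2 hq.1.2)] with s hs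
  exact hu.monotone_fst hb hα hh hs.1 hq.1.1 (by linarith [hs.2]) hq.2

theorem pd_snd_nonneg (hu : IsHarmonicPart b h α u) (hb : 0 < b) (hα : 1 < α)
    (hh : h ∈ Ioc (0 : ℝ) 1) {q : ℝ × ℝ} (hq : q ∈ rect 0 b) : 0 ≤ pd (0, 1) u q := by
  obtain ⟨x, y⟩ := q
  refine deriv_nonneg_of_forall_le (hasDerivAt_slice_snd (hu.differentiableAt hq)) ?_
  filter_upwards [Ioo_mem_nhdsGT (sub_pos.2 hq.2.2)] with s hs
  exact hu.monotone_snd hb hα hh hs.1 hq.1 hq.2.1 (by linarith [hs.2])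

theorem continuousOn_slice_fst (hu : IsHarmonicPart b h α u) {y : ℝ} (hy : y ∈ Ioo (0 : ℝ) 1) :
    ContinuousOn (fun x => u (x, y)) (Icc 0 b) :=
  hu.continuousOn'.comp (by fun_prop) fun _ hx =>
    ⟨⟨hx, Ioo_subset_Icc_self hy⟩, fun h' => hy.2.ne (congrArg Prod.snd h')⟩

theorem continuousOn_slice_snd (hu : IsHarmonicPart b h α u) {x : ℝ} (hx : x ∈ Ioo 0 b) :
    ContinuousOn (fun y => u (x, y)) (Icc 0 1) :=
  hu.continuousOn'.comp (by fun_prop) fun _ hy =>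
    ⟨⟨Ioo_subset_Icc_self hx, hy⟩, fun h' => hx.1.ne' (congrArg Prod.fst h')⟩

theorem contDiffOn_pd' (hu : IsHarmonicPart b h α u) (e : ℝ × ℝ) :
    ContDiffOn ℝ 1 (pd e u) (rect 0 b) :=
  contDiffOn_pd (isOpen_rect 0 b) hu.contDiffOn (by norm_num) e

theorem aestronglyMeasurable_pd (hu : IsHarmonicPart b h α u) (e : ℝ × ℝ) :
    AEStronglyMeasurable (pd e u) (volume.restrict (rect 0 b)) :=
  (hu.contDiffOn_pd' e).continuousOn.aestronglyMeasurable (measurableSet_rect 0 b)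

/-- By Tonelli it suffices to bound slices, where the integral of the nonnegative derivative is the
increment `y - h y ^ α ≤ 1`. No gradient estimate near the boundary is needed. -/
theorem integrableOn_pd_fst (hu : IsHarmonicPart b h α u) (hb : 0 < b) (hα : 1 < α)
    (hh : h ∈ Ioc (0 : ℝ) 1) : IntegrableOn (pd (1, 0) u) (rect 0 b) := by
  refine ⟨hu.aestronglyMeasurable_pd _, ?_⟩
  have hm := (hu.aestronglyMeasurable_pd (1, 0)).enorm
  rw [HasFiniteIntegral]
  rw [volume_restrict_rect] at hm ⊢
  rw [lintegral_prod_symm _ hm]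
  refine lt_of_le_of_lt (b := ∫⁻ _ in Ioo (0 : ℝ) 1, ENNReal.ofReal 1)
    (setLIntegral_mono measurable_const fun y hy => ?_) (by simp)
  refine lintegral_deriv_le hb.le (hu.continuousOn_slice_fst hy)
    (fun x hx => hasDerivAt_slice_fst (hu.differentiableAt ⟨hx, hy⟩))
    (fun x hx => hu.pd_fst_nonneg hb hα hh ⟨hx, hy⟩) ?_
  simp only [hu.left y hy, hu.right y hy]
  linarith [mul_nonneg hh.1.le (Real.rpow_nonneg hy.1.le α), hy.2]

theorem integrableOn_pd_snd (hu : IsHarmonicPart b h α u) (hb : 0 < b) (hα : 1 < α)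
    (hh : h ∈ Ioc (0 : ℝ) 1) : IntegrableOn (pd (0, 1) u) (rect 0 b) := by
  refine ⟨hu.aestronglyMeasurable_pd _, ?_⟩
  have hm := (hu.aestronglyMeasurable_pd (0, 1)).enorm
  rw [HasFiniteIntegral]
  rw [volume_restrict_rect] at hm ⊢
  rw [lintegral_prod _ hm]
  refine lt_of_le_of_lt (b := ∫⁻ _ in Ioo (0 : ℝ) b, ENNReal.ofReal 1)
    (setLIntegral_mono measurable_const fun x hx => ?_) (by simp)
  refine lintegral_deriv_le zero_le_one (hu.continuousOn_slice_snd hx)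
    (fun y hy => hasDerivAt_slice_snd (hu.differentiableAt ⟨hx, hy⟩))
    (fun y hy => hu.pd_snd_nonneg hb hα hh ⟨hx, hy⟩) ?_
  simp [hu.bottom x hx, hu.top x hx]

theorem isWeakPartial (hu : IsHarmonicPart b h α u) {e : ℝ × ℝ}
    (hi : IntegrableOn (pd e u) (rect 0 b)) : IsWeakPartial (rect 0 b) e u (pd e u) :=
  ⟨hi, fun _ hφ => integral_mul_pd (isOpen_rect 0 b) (hu.contDiffOn.of_le (by norm_num))
    (hφ.smooth.of_le (by norm_num)) hφ.compactSupport hφ.support_subset e⟩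

theorem integrableOn (hu : IsHarmonicPart b h α u) : IntegrableOn u (rect 0 b) := by
  obtain ⟨M, hM⟩ := hu.bounded
  have : IsFiniteMeasure ((volume : Measure (ℝ × ℝ)).restrict (rect 0 b)) :=
    isFiniteMeasure_restrict.2 (volume_rect_lt_top 0 b).ne
  exact Integrable.of_bound
    (hu.contDiffOn.continuousOn.aestronglyMeasurable (measurableSet_rect 0 b)) M
    ((ae_restrict_mem (measurableSet_rect 0 b)).mono hM)

/-- The trace of `u` on the left side is `h y ^ α`. -/
theorem tendsto_strip (hu : IsHarmonicPart b h α u) (hb : 0 < b) (hα : 1 < α)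
    (hh : h ∈ Ioc (0 : ℝ) 1) :
    Tendsto (fun ε : ℝ => (∫⁻ p in strip 0 b ε, ‖u p - h * p.2 ^ α‖ₑ) / ENNReal.ofReal ε)
      (𝓝[>] 0) (𝓝 0) := by
  -- As `u` increases in `x`, the deviation on every slice `x < ε` is at most the one on `x = ε`, so
  -- `Φ ε` bounds the averaged layer integral. Dominated convergence sends it to zero even though
  -- the jump may prevent uniform convergence.
  set Φ : ℝ → ENNReal := fun ε => ∫⁻ y in Ioo (0 : ℝ) 1, ‖u (ε, y) - h * y ^ α‖ₑ with hΦ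
  have hcr : Continuous fun y : ℝ => h * y ^ α :=
    continuous_const.mul (continuous_id.rpow_const fun _ => Or.inr (by linarith))
  have hΦ0 : Tendsto Φ (𝓝[>] 0) (𝓝 0) := by
    have hev : ∀ᶠ ε in 𝓝[>] (0 : ℝ), ε ∈ Ioo 0 b := Ioo_mem_nhdsGT hb
    have h0 : (0 : ENNReal) = ∫⁻ y in Ioo (0 : ℝ) 1, 0 := by simp
    rw [h0]
    refine tendsto_lintegral_filter_of_dominated_convergence' (fun _ => 1) ?_ ?_ (by simp) ?_
    · filter_upwards [hev] with ε hε
      exact (((hu.continuousOn_slice_snd hε).mono Ioo_subset_Icc_self).sub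
        hcr.continuousOn).aestronglyMeasurable measurableSet_Ioo |>.enorm
    · filter_upwards [hev] with ε hε
      filter_upwards [ae_restrict_mem measurableSet_Ioo] with y hy
      have h1 := hu.rpow_le_of_mem_rect hb hα hh (q := (ε, y)) ⟨hε, hy⟩
      have h2 := hu.le_snd_of_mem_rect hb hα hh (q := (ε, y)) ⟨hε, hy⟩
      simp only at h1 h2
      rw [Real.enorm_of_nonneg (by linarith), ENNReal.ofReal_le_one]
      linarith [hy.2, mul_nonneg hh.1.le (Real.rpow_nonneg hy.1.le α)]
    · filter_upwards [ae_restrict_mem measurableSet_Ioo] with y hy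
      have h1 : Tendsto (fun ε => u (ε, y)) (𝓝[>] 0) (𝓝 (u (0, y))) :=
        ((hu.continuousOn_slice_fst hy) 0 ⟨le_rfl, hb.le⟩).mono_left
          (nhdsWithin_le_of_mem (mem_of_superset (Ioo_mem_nhdsGT hb) Ioo_subset_Icc_self))
      have h2 := (h1.sub_const (h * y ^ α)).enorm
      rwa [hu.left y hy, sub_self, enorm_zero] at h2
  refine tendsto_of_tendsto_of_tendsto_of_le_of_le' tendsto_const_nhds hΦ0
    (Eventually.of_forall fun _ => zero_le) ?_
  filter_upwards [Ioo_mem_nhdsGT hb] with ε hε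
  have hε0 : 0 < ε := hε.1
  refine ENNReal.div_le_of_le_mul ?_
  have hstrip : strip 0 b ε = rect 0 ε := by
    ext q
    simp only [strip, rect, mem_inter_iff, mem_prod, mem_Ioo, mem_ofPred_eq, abs_lt]
    constructor
    · rintro ⟨⟨h1, h2⟩, h3⟩
      exact ⟨⟨h1.1, h3.2⟩, h2⟩
    · rintro ⟨h1, h2⟩
      exact ⟨⟨⟨h1.1, h1.2.trans hε.2⟩, h2⟩, by linarith, h1.2⟩
  have hm : AEMeasurable (fun p : ℝ × ℝ => ‖u p - h * p.2 ^ α‖ₑ)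
      (volume.restrict (rect 0 ε)) := by
    refine ((ContinuousOn.sub (hu.contDiffOn.continuousOn.mono ?_)
      (continuous_rpow_snd hα h).continuousOn).aestronglyMeasurable
        (measurableSet_rect 0 ε)).enorm
    exact prod_mono (Ioo_subset_Ioo_right hε.2.le) le_rfl
  rw [hstrip]
  rw [volume_restrict_rect] at hm ⊢
  rw [lintegral_prod _ hm]
  calc _ ≤ ∫⁻ _ in Ioo (0 : ℝ) ε, Φ ε := by
        refine setLIntegral_mono measurable_const fun x hx =>
          setLIntegral_mono' measurableSet_Ioo fun y hy => ?_
        have h1 := hu.rpow_le_of_mem_rect hb hα hh (q := (x, y)) ⟨⟨hx.1, hx.2.trans hε.2⟩, hy⟩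
        have h2 := hu.monotone_fst hb hα hh (s := ε - x) (sub_pos.2 hx.2) hx.1
          (by rw [add_sub_cancel]; exact hε.2) hy
        rw [add_sub_cancel] at h2
        simp only at h1 h2 ⊢
        rw [Real.enorm_of_nonneg (by linarith), Real.enorm_of_nonneg (by linarith)]
        exact ENNReal.ofReal_le_ofReal (by linarith)
    _ = Φ ε * ENNReal.ofReal ε := by simp

/-- `u` is harmonic in the sense of distributions. -/
theorem integral_mul_lap (hu : IsHarmonicPart b h α u) {ψ : ℝ × ℝ → ℝ}
    (hψ : IsTestFunction (rect 0 b) ψ) : ∫ q in rect 0 b, u q * lap ψ q = 0 := by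
  have hU := isOpen_rect 0 b
  have hd : ∀ e, ContDiff ℝ 1 (pd e ψ) := fun e =>
    (hψ.smooth.fderiv_right (m := 1) (by norm_cast)).clm_apply contDiff_const
  have hdd : ∀ e, ContDiff ℝ 0 (pd e (pd e ψ)) := fun e =>
    ((hd e).fderiv_right (by norm_num)).clm_apply contDiff_const
  have hs : ∀ e, tsupport (pd e ψ) ⊆ rect 0 b := fun e =>
    (tsupport_fderiv_apply_subset ℝ e).trans hψ.support_subset
  have hss : ∀ e, tsupport (pd e (pd e ψ)) ⊆ rect 0 b := fun e =>
    (tsupport_fderiv_apply_subset ℝ e).trans (hs e)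
  have hc : ∀ e, HasCompactSupport (pd e ψ) := fun e => hψ.compactSupport.fderiv_apply ℝ e
  have hcc : ∀ e, HasCompactSupport (pd e (pd e ψ)) := fun e => (hc e).fderiv_apply ℝ e
  have hψ1 : ContDiff ℝ 1 ψ := hψ.smooth.of_le (by norm_cast)
  have hpp : ∀ e, ContDiffOn ℝ 0 (pd e (pd e u)) (rect 0 b) := fun e =>
    contDiffOn_pd hU (hu.contDiffOn_pd' e) (by norm_num) e
  have key : ∀ e, ∫ q in rect 0 b, u q * pd e (pd e ψ) q
      = ∫ q in rect 0 b, pd e (pd e u) q * ψ q := fun e => by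
    rw [integral_mul_pd hU (hu.contDiffOn.of_le (by norm_num)) (hd e) (hc e) (hs e),
      integral_mul_pd hU (hu.contDiffOn_pd' e) hψ1 hψ.compactSupport hψ.support_subset, neg_neg]
  have i1 : ∀ e, IntegrableOn (fun q => u q * pd e (pd e ψ) q) (rect 0 b) := fun e =>
    ((contDiff_mul_of_tsupport_subset hU (hu.contDiffOn.of_le (by norm_num)) (hdd e)
      (hss e)).continuous.integrable_of_hasCompactSupport (hcc e).mul_left).integrableOn
  have i2 : ∀ e, IntegrableOn (fun q => pd e (pd e u) q * ψ q) (rect 0 b) := fun e =>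
    ((contDiff_mul_of_tsupport_subset hU (hpp e) (hψ1.of_le zero_le_one)
      hψ.support_subset).continuous.integrable_of_hasCompactSupport
      hψ.compactSupport.mul_left).integrableOn
  have e1 : ∀ q, u q * lap ψ q = u q * pd (1, 0) (pd (1, 0) ψ) q
      + u q * pd (0, 1) (pd (0, 1) ψ) q := fun q => by
    rw [lap_eq isOpen_univ (hψ.smooth.of_le (by norm_cast)).contDiffOn (mem_univ q), mul_add]
  simp only [e1]
  rw [integral_add (i1 _) (i1 _), key, key, ← integral_add (i2 _) (i2 _)]
  refine setIntegral_eq_zero_of_forall_eq_zero fun q hq => ?_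
  rw [← add_mul, ← lap_eq hU hu.contDiffOn hq, hu.harmonic q hq, zero_mul]

end IsHarmonicPart

/-! ### Splitting a rectangle along the `y`-axis -/

theorem ae_fst_ne_zero : ∀ᵐ q : ℝ × ℝ, q.1 ≠ 0 := by
  have h0 : (volume : Measure (ℝ × ℝ)) ({(0 : ℝ)} ×ˢ univ) = 0 := by
    rw [Measure.volume_eq_prod, Measure.prod_prod, Real.volume_singleton, zero_mul]
  filter_upwards [compl_mem_ae_iff.2 h0] with q hq h
  exact hq ⟨h, mem_univ _⟩

theorem rect_left_subset {a b : ℝ} (hb : 0 < b) : rect (-a) 0 ⊆ rect (-a) b :=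
  prod_mono (Ioo_subset_Ioo_right hb.le) le_rfl

theorem rect_right_subset {a b : ℝ} (ha : 0 < a) : rect 0 b ⊆ rect (-a) b :=
  prod_mono (Ioo_subset_Ioo_left (by linarith)) le_rfl

theorem mem_halves_of_ne {a b : ℝ} {q : ℝ × ℝ} (hq : q ∈ rect (-a) b) (h0 : q.1 ≠ 0) :
    q ∈ rect (-a) 0 ∨ q ∈ rect 0 b := by
  rcases lt_or_gt_of_ne h0 with h | h
  · exact Or.inl ⟨⟨hq.1.1, h⟩, hq.2⟩
  · exact Or.inr ⟨⟨h, hq.1.2⟩, hq.2⟩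

theorem rect_ae_eq {a b : ℝ} (ha : 0 < a) (hb : 0 < b) :
    (rect (-a) b : Set (ℝ × ℝ)) =ᵐ[volume] (rect (-a) 0 ∪ rect 0 b : Set (ℝ × ℝ)) := by
  filter_upwards [ae_fst_ne_zero] with q hq
  exact propext ⟨fun h => mem_halves_of_ne h hq,
    fun h => h.elim (fun h => rect_left_subset hb h) fun h => rect_right_subset ha h⟩

theorem disjoint_halves (a b : ℝ) : Disjoint (rect (-a) 0) (rect 0 b) :=
  disjoint_left.2 fun _ h1 h2 => lt_asymm h1.1.2 h2.1.1

theorem integrableOn_of_halves {a b : ℝ} (ha : 0 < a) (hb : 0 < b) {F : ℝ × ℝ → ℝ}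
    (h1 : IntegrableOn F (rect (-a) 0)) (h2 : IntegrableOn F (rect 0 b)) :
    IntegrableOn F (rect (-a) b) :=
  (h1.union h2).congr_set_ae (rect_ae_eq ha hb)

theorem setIntegral_eq_halves {a b : ℝ} (ha : 0 < a) (hb : 0 < b) {F : ℝ × ℝ → ℝ}
    (h : IntegrableOn F (rect (-a) b)) :
    ∫ q in rect (-a) b, F q = (∫ q in rect (-a) 0, F q) + ∫ q in rect 0 b, F q := by
  rw [setIntegral_congr_set (rect_ae_eq ha hb)]
  exact setIntegral_union (disjoint_halves a b) (measurableSet_rect 0 b)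
    (h.mono_set (rect_left_subset hb)) (h.mono_set (rect_right_subset ha))

theorem glue_of_mem_left {a : ℝ} {uL uR : ℝ × ℝ → ℝ} {q : ℝ × ℝ} (hq : q ∈ rect (-a) 0) :
    glue uL uR q = uL q := if_pos hq.1.2

theorem glue_of_mem_right {b : ℝ} {uL uR : ℝ × ℝ → ℝ} {q : ℝ × ℝ} (hq : q ∈ rect 0 b) :
    glue uL uR q = uR q := if_neg (not_lt.2 hq.1.1.le)

theorem integrableOn_glue {a b : ℝ} (ha : 0 < a) (hb : 0 < b) {vL vR : ℝ × ℝ → ℝ}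
    (h1 : IntegrableOn vL (rect (-a) 0)) (h2 : IntegrableOn vR (rect 0 b)) :
    IntegrableOn (glue vL vR) (rect (-a) b) :=
  integrableOn_of_halves ha hb
    (h1.congr_fun (fun _ hq => (glue_of_mem_left hq).symm) (measurableSet_rect _ _))
    (h2.congr_fun (fun _ hq => (glue_of_mem_right hq).symm) (measurableSet_rect _ _))

/-! ### Cutoff functions -/

/-- A smooth step, equal to `0` for `x ≤ ε` and to `1` for `x ≥ 2 ε`. -/
def step (ε x : ℝ) : ℝ := Real.smoothTransition (x / ε - 1)

/-- A smooth cutoff function, equal to `0` for `|x| ≤ ε` and to `1` for `|x| ≥ 2 ε`. -/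
def cutoff (ε x : ℝ) : ℝ := step ε x + step ε (-x)

theorem contDiff_step (ε : ℝ) {n : ℕ∞} : ContDiff ℝ n (step ε) :=
  Real.smoothTransition.contDiff.comp (by fun_prop)

theorem contDiff_step_neg (ε : ℝ) {n : ℕ∞} : ContDiff ℝ n fun x => step ε (-x) :=
  (contDiff_step ε).comp contDiff_neg

theorem contDiff_cutoff (ε : ℝ) {n : ℕ∞} : ContDiff ℝ n (cutoff ε) :=
  (contDiff_step ε).add (contDiff_step_neg ε)

theorem step_eq_zero {ε x : ℝ} (hε : 0 < ε) (hx : x ≤ ε) : step ε x = 0 :=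
  Real.smoothTransition.zero_of_nonpos (by rw [sub_nonpos, div_le_one hε]; exact hx)

theorem step_eq_one {ε x : ℝ} (hε : 0 < ε) (hx : 2 * ε ≤ x) : step ε x = 1 :=
  Real.smoothTransition.one_of_one_le (by
    have : 2 ≤ x / ε := by rwa [le_div_iff₀ hε]
    linarith)

theorem cutoff_nonneg (ε x : ℝ) : 0 ≤ cutoff ε x :=
  add_nonneg (Real.smoothTransition.nonneg _) (Real.smoothTransition.nonneg _)

theorem cutoff_le_one {ε : ℝ} (hε : 0 < ε) (x : ℝ) : cutoff ε x ≤ 1 := by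
  rcases le_total x 0 with h | h
  · rw [cutoff, step_eq_zero hε (h.trans hε.le), zero_add]
    exact Real.smoothTransition.le_one _
  · rw [cutoff, step_eq_zero hε (x := -x) (by linarith), add_zero]
    exact Real.smoothTransition.le_one _

theorem tendsto_cutoff {x : ℝ} (hx : x ≠ 0) :
    Tendsto (fun ε => cutoff ε x) (𝓝[>] 0) (𝓝 1) := by
  refine tendsto_const_nhds.congr' ?_
  filter_upwards [Ioo_mem_nhdsGT (show 0 < |x| / 2 by positivity)] with ε hε
  have h2 : 2 * ε ≤ |x| := by linarith [hε.2]
  rcases lt_or_gt_of_ne hx with h | h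
  · rw [abs_of_neg h] at h2
    rw [cutoff, step_eq_zero hε.1 (x := x) (by linarith [hε.1]), step_eq_one hε.1 h2, zero_add]
  · rw [abs_of_pos h] at h2
    rw [cutoff, step_eq_zero hε.1 (x := -x) (by linarith [hε.1]), step_eq_one hε.1 h2, add_zero]

theorem deriv_step_eq_zero {ε x : ℝ} (hε : 0 < ε) (hx : x < ε ∨ 2 * ε < x) :
    deriv (step ε) x = 0 := by
  rcases hx with hx | hx
  · have : step ε =ᶠ[𝓝 x] fun _ => 0 := by
      filter_upwards [Iio_mem_nhds hx] with t ht using step_eq_zero hε (le_of_lt ht)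
    rw [this.deriv_eq, deriv_const]
  · have : step ε =ᶠ[𝓝 x] fun _ => 1 := by
      filter_upwards [Ioi_mem_nhds hx] with t ht using step_eq_one hε (le_of_lt ht)
    rw [this.deriv_eq, deriv_const]

theorem deriv_step_nonneg {ε : ℝ} (hε : 0 < ε) (x : ℝ) : 0 ≤ deriv (step ε) x := by
  refine Monotone.deriv_nonneg fun s t hst => Real.smoothTransition.monotone ?_
  gcongr

/-- By scaling, `C` is a bound for the derivative of the fixed profile on `[0, 1]`. -/
theorem exists_deriv_step_le : ∃ C, 0 ≤ C ∧ ∀ ε > 0, ∀ x, deriv (step ε) x ≤ C / ε := by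
  have hc : Continuous (deriv Real.smoothTransition) :=
    (Real.smoothTransition.contDiff (n := 1)).continuous_deriv (by simp)
  obtain ⟨C, hC⟩ := (isCompact_Icc (a := (0 : ℝ)) (b := 1)).exists_bound_of_continuousOn
    hc.continuousOn
  have hC0 : 0 ≤ C := (norm_nonneg _).trans (hC 0 ⟨le_rfl, zero_le_one⟩)
  refine ⟨C, hC0, fun ε hε x => ?_⟩
  by_cases hx : x < ε ∨ 2 * ε < x
  · rw [deriv_step_eq_zero hε hx]
    positivity
  · push Not at hx
    have h1 : HasDerivAt (step ε) (deriv Real.smoothTransition (x / ε - 1) * (1 / ε)) x := by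
      have h2 : HasDerivAt (fun x : ℝ => x / ε - 1) (1 / ε) x :=
        ((hasDerivAt_id x).div_const ε).sub_const 1
      have h3 : DifferentiableAt ℝ Real.smoothTransition (x / ε - 1) :=
        (Real.smoothTransition.contDiff (n := 1)).differentiable (by simp) _
      exact h3.hasDerivAt.comp x h2
    rw [h1.deriv, mul_one_div]
    have h4 : x / ε - 1 ∈ Icc (0 : ℝ) 1 :=
      ⟨by rw [sub_nonneg, le_div_iff₀ hε]; linarith,
        by rw [sub_le_iff_le_add, div_le_iff₀ hε]; linarith⟩
    gcongr
    exact (le_abs_self _).trans (hC _ h4)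

theorem deriv_cutoff {ε : ℝ} (x : ℝ) :
    deriv (cutoff ε) x = deriv (step ε) x - deriv (step ε) (-x) := by
  have hd : Differentiable ℝ (step ε) := (contDiff_step ε (n := 1)).differentiable (by simp)
  have h1 : HasDerivAt (fun t => step ε (-t)) (deriv (step ε) (-x) * (-1)) x :=
    (hd (-x)).hasDerivAt.comp x (hasDerivAt_neg x)
  have h2 := ((hd x).hasDerivAt.add h1).deriv
  rw [mul_neg_one, ← sub_eq_add_neg] at h2
  exact h2

theorem deriv_cutoff_of_neg {ε x : ℝ} (hε : 0 < ε) (hx : x < 0) :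
    deriv (cutoff ε) x = - deriv (step ε) (-x) := by
  rw [deriv_cutoff, deriv_step_eq_zero hε (Or.inl (hx.trans hε)), zero_sub]

theorem deriv_cutoff_of_pos {ε x : ℝ} (hε : 0 < ε) (hx : 0 < x) :
    deriv (cutoff ε) x = deriv (step ε) x := by
  rw [deriv_cutoff, deriv_step_eq_zero hε (x := -x) (Or.inl (by linarith)), sub_zero]

/-- The margin from `2 ε` to `3 ε` gives the strict inequality under which the step is constant near
the point. -/
theorem deriv_cutoff_eq_zero {ε x : ℝ} (hε : 0 < ε) (hx : 3 * ε ≤ |x|) :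
    deriv (cutoff ε) x = 0 := by
  rw [deriv_cutoff]
  rcases abs_cases x with h | h
  · rw [deriv_step_eq_zero hε (x := x) (Or.inr (by linarith)),
      deriv_step_eq_zero hε (x := -x) (Or.inl (by linarith)), sub_zero]
  · rw [deriv_step_eq_zero hε (x := x) (Or.inl (by linarith)),
      deriv_step_eq_zero hε (x := -x) (Or.inr (by linarith)), sub_zero]

theorem abs_deriv_cutoff_le {C : ℝ} (hC : ∀ ε > 0, ∀ x, deriv (step ε) x ≤ C / ε) {ε : ℝ}
    (hε : 0 < ε) (x : ℝ) : |deriv (cutoff ε) x| ≤ C / ε := by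
  rw [deriv_cutoff, abs_le]
  have h1 := hC ε hε x
  have h2 := hC ε hε (-x)
  have h3 := deriv_step_nonneg hε x
  have h4 := deriv_step_nonneg hε (-x)
  constructor <;> linarith

/-! ### Products with functions of `x` -/

theorem pd_mul {f g : ℝ × ℝ → ℝ} {q : ℝ × ℝ} (hf : DifferentiableAt ℝ f q)
    (hg : DifferentiableAt ℝ g q) (e : ℝ × ℝ) :
    pd e (fun q => f q * g q) q = f q * pd e g q + pd e f q * g q := by
  simp only [pd, fderiv_fun_mul hf hg]
  simp [mul_comm]

theorem pd_comp_fst {c : ℝ → ℝ} {q : ℝ × ℝ} (hc : DifferentiableAt ℝ c q.1) (e : ℝ × ℝ) :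
    pd e (fun q => c q.1) q = deriv c q.1 * e.1 := by
  have h : HasFDerivAt (fun q : ℝ × ℝ => c q.1) _ q :=
    hc.hasDerivAt.hasFDerivAt.comp (f := Prod.fst) q hasFDerivAt_fst
  simp [pd, h.fderiv, mul_comm]

theorem pd_fst_mul {c : ℝ → ℝ} {f : ℝ × ℝ → ℝ} (hc : Differentiable ℝ c)
    (hf : Differentiable ℝ f) (e q : ℝ × ℝ) :
    pd e (fun q => c q.1 * f q) q = c q.1 * pd e f q + e.1 * (deriv c q.1 * f q) := by
  rw [pd_mul (f := fun q => c q.1) ((hc _).comp q differentiableAt_fst) (hf q), pd_comp_fst (hc _)]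
  ring

theorem pd_congr {f g : ℝ × ℝ → ℝ} {U : Set (ℝ × ℝ)} (hU : IsOpen U) (h : EqOn f g U)
    {q : ℝ × ℝ} (hq : q ∈ U) (e : ℝ × ℝ) : pd e f q = pd e g q := by
  have : f =ᶠ[𝓝 q] g := h.eventuallyEq_of_mem (hU.mem_nhds hq)
  simp only [pd, this.fderiv_eq]

/-- The closed set `S` contains the topological support of the product, which is how a cutoff moves
a test function from `D` to a smaller domain. -/
theorem IsTestFunction.of_mul {D D' : Set (ℝ × ℝ)} {φ : ℝ × ℝ → ℝ} (hφ : IsTestFunction D φ)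
    {c : ℝ → ℝ} (hc : ContDiff ℝ ∞ c) {S : Set (ℝ × ℝ)} (hS : IsClosed S)
    (h0 : ∀ q ∉ S, c q.1 = 0) (hD : ∀ q ∈ D, q ∈ S → q ∈ D') :
    IsTestFunction D' (fun q => c q.1 * φ q) where
  smooth := (hc.comp contDiff_fst).mul hφ.smooth
  compactSupport := hφ.compactSupport.mul_left
  support_subset := fun q hq => by
    refine hD q (hφ.support_subset (tsupport_mul_subset_right hq)) ?_
    refine closure_minimal (fun p hp => ?_) hS hq
    by_contra hpS
    exact hp (by simp [h0 p hpS])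

theorem IsTestFunction.step_neg_mul {a b : ℝ} {φ : ℝ × ℝ → ℝ}
    (hφ : IsTestFunction (rect (-a) b) φ) {ε : ℝ} (hε : 0 < ε) :
    IsTestFunction (rect (-a) 0) (fun q => step ε (-q.1) * φ q) :=
  hφ.of_mul (c := fun x => step ε (-x)) (contDiff_step_neg ε)
    (isClosed_le continuous_fst (continuous_const (y := -ε)))
    (fun q hq => step_eq_zero hε (by have : ¬ q.1 ≤ -ε := hq; linarith))
    fun q hq hS => ⟨⟨hq.1.1, by have : q.1 ≤ -ε := hS; linarith⟩, hq.2⟩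

theorem IsTestFunction.step_mul {a b : ℝ} {φ : ℝ × ℝ → ℝ}
    (hφ : IsTestFunction (rect (-a) b) φ) {ε : ℝ} (hε : 0 < ε) :
    IsTestFunction (rect 0 b) (fun q => step ε q.1 * φ q) :=
  hφ.of_mul (contDiff_step ε) (isClosed_le (continuous_const (y := ε)) continuous_fst)
    (fun q hq => step_eq_zero hε (not_le.1 hq).le)
    fun q hq hS => ⟨⟨by have : ε ≤ q.1 := hS; linarith, hq.1.2⟩, hq.2⟩

theorem contDiff_deriv_step (ε : ℝ) : ContDiff ℝ ∞ (deriv (step ε)) :=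
  ((contDiff_infty_iff_deriv (f := step ε)).1 (contDiff_step ε)).2

theorem IsTestFunction.deriv_step_neg_mul {a b : ℝ} {φ : ℝ × ℝ → ℝ}
    (hφ : IsTestFunction (rect (-a) b) φ) {ε : ℝ} (hε : 0 < ε) :
    IsTestFunction (rect (-a) 0) (fun q => deriv (step ε) (-q.1) * φ q) :=
  hφ.of_mul (c := fun x => deriv (step ε) (-x)) ((contDiff_deriv_step ε).comp contDiff_neg)
    (isClosed_le continuous_fst (continuous_const (y := -ε)))
    (fun q hq => deriv_step_eq_zero hε (Or.inl (by have : ¬ q.1 ≤ -ε := hq; linarith)))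
    fun q hq hS => ⟨⟨hq.1.1, by have : q.1 ≤ -ε := hS; linarith⟩, hq.2⟩

theorem IsTestFunction.deriv_step_mul {a b : ℝ} {φ : ℝ × ℝ → ℝ}
    (hφ : IsTestFunction (rect (-a) b) φ) {ε : ℝ} (hε : 0 < ε) :
    IsTestFunction (rect 0 b) (fun q => deriv (step ε) q.1 * φ q) :=
  hφ.of_mul (contDiff_deriv_step ε) (isClosed_le (continuous_const (y := ε)) continuous_fst)
    (fun q hq => deriv_step_eq_zero hε (Or.inl (not_le.1 hq)))
    fun q hq hS => ⟨⟨by have : ε ≤ q.1 := hS; linarith, hq.1.2⟩, hq.2⟩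

theorem contDiff_deriv_cutoff (ε : ℝ) : ContDiff ℝ ∞ (deriv (cutoff ε)) :=
  ((contDiff_infty_iff_deriv (f := cutoff ε)).1 (contDiff_cutoff ε)).2

/-! ### Traces -/

theorem abs_lt_of_mem_thickening_vseg {c ε : ℝ} {q : ℝ × ℝ}
    (hq : q ∈ Metric.thickening ε (vseg c)) : |q.1 - c| < ε := by
  obtain ⟨z, hz, hd⟩ := Metric.mem_thickening_iff.1 hq
  rw [Prod.dist_eq, max_lt_iff, Real.dist_eq, show z.1 = c from hz.1] at hd
  exact hd.1

theorem abs_lt_of_mem_thickening_hseg {c d y ε : ℝ} {q : ℝ × ℝ}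
    (hq : q ∈ Metric.thickening ε (hseg c d y)) : |q.2 - y| < ε := by
  obtain ⟨z, hz, hd⟩ := Metric.mem_thickening_iff.1 hq
  rw [Prod.dist_eq, max_lt_iff, Real.dist_eq q.2, show z.2 = y from hz.2] at hd
  exact hd.2

theorem mem_thickening_hseg {c d y ε : ℝ} {q : ℝ × ℝ} (hx : q.1 ∈ Ioo c d) (hy : |q.2 - y| < ε) :
    q ∈ Metric.thickening ε (hseg c d y) := by
  refine Metric.mem_thickening_iff.2 ⟨(q.1, y), ⟨hx, rfl⟩, ?_⟩
  rw [Prod.dist_eq, dist_self, Real.dist_eq, max_eq_right (abs_nonneg _)]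
  exact hy

theorem measurableSet_rect_inter_thickening (c d ε : ℝ) (Γ : Set (ℝ × ℝ)) :
    MeasurableSet (rect c d ∩ Metric.thickening ε Γ) :=
  (measurableSet_rect c d).inter Metric.isOpen_thickening.measurableSet

theorem HasZeroTrace.mono {c d c' d' : ℝ} {Γ Γ' : Set (ℝ × ℝ)} {w w' : ℝ × ℝ → ℝ}
    (h : HasZeroTrace (rect c d) Γ w)
    (hsub : ∀ᶠ ε in 𝓝[>] (0 : ℝ), rect c' d' ∩ Metric.thickening ε Γ' ⊆
      rect c d ∩ Metric.thickening ε Γ)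
    (hw : ∀ q ∈ rect c' d', q ∈ rect c d → ‖w' q‖ₑ ≤ ‖w q‖ₑ) :
    HasZeroTrace (rect c' d') Γ' w' := by
  refine tendsto_of_tendsto_of_tendsto_of_le_of_le' tendsto_const_nhds h
    (Eventually.of_forall fun _ => zero_le) ?_
  filter_upwards [hsub] with ε hε
  gcongr ?_ / _
  calc _ ≤ ∫⁻ p in rect c' d' ∩ Metric.thickening ε Γ', ‖w p‖ₑ :=
        setLIntegral_mono' (measurableSet_rect_inter_thickening _ _ _ _)
          fun q hq => hw q hq.1 (hε hq).1
    _ ≤ _ := lintegral_mono_set hε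

theorem hasZeroTrace_of_eventually_eq_zero {c d : ℝ} {Γ : Set (ℝ × ℝ)} {w : ℝ × ℝ → ℝ}
    (h : ∀ᶠ ε in 𝓝[>] (0 : ℝ), ∀ q ∈ rect c d ∩ Metric.thickening ε Γ, w q = 0) :
    HasZeroTrace (rect c d) Γ w := by
  refine tendsto_const_nhds.congr' ?_
  filter_upwards [h] with ε hε
  rw [setLIntegral_congr_fun (g := fun _ => 0) (measurableSet_rect_inter_thickening _ _ _ _)
    fun q hq => by simp [hε q hq]]
  simp

theorem hasZeroTrace_of_halves {a b : ℝ} {Γ : Set (ℝ × ℝ)} {w : ℝ × ℝ → ℝ}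
    (h1 : HasZeroTrace (rect (-a) 0) Γ w) (h2 : HasZeroTrace (rect 0 b) Γ w) :
    HasZeroTrace (rect (-a) b) Γ w := by
  have h12 := h1.add h2
  rw [add_zero] at h12
  refine tendsto_of_tendsto_of_tendsto_of_le_of_le tendsto_const_nhds h12
    (fun _ => zero_le) fun ε => ?_
  simp only [← ENNReal.add_div]
  gcongr ?_ / _
  refine le_trans ?_ (lintegral_union_le _ _ _)
  refine lintegral_mono_set' ?_
  filter_upwards [ae_fst_ne_zero] with q hq hqm
  exact (mem_halves_of_ne hqm.1 hq).imp (fun h => ⟨h, hqm.2⟩) fun h => ⟨h, hqm.2⟩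

theorem tendsto_three_mul : Tendsto (fun ε : ℝ => 3 * ε) (𝓝[>] 0) (𝓝[>] 0) := by
  refine tendsto_nhdsWithin_iff.2 ⟨?_, ?_⟩
  · have : Continuous fun ε : ℝ => 3 * ε := by fun_prop
    simpa using (this.tendsto 0).mono_left nhdsWithin_le_nhds
  · filter_upwards [self_mem_nhdsWithin] with ε hε
    have : 0 < ε := hε
    exact mem_Ioi.2 (by positivity)

/-- Integrals against kernels of size `1 / ε` supported in the layer of width `3 ε` around `Γ` tend
to zero for functions with zero trace on `Γ`. -/
theorem HasZeroTrace.tendsto_integral {c d K : ℝ} {Γ : Set (ℝ × ℝ)} {w : ℝ × ℝ → ℝ}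
    (h : HasZeroTrace (rect c d) Γ w) (hK : 0 ≤ K) {F : ℝ → ℝ × ℝ → ℝ}
    (h0 : ∀ ε > 0, ∀ q ∈ rect c d, q ∉ Metric.thickening (3 * ε) Γ → F ε q = 0)
    (hF : ∀ ε > 0, ∀ q ∈ rect c d, |F ε q| ≤ K / ε * |w q|) :
    Tendsto (fun ε => ∫ q in rect c d, F ε q) (𝓝[>] 0) (𝓝 0) := by
  rw [tendsto_zero_iff_enorm_tendsto_zero]
  have hlim := ENNReal.Tendsto.const_mul (h.comp tendsto_three_mul) (a := ENNReal.ofReal (3 * K))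
    (Or.inr ENNReal.ofReal_ne_top)
  rw [mul_zero] at hlim
  refine tendsto_of_tendsto_of_tendsto_of_le_of_le' tendsto_const_nhds hlim
    (Eventually.of_forall fun _ => zero_le) ?_
  filter_upwards [self_mem_nhdsWithin] with ε hε
  have hε0 : 0 < ε := hε
  have hm := measurableSet_rect_inter_thickening c d (3 * ε) Γ
  set S := rect c d ∩ Metric.thickening (3 * ε) Γ
  calc ‖∫ q in rect c d, F ε q‖ₑ ≤ ∫⁻ q in rect c d, ‖F ε q‖ₑ := enorm_integral_le_lintegral_enorm _
    _ ≤ ∫⁻ q in rect c d, S.indicator (fun q => ENNReal.ofReal (K / ε) * ‖w q‖ₑ) q := by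
        refine setLIntegral_mono' (measurableSet_rect c d) fun q hq => ?_
        by_cases hqS : q ∈ Metric.thickening (3 * ε) Γ
        · rw [indicator_of_mem (show q ∈ S from ⟨hq, hqS⟩), Real.enorm_eq_ofReal_abs,
            Real.enorm_eq_ofReal_abs, ← ENNReal.ofReal_mul (by positivity)]
          exact ENNReal.ofReal_le_ofReal (hF ε hε0 q hq)
        · rw [h0 ε hε0 q hq hqS, enorm_zero]
          exact zero_le
    _ ≤ ∫⁻ q, S.indicator (fun q => ENNReal.ofReal (K / ε) * ‖w q‖ₑ) q :=
        setLIntegral_le_lintegral _ _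
    _ = ENNReal.ofReal (K / ε) * ∫⁻ q in S, ‖w q‖ₑ := by
        rw [lintegral_indicator hm, lintegral_const_mul' _ _ ENNReal.ofReal_ne_top]
    _ = _ := by
        -- The layer has width `3 ε`, so the zero-trace quotient has to be taken at `3 ε`.
        have e : K / ε = 3 * K / (3 * ε) := by field_simp
        rw [e, ENNReal.ofReal_div_of_pos (by positivity)]
        simp only [div_eq_mul_inv, Function.comp]
        ring

/-! ### Test functions and limits of cut-off integrals -/

theorem IsTestFunction.pderiv {D : Set (ℝ × ℝ)} {φ : ℝ × ℝ → ℝ} (hφ : IsTestFunction D φ)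
    (e : ℝ × ℝ) : IsTestFunction D (pd e φ) where
  smooth := (hφ.smooth.fderiv_right (m := ∞) (by norm_cast)).clm_apply contDiff_const
  compactSupport := hφ.compactSupport.fderiv_apply ℝ e
  support_subset := (tsupport_fderiv_apply_subset ℝ e).trans hφ.support_subset

theorem IsTestFunction.continuous {D : Set (ℝ × ℝ)} {φ : ℝ × ℝ → ℝ} (hφ : IsTestFunction D φ) :
    Continuous φ := hφ.smooth.continuous

theorem IsTestFunction.differentiable {D : Set (ℝ × ℝ)} {φ : ℝ × ℝ → ℝ}
    (hφ : IsTestFunction D φ) : Differentiable ℝ φ := hφ.smooth.differentiable (by simp)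

theorem IsTestFunction.lap_eq {D : Set (ℝ × ℝ)} {φ : ℝ × ℝ → ℝ} (hφ : IsTestFunction D φ)
    (q : ℝ × ℝ) : lap φ q = pd (1, 0) (pd (1, 0) φ) q
      + pd (0, 1) (pd (0, 1) φ) q :=
  SpaceCharge.lap_eq isOpen_univ (hφ.smooth.of_le (by norm_cast)).contDiffOn (mem_univ q)

theorem integrableOn_mul_of_hasCompactSupport {D : Set (ℝ × ℝ)} {F ψ : ℝ × ℝ → ℝ}
    (hF : IntegrableOn F D) (hψ : Continuous ψ) (hc : HasCompactSupport ψ) :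
    IntegrableOn (fun q => F q * ψ q) D := by
  obtain ⟨C, hC⟩ := hc.exists_bound_of_continuous hψ
  exact Integrable.mul_bdd hF hψ.aestronglyMeasurable (Eventually.of_forall hC)

theorem IsTestFunction.integrableOn_mul {D D' : Set (ℝ × ℝ)} {F ψ : ℝ × ℝ → ℝ}
    (hψ : IsTestFunction D' ψ) (hF : IntegrableOn F D) : IntegrableOn (fun q => F q * ψ q) D :=
  integrableOn_mul_of_hasCompactSupport hF hψ.continuous hψ.compactSupport

theorem IsTestFunction.cutoff_mul {D : Set (ℝ × ℝ)} {φ : ℝ × ℝ → ℝ} (hφ : IsTestFunction D φ)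
    (ε : ℝ) : IsTestFunction D (fun q => cutoff ε q.1 * φ q) :=
  hφ.of_mul (contDiff_cutoff ε) isClosed_univ (fun q hq => absurd (mem_univ q) hq)
    fun _ hq _ => hq

theorem IsTestFunction.deriv_cutoff_mul {D : Set (ℝ × ℝ)} {φ : ℝ × ℝ → ℝ}
    (hφ : IsTestFunction D φ) (ε : ℝ) : IsTestFunction D (fun q => deriv (cutoff ε) q.1 * φ q) :=
  hφ.of_mul (contDiff_deriv_cutoff ε) isClosed_univ (fun q hq => absurd (mem_univ q) hq)
    fun _ hq _ => hq

theorem tendsto_integral_cutoff {D : Set (ℝ × ℝ)} {G : ℝ × ℝ → ℝ} (hG : IntegrableOn G D) :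
    Tendsto (fun ε => ∫ q in D, cutoff ε q.1 * G q) (𝓝[>] 0) (𝓝 (∫ q in D, G q)) := by
  refine tendsto_integral_filter_of_dominated_convergence (fun q => ‖G q‖) ?_ ?_ hG.norm ?_
  · refine Eventually.of_forall fun ε => AEStronglyMeasurable.mul ?_ hG.1
    have : Continuous fun q : ℝ × ℝ => cutoff ε q.1 :=
      (contDiff_cutoff ε (n := 1)).continuous.comp continuous_fst
    exact this.aestronglyMeasurable
  · filter_upwards [self_mem_nhdsWithin] with ε hε
    refine Eventually.of_forall fun q => ?_
    rw [norm_mul, Real.norm_eq_abs, abs_of_nonneg (cutoff_nonneg _ _)]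
    exact mul_le_of_le_one_left (norm_nonneg _) (cutoff_le_one hε _)
  · filter_upwards [ae_restrict_of_ae ae_fst_ne_zero] with q hq
    simpa using (tendsto_cutoff hq).mul_const (G q)

theorem tendsto_integral_mul_cutoff_mul {D : Set (ℝ × ℝ)} {F ψ : ℝ × ℝ → ℝ}
    (hF : IntegrableOn (fun q => F q * ψ q) D) :
    Tendsto (fun ε => ∫ q in D, F q * (cutoff ε q.1 * ψ q)) (𝓝[>] 0)
      (𝓝 (∫ q in D, F q * ψ q)) := by
  refine (tendsto_integral_cutoff hF).congr fun ε => ?_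
  exact integral_congr_ae (Eventually.of_forall fun q => by ring)

theorem mem_thickening_vseg_zero {a b ε : ℝ} {q : ℝ × ℝ} (hq : q ∈ rect a b) (h : |q.1| < ε) :
    q ∈ Metric.thickening ε (vseg 0) := by
  have : q ∈ strip a b ε := ⟨hq, h⟩
  rw [strip_eq_thickening] at this
  exact this.2

/-! ### Gluing weak derivatives and subsolutions across the axis -/

section

variable {a b h α : ℝ}

theorem pd_fst_rpow_snd (hα : 1 < α) (q : ℝ × ℝ) :
    pd (1, 0) (fun q : ℝ × ℝ => h * q.2 ^ α) q = 0 := by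
  have hd : DifferentiableAt ℝ (fun q : ℝ × ℝ => h * q.2 ^ α) (q.1, q.2) :=
    (differentiableAt_const h).mul (differentiableAt_snd.rpow_const (Or.inr hα.le))
  exact (hasDerivAt_slice_fst hd).unique (hasDerivAt_const q.1 (h * q.2 ^ α))

theorem integral_rpow_snd_mul_pd (hα : 1 < α) {ψ : ℝ × ℝ → ℝ}
    (hψ : IsTestFunction (rect (-a) b) ψ) :
    ∫ q in rect (-a) b, h * q.2 ^ α * pd (1, 0) ψ q = 0 := by
  rw [integral_mul_pd (isOpen_rect _ _) (contDiffOn_rpow_snd h α b (-a))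
    (hψ.smooth.of_le (by norm_cast)) hψ.compactSupport hψ.support_subset]
  simp only [pd_fst_rpow_snd hα, zero_mul, integral_zero, neg_zero]

theorem integrableOn_rpow_snd (hα : 1 < α) : IntegrableOn (fun q : ℝ × ℝ => h * q.2 ^ α)
    (rect (-a) b) :=
  ((continuous_rpow_snd hα h).continuousOn.integrableOn_compact
    (isCompact_Icc.prod isCompact_Icc : IsCompact (Icc (-a) b ×ˢ Icc (0 : ℝ) 1))).mono_set
    (prod_mono Ioo_subset_Icc_self Ioo_subset_Icc_self)

/-- No mass concentrates on the `y`-axis if the traces from both sides agree. -/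
theorem tendsto_integral_deriv_cutoff (hα : 1 < α) {u : ℝ × ℝ → ℝ}
    (hu : IntegrableOn u (rect (-a) b))
    (htr : HasZeroTrace (rect (-a) b) (vseg 0) (fun q => u q - h * q.2 ^ α))
    {ψ : ℝ × ℝ → ℝ} (hψ : IsTestFunction (rect (-a) b) ψ) :
    Tendsto (fun ε => ∫ q in rect (-a) b, u q * (deriv (cutoff ε) q.1 * ψ q))
      (𝓝[>] 0) (𝓝 0) := by
  obtain ⟨C, hC0, hC⟩ := exists_deriv_step_le
  obtain ⟨M, hM⟩ := hψ.compactSupport.exists_bound_of_continuous hψ.continuous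
  have hM0 : 0 ≤ M := (norm_nonneg _).trans (hM 0)
  have hg := integrableOn_rpow_snd (a := a) (b := b) (h := h) hα
  -- The kernel has size `1 / ε` on a layer of width of order `ε`, exactly what zero trace controls.
  have t1 : Tendsto (fun ε => ∫ q in rect (-a) b, (u q - h * q.2 ^ α) *
      (deriv (cutoff ε) q.1 * ψ q)) (𝓝[>] 0) (𝓝 0) := by
    refine htr.tendsto_integral (K := C * M) (by positivity) (fun ε hε q hq hqn => ?_)
      fun ε hε q hq => ?_
    · have : 3 * ε ≤ |q.1| := not_lt.1 fun hlt => hqn (mem_thickening_vseg_zero hq hlt)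
      rw [deriv_cutoff_eq_zero hε this, zero_mul, mul_zero]
    · rw [abs_mul, abs_mul, mul_comm]
      refine mul_le_mul_of_nonneg_right ?_ (abs_nonneg _)
      calc |deriv (cutoff ε) q.1| * |ψ q| ≤ C / ε * M :=
            mul_le_mul (abs_deriv_cutoff_le hC hε _) (hM q) (abs_nonneg _) (by positivity)
        _ = C * M / ε := by ring
  -- The common trace `h y ^ α` is independent of `x`, so it integrates to zero against any `∂ₓ` of
  -- a test function. Applied to `η ψ`, this trades `η' ψ` for `-η ∂ₓψ`, whose limit is again such
  -- an integral.
  have t2 : Tendsto (fun ε => ∫ q in rect (-a) b, h * q.2 ^ α *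
      (deriv (cutoff ε) q.1 * ψ q)) (𝓝[>] 0) (𝓝 0) := by
    have hlim := (tendsto_integral_mul_cutoff_mul ((hψ.pderiv (1, 0)).integrableOn_mul hg)).neg
    rw [integral_rpow_snd_mul_pd hα hψ, neg_zero] at hlim
    refine hlim.congr fun ε => ?_
    have h1 := integral_rpow_snd_mul_pd (h := h) hα (hψ.cutoff_mul ε)
    have e : ∀ q : ℝ × ℝ, h * q.2 ^ α * pd (1, 0) (fun q => cutoff ε q.1 * ψ q) q =
        h * q.2 ^ α * (cutoff ε q.1 * pd (1, 0) ψ q) +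
          h * q.2 ^ α * (deriv (cutoff ε) q.1 * ψ q) := fun q => by
      rw [pd_fst_mul ((contDiff_cutoff ε (n := 1)).differentiable (by simp)) hψ.differentiable]
      ring
    simp only [e] at h1
    rw [integral_add (((hψ.pderiv (1, 0)).cutoff_mul ε).integrableOn_mul hg)
      ((hψ.deriv_cutoff_mul ε).integrableOn_mul hg)] at h1
    linarith
  have t := t1.add t2
  rw [add_zero] at t
  refine t.congr fun ε => ?_
  have i := hψ.deriv_cutoff_mul ε
  rw [← integral_add (i.integrableOn_mul (F := fun q => u q - h * q.2 ^ α) (hu.sub hg))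
    (i.integrableOn_mul hg)]
  refine integral_congr_ae (Eventually.of_forall fun q => ?_)
  simp only []
  ring

theorem setIntegral_glue_mul (ha : 0 < a) (hb : 0 < b) {uL uR Ψ ΨL ΨR : ℝ × ℝ → ℝ}
    (hi : IntegrableOn (fun q => glue uL uR q * Ψ q) (rect (-a) b))
    (hL : EqOn Ψ ΨL (rect (-a) 0)) (hR : EqOn Ψ ΨR (rect 0 b)) :
    ∫ q in rect (-a) b, glue uL uR q * Ψ q =
      (∫ q in rect (-a) 0, uL q * ΨL q) + ∫ q in rect 0 b, uR q * ΨR q := by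
  rw [setIntegral_eq_halves ha hb hi]
  congr 1
  · exact setIntegral_congr_fun (measurableSet_rect _ _) fun q hq => by
      simp only [glue_of_mem_left hq, hL hq]
  · exact setIntegral_congr_fun (measurableSet_rect _ _) fun q hq => by
      simp only [glue_of_mem_right hq, hR hq]

theorem cutoff_eqOn_left {ε : ℝ} (hε : 0 < ε) (φ : ℝ × ℝ → ℝ) :
    EqOn (fun q => cutoff ε q.1 * φ q) (fun q => step ε (-q.1) * φ q) (rect (-a) 0) :=
  fun q hq => by
    simp only [cutoff, step_eq_zero hε (x := q.1) (by linarith [hq.1.2]), zero_add]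

theorem cutoff_eqOn_right {ε : ℝ} (hε : 0 < ε) (φ : ℝ × ℝ → ℝ) :
    EqOn (fun q => cutoff ε q.1 * φ q) (fun q => step ε q.1 * φ q) (rect 0 b) :=
  fun q hq => by
    simp only [cutoff, step_eq_zero hε (x := -q.1) (by linarith [hq.1.1]), add_zero]

/-- Weak derivatives can be glued along a segment on which the traces agree. -/
theorem isWeakPartial_glue (ha : 0 < a) (hb : 0 < b) (hα : 1 < α) {uL uR vL vR : ℝ × ℝ → ℝ}
    {e : ℝ × ℝ} (hu : IntegrableOn (glue uL uR) (rect (-a) b))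
    (htr : HasZeroTrace (rect (-a) b) (vseg 0) (fun q => glue uL uR q - h * q.2 ^ α))
    (hL : IsWeakPartial (rect (-a) 0) e uL vL) (hR : IsWeakPartial (rect 0 b) e uR vR) :
    IsWeakPartial (rect (-a) b) e (glue uL uR) (glue vL vR) := by
  have hv : IntegrableOn (glue vL vR) (rect (-a) b) := integrableOn_glue ha hb hL.1 hR.1
  refine ⟨hv, fun φ hφ => ?_⟩
  have t1 := tendsto_integral_mul_cutoff_mul ((hφ.pderiv e).integrableOn_mul hu)
  have t2 := (tendsto_integral_mul_cutoff_mul (hφ.integrableOn_mul hv)).neg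
  have t3 := (tendsto_integral_deriv_cutoff hα hu htr hφ).const_mul e.1
  have t := t2.sub t3
  rw [mul_zero, sub_zero] at t
  refine tendsto_nhds_unique (t1.congr' ?_) t
  filter_upwards [self_mem_nhdsWithin] with ε hε
  have hε0 : 0 < ε := hε
  have hcφ := hφ.cutoff_mul ε
  -- For the cut-off test function the identity is exact, being the sum of those on the two halves;
  -- only the term with `η'` separates it from the one for `φ`.
  have e1 : ∫ q in rect (-a) b, glue uL uR q * pd e (fun q => cutoff ε q.1 * φ q) q =
      - ∫ q in rect (-a) b, glue vL vR q * (cutoff ε q.1 * φ q) := by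
    rw [setIntegral_glue_mul ha hb ((hcφ.pderiv e).integrableOn_mul hu)
        (fun q hq => pd_congr (isOpen_rect _ _) (cutoff_eqOn_left hε0 φ) hq e)
        (fun q hq => pd_congr (isOpen_rect _ _) (cutoff_eqOn_right hε0 φ) hq e),
      setIntegral_glue_mul ha hb (hcφ.integrableOn_mul hv) (cutoff_eqOn_left hε0 φ)
        (cutoff_eqOn_right hε0 φ), hL.2 _ (hφ.step_neg_mul hε0), hR.2 _ (hφ.step_mul hε0)]
    ring
  rw [← e1, ← integral_const_mul, ← integral_sub ((hcφ.pderiv e).integrableOn_mul hu)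
    (((hφ.deriv_cutoff_mul ε).integrableOn_mul hu).const_mul e.1)]
  refine integral_congr_ae (Eventually.of_forall fun q => ?_)
  simp only []
  rw [pd_fst_mul ((contDiff_cutoff ε (n := 1)).differentiable (by simp)) hφ.differentiable]
  ring

theorem lap_congr {f g : ℝ × ℝ → ℝ} {U : Set (ℝ × ℝ)} (hU : IsOpen U) (hfg : EqOn f g U)
    {q : ℝ × ℝ} (hq : q ∈ U) : lap f q = lap g q := by
  have h1 : (fun x => f (x, q.2)) =ᶠ[𝓝 q.1] fun x => g (x, q.2) := by
    filter_upwards [eventually_slice_fst hU hq] with t ht using hfg ht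
  have h2 : (fun y => f (q.1, y)) =ᶠ[𝓝 q.2] fun y => g (q.1, y) := by
    filter_upwards [eventually_slice_snd hU hq] with t ht using hfg ht
  rw [lap, lap, h1.iteratedDeriv_eq, h2.iteratedDeriv_eq]

/-- The product rule is grouped so that `η''`, of order `ε⁻²`, appears only inside `∂ₓ(η' φ)`; one
integration by parts then leaves kernels of order `ε⁻¹`. -/
theorem lap_cutoff_mul {D : Set (ℝ × ℝ)} {φ : ℝ × ℝ → ℝ} (hφ : IsTestFunction D φ) (ε : ℝ)
    (q : ℝ × ℝ) : lap (fun q => cutoff ε q.1 * φ q) q = cutoff ε q.1 * lap φ q +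
      pd (1, 0) (fun q => deriv (cutoff ε) q.1 * φ q) q +
      deriv (cutoff ε) q.1 * pd (1, 0) φ q := by
  have hc : Differentiable ℝ (cutoff ε) := (contDiff_cutoff ε (n := 1)).differentiable (by simp)
  have e1 : pd (1, 0) (fun q => cutoff ε q.1 * φ q) = fun q =>
      cutoff ε q.1 * pd (1, 0) φ q + deriv (cutoff ε) q.1 * φ q := by
    funext q
    rw [pd_fst_mul hc hφ.differentiable, one_mul]
  have e2 : pd (0, 1) (fun q => cutoff ε q.1 * φ q) = fun q =>
      cutoff ε q.1 * pd (0, 1) φ q := by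
    funext q
    rw [pd_fst_mul hc hφ.differentiable, zero_mul, add_zero]
  have e3 : pd (1, 0) (fun q => cutoff ε q.1 * pd (1, 0) φ q + deriv (cutoff ε) q.1 * φ q) q =
      pd (1, 0) (fun q => cutoff ε q.1 * pd (1, 0) φ q) q +
        pd (1, 0) (fun q => deriv (cutoff ε) q.1 * φ q) q := by
    have d1 : DifferentiableAt ℝ (fun q => cutoff ε q.1 * pd (1, 0) φ q) q :=
      ((hφ.pderiv (1, 0)).cutoff_mul ε).differentiable q
    have d2 : DifferentiableAt ℝ (fun q => deriv (cutoff ε) q.1 * φ q) q :=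
      (hφ.deriv_cutoff_mul ε).differentiable q
    simp only [pd]
    rw [fderiv_fun_add d1 d2]
    rfl
  rw [(hφ.cutoff_mul ε).lap_eq, e1, e2, e3, pd_fst_mul hc (hφ.pderiv (1, 0)).differentiable,
    pd_fst_mul hc (hφ.pderiv (0, 1)).differentiable, hφ.lap_eq]
  ring

theorem IsTestFunction.integrableOn_mul_lap {D D' : Set (ℝ × ℝ)} {F φ : ℝ × ℝ → ℝ}
    (hφ : IsTestFunction D' φ) (hF : IntegrableOn F D) :
    IntegrableOn (fun q => F q * lap φ q) D := by
  have h1 := (((hφ.pderiv (1, 0)).pderiv (1, 0)).integrableOn_mul hF).add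
    (((hφ.pderiv (0, 1)).pderiv (0, 1)).integrableOn_mul hF)
  refine h1.congr (Eventually.of_forall fun q => ?_)
  simp only [Pi.add_apply, hφ.lap_eq q]
  ring

/-- The contribution of a function with nonpositive derivative on the `y`-axis. -/
theorem tendsto_integral_max_mul {v φ : ℝ × ℝ → ℝ} (hφ : IsTestFunction (rect (-a) b) φ)
    (hv : ∀ K ⊆ vseg 0, IsCompact K → TraceLE (rect (-a) 0) K v 0) :
    Tendsto (fun ε => ∫ q in rect (-a) 0, max (v q) 0 * (deriv (step ε) (-q.1) * φ q))
      (𝓝[>] 0) (𝓝 0) := by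
  obtain ⟨C, hC0, hC⟩ := exists_deriv_step_le
  obtain ⟨M, hM⟩ := hφ.compactSupport.exists_bound_of_continuous hφ.continuous
  have hM0 : 0 ≤ M := (norm_nonneg _).trans (hM 0)
  -- The trace condition is available only on compact parts of the open segment. Projecting the
  -- support of `φ` horizontally to the axis gives one that suffices.
  set K : Set (ℝ × ℝ) := {0} ×ˢ (Prod.snd '' tsupport φ) with hK
  have hKc : IsCompact K := isCompact_singleton.prod (hφ.compactSupport.isCompact.image continuous_snd)
  have hKs : K ⊆ vseg 0 := by
    refine prod_mono le_rfl ?_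
    rintro _ ⟨q, hq, rfl⟩
    exact (hφ.support_subset hq).2
  have htr := hv K hKs hKc
  simp only [TraceLE, Pi.zero_apply, sub_zero] at htr
  refine htr.tendsto_integral (K := C * M) (by positivity) (fun ε hε q hq hqn => ?_)
    fun ε hε q hq => ?_
  · by_cases hqφ : q ∈ tsupport φ
    · have h3 : 3 * ε ≤ -q.1 := by
        by_contra! hlt
        refine hqn (Metric.mem_thickening_iff.2 ⟨(0, q.2), ⟨rfl, q, hqφ, rfl⟩, ?_⟩)
        rw [Prod.dist_eq, dist_self, Real.dist_eq, sub_zero, max_eq_left (abs_nonneg _),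
          abs_of_neg hq.1.2]
        exact hlt
      rw [deriv_step_eq_zero hε (Or.inr (by linarith)), zero_mul, mul_zero]
    · rw [image_eq_zero_of_notMem_tsupport hqφ, mul_zero, mul_zero]
  · rw [abs_mul, abs_mul, mul_comm]
    refine mul_le_mul_of_nonneg_right ?_ (abs_nonneg _)
    rw [abs_of_nonneg (deriv_step_nonneg hε _)]
    calc deriv (step ε) (-q.1) * |φ q| ≤ C / ε * M :=
          mul_le_mul (hC ε hε _) (hM q) (abs_nonneg _) (by positivity)
      _ = C * M / ε := by ring

/-- Subsolutions can be glued along a segment on which the traces agree, if the normal derivative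
does not decrease across it. -/
theorem glue_subsolution_ineq (ha : 0 < a) (hb : 0 < b) (hα : 1 < α)
    {uL uR vL vR f : ℝ × ℝ → ℝ} (hu : IntegrableOn (glue uL uR) (rect (-a) b))
    (htr : HasZeroTrace (rect (-a) b) (vseg 0) (fun q => glue uL uR q - h * q.2 ^ α))
    (hL : IsWeakPartial (rect (-a) 0) (1, 0) uL vL)
    (hvL : ∀ K ⊆ vseg 0, IsCompact K → TraceLE (rect (-a) 0) K vL 0)
    (hR : IsWeakPartial (rect 0 b) (1, 0) uR vR) (hvR : ∀ q ∈ rect 0 b, 0 ≤ vR q)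
    (hf : IntegrableOn f (rect (-a) 0))
    (hineq : ∀ φ : ℝ × ℝ → ℝ, IsTestFunction (rect (-a) 0) φ → (∀ q, 0 ≤ φ q) →
      ∫ q in rect (-a) 0, uL q * (- lap φ q) ≤ ∫ q in rect (-a) 0, - f q * φ q)
    (hharm : ∀ φ : ℝ × ℝ → ℝ, IsTestFunction (rect 0 b) φ → ∫ q in rect 0 b, uR q * lap φ q = 0)
    {φ : ℝ × ℝ → ℝ} (hφ : IsTestFunction (rect (-a) b) φ) (hφ0 : ∀ q, 0 ≤ φ q) :
    ∫ q in rect (-a) b, glue uL uR q * (- lap φ q) ≤ ∫ q in rect (-a) 0, - f q * φ q := by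
  have t1 := (tendsto_integral_mul_cutoff_mul (hφ.integrableOn_mul_lap hu)).neg
  have t2 := tendsto_integral_mul_cutoff_mul (F := fun q => - f q) (hφ.integrableOn_mul hf.neg)
  have t3 := tendsto_integral_max_mul hφ hvL
  have t4 := tendsto_integral_deriv_cutoff hα hu htr (hφ.pderiv (1, 0))
  have t := (t2.add t3).add t4
  rw [add_zero, add_zero] at t
  simp only [mul_neg, integral_neg]
  refine le_of_tendsto_of_tendsto t1 t ?_
  filter_upwards [self_mem_nhdsWithin] with ε hε
  have hε0 : 0 < ε := hε
  have hcφ := hφ.cutoff_mul ε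
  have hdφ := hφ.deriv_cutoff_mul ε
  have hsφ := hφ.deriv_step_neg_mul hε0
  have hsφ' := hφ.deriv_step_mul hε0
  have e1 : ∫ q in rect (-a) b, glue uL uR q * lap (fun q => cutoff ε q.1 * φ q) q =
      ∫ q in rect (-a) 0, uL q * lap (fun q => step ε (-q.1) * φ q) q := by
    rw [setIntegral_glue_mul ha hb (hcφ.integrableOn_mul_lap hu)
      (fun q hq => lap_congr (isOpen_rect _ _) (cutoff_eqOn_left hε0 φ) hq)
      (fun q hq => lap_congr (isOpen_rect _ _) (cutoff_eqOn_right hε0 φ) hq),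
      hharm _ (hφ.step_mul hε0), add_zero]
  have i1 := hineq _ (hφ.step_neg_mul hε0)
    fun q => mul_nonneg (Real.smoothTransition.nonneg _) (hφ0 q)
  simp only [mul_neg, integral_neg] at i1
  have e2 : ∫ q in rect (-a) 0, - f q * (step ε (-q.1) * φ q) =
      ∫ q in rect (-a) 0, - f q * (cutoff ε q.1 * φ q) :=
    setIntegral_congr_fun (measurableSet_rect _ _) fun q hq => by
      simp only [cutoff, step_eq_zero hε0 (x := q.1) (by linarith [hq.1.2]), zero_add]
  -- The cutoff decreases towards the axis from the left and increases away from it on the right;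
  -- hence the normal derivatives enter with opposite signs, as the jump across the axis.
  have e3 : ∫ q in rect (-a) b, glue uL uR q *
        pd (1, 0) (fun q => deriv (cutoff ε) q.1 * φ q) q =
      (∫ q in rect (-a) 0, vL q * (deriv (step ε) (-q.1) * φ q)) -
        ∫ q in rect 0 b, vR q * (deriv (step ε) q.1 * φ q) := by
    have hneg : ∀ q, pd (1, 0) (fun q : ℝ × ℝ => -(deriv (step ε) (-q.1) * φ q)) q =
        - pd (1, 0) (fun q : ℝ × ℝ => deriv (step ε) (-q.1) * φ q) q := fun q => by
      simp only [pd, fderiv_fun_neg]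
      rfl
    rw [setIntegral_glue_mul ha hb ((hdφ.pderiv (1, 0)).integrableOn_mul hu)
      (fun q hq => pd_congr (g := fun q => -(deriv (step ε) (-q.1) * φ q)) (isOpen_rect _ _)
        (fun p hp => by simp only [deriv_cutoff_of_neg hε0 hp.1.2, neg_mul]) hq _)
      (fun q hq => pd_congr (g := fun q => deriv (step ε) q.1 * φ q) (isOpen_rect _ _)
        (fun p hp => by simp only [deriv_cutoff_of_pos hε0 hp.1.1]) hq _)]
    simp only [hneg, mul_neg, integral_neg]
    rw [hL.2 _ hsφ, hR.2 _ hsφ', neg_neg]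
    ring
  have i2 : ∫ q in rect (-a) 0, vL q * (deriv (step ε) (-q.1) * φ q) ≤
      ∫ q in rect (-a) 0, max (vL q) 0 * (deriv (step ε) (-q.1) * φ q) := by
    refine integral_mono (hsφ.integrableOn_mul hL.1)
      (hsφ.integrableOn_mul (F := fun q => max (vL q) 0) hL.1.pos_part) fun q => ?_
    exact mul_le_mul_of_nonneg_right (le_max_left _ _)
      (mul_nonneg (deriv_step_nonneg hε0 _) (hφ0 q))
  have i3 : 0 ≤ ∫ q in rect 0 b, vR q * (deriv (step ε) q.1 * φ q) :=
    setIntegral_nonneg (measurableSet_rect _ _) fun q hq =>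
      mul_nonneg (hvR q hq) (mul_nonneg (deriv_step_nonneg hε0 _) (hφ0 q))
  have e4 : ∫ q in rect (-a) b, glue uL uR q * lap (fun q => cutoff ε q.1 * φ q) q =
      (∫ q in rect (-a) b, glue uL uR q * (cutoff ε q.1 * lap φ q)) +
      (∫ q in rect (-a) b, glue uL uR q *
        pd (1, 0) (fun q => deriv (cutoff ε) q.1 * φ q) q) +
      ∫ q in rect (-a) b, glue uL uR q * (deriv (cutoff ε) q.1 * pd (1, 0) φ q) := by
    have j1 := (hdφ.pderiv (1, 0)).integrableOn_mul hu
    have j2 := ((hφ.pderiv (1, 0)).deriv_cutoff_mul ε).integrableOn_mul hu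
    have j3 : IntegrableOn (fun q => glue uL uR q * (cutoff ε q.1 * lap φ q)) (rect (-a) b) := by
      refine (((hcφ.integrableOn_mul_lap hu).sub j1).sub j2).congr
        (Eventually.of_forall fun q => ?_)
      simp only [Pi.sub_apply, lap_cutoff_mul hφ]
      ring
    have j4 : IntegrableOn (fun q => glue uL uR q * (cutoff ε q.1 * lap φ q) + glue uL uR q *
        pd (1, 0) (fun q => deriv (cutoff ε) q.1 * φ q) q) (rect (-a) b) := j3.add j1
    rw [← integral_add j3 j1, ← integral_add j4 j2]
    refine integral_congr_ae (Eventually.of_forall fun q => ?_)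
    simp only [lap_cutoff_mul hφ]
    ring
  simp only [← e2]
  linarith

end

/-! ### Boundary conditions and assembly -/

section

variable {a b h α : ℝ} {uL uR : ℝ × ℝ → ℝ}

theorem glue_pos (hb : 0 < b) (hα : 1 < α) (hh : h ∈ Ioc (0 : ℝ) 1)
    (hpos : ∀ q ∈ rect (-a) 0, 0 < uL q) (hu : IsHarmonicPart b h α uR) {q : ℝ × ℝ}
    (hq : q ∈ rect (-a) b) : 0 < glue uL uR q := by
  have hp : 0 < h * q.2 ^ α := mul_pos hh.1 (Real.rpow_pos_of_pos hq.2.1 _)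
  rcases lt_trichotomy q.1 0 with h0 | h0 | h0
  · have hq' : q ∈ rect (-a) 0 := ⟨⟨hq.1.1, h0⟩, hq.2⟩
    rw [glue_of_mem_left hq']
    exact hpos q hq'
  · have : q = (0, q.2) := Prod.ext h0 rfl
    rw [glue, if_neg (by rw [h0]; exact lt_irrefl _), this, hu.left _ hq.2]
    exact hp
  · have hq' : q ∈ rect 0 b := ⟨⟨h0, hq.1.2⟩, hq.2⟩
    rw [glue_of_mem_right hq']
    exact hp.trans_le (hu.rpow_le_of_mem_rect hb hα hh hq')

theorem left_inter_thickening_hseg_subset (y : ℝ) :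
    ∀ᶠ ε in 𝓝[>] (0 : ℝ), rect (-a) 0 ∩ Metric.thickening ε (hseg (-a) b y) ⊆
      rect (-a) 0 ∩ Metric.thickening ε (hseg (-a) 0 y) :=
  Eventually.of_forall fun _ _ hq =>
    ⟨hq.1, mem_thickening_hseg hq.1.1 (abs_lt_of_mem_thickening_hseg hq.2)⟩

theorem enorm_sub_le_of_mem_left {g : ℝ × ℝ → ℝ} :
    ∀ q ∈ rect (-a) 0, q ∈ rect (-a) 0 → ‖glue uL uR q - g q‖ₑ ≤ ‖uL q - g q‖ₑ :=
  fun q hq _ => by rw [glue_of_mem_left hq]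

theorem enorm_max_le_of_mem_left {g : ℝ × ℝ → ℝ} :
    ∀ q ∈ rect (-a) 0, q ∈ rect (-a) 0 →
      ‖max (glue uL uR q - g q) 0‖ₑ ≤ ‖max (uL q - g q) 0‖ₑ :=
  fun q hq _ => by rw [glue_of_mem_left hq]

namespace IsHarmonicPart

/-- In the layer of width `ε` one has `0 ≤ u ≤ y < ε` on a set of area at most `b ε`, so the
quotient is at most `b ε`. -/
theorem traceEq_bottom (hu : IsHarmonicPart b h α uR) (hb : 0 < b) (hα : 1 < α)
    (hh : h ∈ Ioc (0 : ℝ) 1) : HasZeroTrace (rect 0 b) (hseg (-a) b 0) uR := by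
  have hlim : Tendsto (fun ε => ENNReal.ofReal b * ENNReal.ofReal ε) (𝓝[>] 0) (𝓝 0) := by
    have h1 : Tendsto ENNReal.ofReal (𝓝[>] 0) (𝓝 0) := by
      have := (ENNReal.continuous_ofReal.tendsto 0).mono_left (nhdsWithin_le_nhds (s := Ioi 0))
      rwa [ENNReal.ofReal_zero] at this
    simpa using ENNReal.Tendsto.const_mul h1 (Or.inr ENNReal.ofReal_ne_top)
  refine tendsto_of_tendsto_of_tendsto_of_le_of_le' tendsto_const_nhds hlim
    (Eventually.of_forall fun _ => zero_le) ?_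
  filter_upwards [self_mem_nhdsWithin] with ε hε
  refine ENNReal.div_le_of_le_mul ?_
  set S := rect 0 b ∩ Metric.thickening ε (hseg (-a) b 0)
  have hbd : ∀ q ∈ S, q.2 < ε ∧ ‖uR q‖ₑ ≤ ENNReal.ofReal ε := fun q hq => by
    have h1 := abs_lt_of_mem_thickening_hseg hq.2
    rw [sub_zero] at h1
    have h2 := hu.le_snd_of_mem_rect hb hα hh hq.1
    have h3 := hu.rpow_le_of_mem_rect hb hα hh hq.1
    have h4 : 0 ≤ h * q.2 ^ α := mul_nonneg hh.1.le (Real.rpow_nonneg hq.1.2.1.le _)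
    have h5 := (le_abs_self q.2).trans_lt h1
    refine ⟨h5, ?_⟩
    rw [Real.enorm_of_nonneg (by linarith)]
    exact ENNReal.ofReal_le_ofReal (by linarith)
  have hvol : volume S ≤ ENNReal.ofReal b * ENNReal.ofReal ε := by
    have : S ⊆ Ioo 0 b ×ˢ Ioo 0 ε := fun q hq => ⟨hq.1.1, hq.1.2.1, (hbd q hq).1⟩
    refine (measure_mono this).trans_eq ?_
    rw [Measure.volume_eq_prod, Measure.prod_prod, Real.volume_Ioo, Real.volume_Ioo, sub_zero,
      sub_zero]
  calc ∫⁻ q in S, ‖uR q‖ₑ ≤ ∫⁻ _ in S, ENNReal.ofReal ε :=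
        setLIntegral_mono measurable_const fun q hq => (hbd q hq).2
    _ = ENNReal.ofReal ε * volume S := by rw [setLIntegral_const]
    _ ≤ ENNReal.ofReal ε * (ENNReal.ofReal b * ENNReal.ofReal ε) := by gcongr
    _ = _ := by ring

end IsHarmonicPart

theorem hasZeroTrace_glue_axis (hα : 1 < α) (hh : h ∈ Ioc (0 : ℝ) 1) (hb : 0 < b)
    (hdir : TraceEq (rect (-a) 0) (vseg 0) uL (fun q => h * q.2 ^ α))
    (hu : IsHarmonicPart b h α uR) :
    HasZeroTrace (rect (-a) b) (vseg 0) (fun q => glue uL uR q - h * q.2 ^ α) := by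
  refine hasZeroTrace_of_halves (HasZeroTrace.mono hdir
    (Eventually.of_forall fun _ => Subset.rfl) enorm_sub_le_of_mem_left) ?_
  have h1 := hu.tendsto_strip hb hα hh
  simp only [strip_eq_thickening] at h1
  exact HasZeroTrace.mono (w := fun q => uR q - h * q.2 ^ α) h1
    (Eventually.of_forall fun _ => Subset.rfl) fun q hq _ => by rw [glue_of_mem_right hq]

theorem left_inter_subset_of_forall_lt {Γ : Set (ℝ × ℝ)}
    (h : ∀ᶠ ε in 𝓝[>] (0 : ℝ), ∀ q ∈ Metric.thickening ε Γ, q.1 < 0) :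
    ∀ᶠ ε in 𝓝[>] (0 : ℝ), rect (-a) b ∩ Metric.thickening ε Γ ⊆
      rect (-a) 0 ∩ Metric.thickening ε Γ := by
  filter_upwards [h] with ε hε q hq
  exact ⟨⟨⟨hq.1.1.1, hε q hq.2⟩, hq.1.2⟩, hq.2⟩

/-- Since `j` vanishes on the right, the current term is almost everywhere the extension by zero of
the left one. -/
theorem memLp_current {j : ℝ → ℝ} {p : ENNReal} (hb : 0 < b)
    (hj : ∀ x ∈ Ioo 0 b, j x = 0)
    (hL : MemLp (fun q : ℝ × ℝ => j q.1 / √(uL q)) p (volume.restrict (rect (-a) 0))) :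
    MemLp (fun q : ℝ × ℝ => j q.1 / √(glue uL uR q)) p (volume.restrict (rect (-a) b)) := by
  have h1 : MemLp ((rect (-a) 0).indicator fun q : ℝ × ℝ => j q.1 / √(uL q)) p
      (volume.restrict (rect (-a) b)) := by
    rw [memLp_indicator_iff_restrict (measurableSet_rect _ _),
      Measure.restrict_restrict_of_subset (rect_left_subset hb)]
    exact hL
  refine h1.ae_eq ?_
  filter_upwards [ae_restrict_mem (measurableSet_rect _ _), ae_restrict_of_ae ae_fst_ne_zero]
    with q hq hq0
  rcases mem_halves_of_ne hq hq0 with h | h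
  · rw [indicator_of_mem h, glue_of_mem_left h]
  · rw [indicator_of_notMem fun h' => lt_asymm h'.1.2 h.1.1, hj _ h.1, zero_div]

end

theorem glue_isPosSubsolution {a b h α : ℝ} (ha : 0 < a) (hb : 0 < b)
    {j : ℝ → ℝ} (hj : ∀ x ∈ Set.Ioo 0 b, j x = 0) (hα : 1 < α)
    (hh : h ∈ Set.Ioc (0 : ℝ) 1) {p₀ : ℝ} (hp₀ : 1 ≤ p₀) {uL uR : ℝ × ℝ → ℝ}
    (hsub : IsPosSubsolution a 0 j (fun y => h * y ^ α) p₀ uL)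
    (hdir : TraceEq (rect (-a) 0) (vseg 0) uL (fun q => h * q.2 ^ α))
    (hdec : PartialNonposOn (rect (-a) 0) (vseg 0) (1, 0) uL)
    (hpos : ∀ q ∈ rect (-a) 0, 0 < uL q) (hu : IsHarmonicPart b h α uR) :
    IsPosSubsolution a b j (fun y => y) p₀ (glue uL uR) := by
  have htr := hasZeroTrace_glue_axis hα hh hb hdir hu
  have hint : IntegrableOn (glue uL uR) (rect (-a) b) :=
    integrableOn_glue ha hb hsub.memW11.1 hu.integrableOn
  have hwx := hu.isWeakPartial (hu.integrableOn_pd_fst hb hα hh)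
  have hwy := hu.isWeakPartial (hu.integrableOn_pd_snd hb hα hh)
  -- With the finite measure of the rectangles this makes the current term integrable.
  have hp1 : 1 ≤ ENNReal.ofReal p₀ := by rwa [ENNReal.one_le_ofReal]
  have hfin : ∀ c d, IsFiniteMeasure ((volume : Measure (ℝ × ℝ)).restrict (rect c d)) :=
    fun c d => isFiniteMeasure_restrict.2 (volume_rect_lt_top c d).ne
  have hmem := memLp_current (uR := uR) hb hj hsub.memLp
  have hposall : ∀ q ∈ rect (-a) b, 0 < glue uL uR q := fun q hq => glue_pos hb hα hh hpos hu hq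
  refine ⟨⟨hint, ?_, ?_⟩, ae_restrict_of_forall_mem (measurableSet_rect _ _) hposall, hmem, ?_,
    ?_, ?_, ?_, ?_⟩
  · obtain ⟨vL, hvL⟩ := hsub.memW11.2.1
    exact ⟨_, isWeakPartial_glue ha hb hα hint htr hvL hwx⟩
  · obtain ⟨vL, hvL⟩ := hsub.memW11.2.2
    exact ⟨_, isWeakPartial_glue ha hb hα hint htr hvL hwy⟩
  · intro φ hφ hφ0
    obtain ⟨vL, hvL, hvL'⟩ := hdec
    have hi : IntegrableOn (fun q : ℝ × ℝ => -(j q.1 / √(glue uL uR q)) * φ q) (rect (-a) b) :=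
      hφ.integrableOn_mul (hmem.integrable hp1).neg
    refine (glue_subsolution_ineq ha hb hα hint htr hvL hvL' hwx
      (fun q hq => hu.pd_fst_nonneg hb hα hh hq) (hsub.memLp.integrable hp1) hsub.ineq
      (fun ψ hψ => hu.integral_mul_lap hψ) hφ hφ0).trans_eq ?_
    rw [setIntegral_eq_halves ha hb hi]
    have e : ∫ q in rect 0 b, -(j q.1 / √(glue uL uR q)) * φ q = 0 :=
      setIntegral_eq_zero_of_forall_eq_zero fun q hq => by simp [hj _ hq.1]
    rw [e, add_zero]
    exact setIntegral_congr_fun (measurableSet_rect _ _) fun q hq => by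
      simp only [glue_of_mem_left hq]
  · exact hasZeroTrace_of_halves (HasZeroTrace.mono hsub.bottom
      (left_inter_thickening_hseg_subset 0) enorm_sub_le_of_mem_left)
      (HasZeroTrace.mono (hu.traceEq_bottom (a := a) hb hα hh)
        (Eventually.of_forall fun _ => Subset.rfl)
        fun q hq _ => by rw [glue_of_mem_right hq, sub_zero])
  · refine hasZeroTrace_of_halves (HasZeroTrace.mono hsub.top
      (left_inter_thickening_hseg_subset 1) enorm_max_le_of_mem_left)
      (hasZeroTrace_of_eventually_eq_zero (Eventually.of_forall fun ε q hq => ?_))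
    rw [glue_of_mem_right hq.1, max_eq_right]
    have := hu.le_snd_of_mem_rect hb hα hh hq.1
    linarith [hq.1.2.2]
  · refine HasZeroTrace.mono hsub.left (left_inter_subset_of_forall_lt ?_)
      fun q _ hq => by rw [glue_of_mem_left hq]
    filter_upwards [Ioo_mem_nhdsGT ha] with ε hε q hq
    have := (abs_lt.1 (abs_lt_of_mem_thickening_vseg hq)).2
    linarith [hε.2]
  -- Thin layers around `x = b` lie in the right half, where `u ≤ y` makes the positive part vanish
  -- identically.
  · refine hasZeroTrace_of_eventually_eq_zero ?_
    filter_upwards [Ioo_mem_nhdsGT hb] with ε hε q hq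
    have h1 := (abs_lt.1 (abs_lt_of_mem_thickening_vseg hq.2)).1
    have hq' : q ∈ rect 0 b := ⟨⟨by linarith [hε.2], hq.1.1.2⟩, hq.1.2⟩
    rw [glue_of_mem_right hq', max_eq_right]
    have := hu.le_snd_of_mem_rect hb hα hh hq'
    linarith

theorem glue_additionalConditions {a b h α : ℝ} (ha : 0 < a) (hb : 0 < b) (hα : 1 < α)
    (hh : h ∈ Set.Ioc (0 : ℝ) 1) {uL uR : ℝ × ℝ → ℝ} (hL : IntegrableOn uL (rect (-a) 0))
    (hdir : TraceEq (rect (-a) 0) (vseg 0) uL (fun q => h * q.2 ^ α))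
    (hac : AdditionalConditions a 0 uL) (hu : IsHarmonicPart b h α uR) :
    AdditionalConditions a b (glue uL uR) := by
  refine ⟨?_, fun q hq => glue_pos hb hα hh hac.pos hu hq⟩
  obtain ⟨vL, hvL, hvL'⟩ := hac.flat
  refine ⟨_, isWeakPartial_glue ha hb hα (integrableOn_glue ha hb hL hu.integrableOn)
    (hasZeroTrace_glue_axis hα hh hb hdir hu) hvL
    (hu.isWeakPartial (hu.integrableOn_pd_snd hb hα hh)), fun K hK hKc => ?_⟩
  refine HasZeroTrace.mono (hvL' K hK hKc) (left_inter_subset_of_forall_lt ?_)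
    fun q _ hq => by rw [glue_of_mem_left hq]
  -- A compact part of the open segment keeps a positive distance from the axis, so thin layers
  -- around it see only the left function.
  obtain ⟨δ, hδ, hδK⟩ := hKc.exists_thickening_subset_open
    (isOpen_Iio.preimage continuous_fst : IsOpen (Prod.fst ⁻¹' Set.Iio (0 : ℝ)))
    fun q hq => (hK hq).1.2
  filter_upwards [Ioo_mem_nhdsGT hδ] with ε hε q hq
  exact hδK (Metric.thickening_mono hε.2.le _ hq)

end SpaceCharge

end

theorem proposition31 (a b : ℝ) (ha : 0 < a) (hb : 0 < b)
    (j : ℝ → ℝ) (hj : SpaceCharge.IsCurrentDensity a b j)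
    (α : ℝ) (hα : α ∈ Set.Ioo (1 : ℝ) (4 / 3)) (h : ℝ) (hh : h ∈ Set.Ioc (0 : ℝ) 1)
    (p₀ : ℝ) (hp₀ : 1 ≤ p₀) (uL : ℝ × ℝ → ℝ)
    (hsub : SpaceCharge.IsPosSubsolution a 0 j (fun y => h * y ^ α) p₀ uL)
    (hdir : SpaceCharge.TraceEq (SpaceCharge.rect (-a) 0) (SpaceCharge.vseg 0) uL
      (fun q => h * q.2 ^ α))
    (hdec : SpaceCharge.PartialNonposOn (SpaceCharge.rect (-a) 0) (SpaceCharge.vseg 0) (1, 0) uL)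
    (hac : SpaceCharge.AdditionalConditions a 0 uL) :
    (∃ uR : ℝ × ℝ → ℝ, SpaceCharge.IsHarmonicPart b h α uR) ∧
    ∀ uR : ℝ × ℝ → ℝ, SpaceCharge.IsHarmonicPart b h α uR →
      SpaceCharge.IsPosSubsolution a b j (fun y => y) p₀ (SpaceCharge.glue uL uR) ∧
      SpaceCharge.AdditionalConditions a b (SpaceCharge.glue uL uR) :=
  ⟨SpaceCharge.exists_isHarmonicPart hb hα.1, fun _ hu =>
    ⟨SpaceCharge.glue_isPosSubsolution ha hb hj.zero hα.1 hh hp₀ hsub hdir hdec hac.pos hu,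
      SpaceCharge.glue_additionalConditions ha hb hα.1 hh hsub.memW11.1 hdir hac hu⟩⟩
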